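/- **Setting.** Let $\delta>0$, and let $u_0\in C^1(\mathbb R)$ be an admissible initial condition: $u_0>0$, $u_0(x)\to0$ as $x\to\pm\infty$, $u_0$ attains its maximum $u_{\max}$ at a point $x_{\max}$, $u_0'(x)\neq0$ for $x\ne x_{\max}$, and $\int_{\mathbb R}(x^2+1)u_0(x)\,dx<\infty$. Let $W_0,W_{-1}$ be the standard branches of the Lambert $W$-function (values on the cuts are taken from above). Put $\zeta(\kappa)=\kappa\cot(2\delta\kappa)+i\kappa$ for $0<\kappa<\pi/2\delta$, $\zeta(0)=1/(2\delta)$, $$E(\zeta)=-\zeta+\tfrac1{2\delta}\bigl(1+\log(2\delta\zeta)\bigr),\qquad \zeta_{\max}=-\tfrac1{2\delta}W_{-1}\bigl(-e^{2\delta u_{\max}-1}\bigr),\qquad \kappa_{\max}=\operatorname{Im}\zeta_{\max}.$$ For $\zeta=\zeta(\kappa)$, $0<\kappa\le\kappa_{\max}$, let $x_-(\zeta)\le x_{\max}\le x_+(\zeta)$ be the turning points, defined by $u_0(x_\pm(\zeta))=E(\zeta)$, and define, with $a(\zeta,y)=-2\delta\zeta e^{-2\delta(\zeta+u_0(y))}$,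 $$R^{\rm Wyl}(\zeta)=\frac1{4\delta}\int_{x_-(\zeta)}^{x_+(\zeta)}\bigl[W_0(a(\zeta,y))-W_{-1}(a(\zeta,y))\bigr]dy,\qquad \rho^{\rm Wyl}(\kappa)=-\frac{d}{d\kappa}R^{\rm Wyl}(\zeta(\kappa)),$$ $$\theta_+(\zeta)=\operatorname{Im}(\zeta)\,x_+(\zeta)+\int_{x_+(\zeta)}^{\infty}\operatorname{Im}\Bigl(\zeta+\tfrac1{2\delta}W_{-1}(a(\zeta,y))\Bigr)dy,\qquad \theta_+(\tfrac1{2\delta})=0,$$ $$V(\zeta;x,t)=x\operatorname{Im}\zeta+t\operatorname{Im}\bigl(\zeta-\tfrac1{2\delta}\bigr)^2-\theta_+(\zeta),\qquad \mathcal L[\rho](\lambda)=\frac1\pi\int_0^{\kappa_{\max}}\log\left|\frac{\lambda-\zeta(\eta)^*}{\lambda-\zeta(\eta)}\right|\rho(\eta)\,d\eta .$$ Let $\mathcal A$ be the set of real measurable functions $\rho$ on $[0,\kappa_{\max}]$ with $0\le\rho\le\rho^{\rm Wyl}$ (functions are identified when they agree almost everywhere, and pointwise conditions are understood almost everywhere),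 and let $$\mathcal E[\rho](x,t)=\int_0^{\kappa_{\max}}\Bigl(V(\zeta(\kappa);x,t)+\tfrac12\mathcal L[\rho](\zeta(\kappa))\Bigr)\rho(\kappa)\,d\kappa .$$ **Theorem.** Let $(x,t)\in\mathbb R^2$. 1. For every $\rho\in\mathcal A$ the integral defining $\mathcal L[\rho](\zeta(\kappa))$ converges absolutely for every $\kappa\in[0,\kappa_{\max}]$, and so does the integral defining $\mathcal E[\rho](x,t)$. 2. There is a minimizer $\rho^{\min}=\rho^{\min}(\cdot\,;x,t)$ of $\mathcal E[\cdot](x,t)$ over $\mathcal A$, and it is unique. 3. For $\rho\in\mathcal A$ put $\frac{\delta E}{\delta\rho}\{\rho\}(\zeta;x,t)=V(\zeta;x,t)+\mathcal L[\rho](\zeta)$, and let $I_+,I_0,I_-$ be the sets of $\kappa\in[0,\kappa_{\max}]$ at which $\frac{\delta E}{\delta\rho}\{\rho\}(\zeta(\kappa);x,t)$ is positive, zero and negative respectively. Then $\rho$ is the minimizer if and only if it satisfies the variational conditions $$\rho=0 \text{ on } I_+ \text{ (voids)},\qquad 0\le\rho\le\rho^{\rm Wyl}\text{ on } I_0\text{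 (bands)},\qquad \rho=\rho^{\rm Wyl}\text{ on } I_-\text{ (saturations)}.$$ 4. $\frac{\delta E}{\delta\rho}\{\rho\}$ is the Fréchet derivative of the energy on $\mathcal A\subset L^1[0,\kappa_{\max}]$: for each $\rho\in\mathcal A$ the map $h\mapsto\int_0^{\kappa_{\max}}\frac{\delta E}{\delta\rho}\{\rho\}(\zeta(\kappa);x,t)\,h(\kappa)\,d\kappa$ is a continuous linear functional on $L^1[0,\kappa_{\max}]$, and it is the Fréchet derivative of $\mathcal E[\cdot](x,t)$ at $\rho$ relative to $\mathcal A$, with respect to the $L^1$ norm. -/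

import Mathlib

open MeasureTheory Set Filter Topology

noncomputable section

namespace ILW

/-- Admissible initial condition with its maximum at `xm`: `C¹`, positive, decaying at `±∞`,
single lobed (the derivative vanishes at most at the maximum point), with finite second moment. -/
structure IsAdmissibleInitialCondition (u₀ : ℝ → ℝ) (xm : ℝ) : Prop where
  contDiff : ContDiff ℝ 1 u₀
  pos : ∀ x, 0 < u₀ x
  tendsto_atTop : Tendsto u₀ atTop (𝓝 0)
  tendsto_atBot : Tendsto u₀ atBot (𝓝 0)
  le_max : ∀ x, u₀ x ≤ u₀ xm
  deriv_ne_zero : ∀ x, x ≠ xm → deriv u₀ x ≠ 0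
  integrable_moment : Integrable (fun x : ℝ => (x ^ 2 + 1) * u₀ x)

/-! ### The branches `W₀` and `W₋₁` of the Lambert function -/

/-- The range of the principal branch `W₀`: the region to the right of the curve
`b ↦ -b cot b + i b`, `|b| < π`, together with the upper half of that curve and its vertex `-1`
(values on the cut are the limits from above). -/
def lambertRangeZero : Set ℂ :=
  {w | (w.im = 0 ∧ -1 ≤ w.re) ∨
    (0 < w.im ∧ w.im < Real.pi ∧ -w.im * Real.cot w.im ≤ w.re) ∨
    (-Real.pi < w.im ∧ w.im < 0 ∧ -w.im * Real.cot w.im < w.re)}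

/-- The range of the branch `W₋₁`: it is bounded above by the half line `(-∞, -1]` and the curve
`b ↦ -b cot b + i b`, `-π < b < 0` (both included), and below by the curve
`b ↦ -b cot b + i b`, `-3π < b < -2π` (excluded). -/
def lambertRangeNegOne : Set ℂ :=
  {w | (w.im = 0 ∧ w.re ≤ -1) ∨
    (-Real.pi < w.im ∧ w.im < 0 ∧ w.re ≤ -w.im * Real.cot w.im) ∨
    (-(2 * Real.pi) ≤ w.im ∧ w.im ≤ -Real.pi) ∨
    (-(3 * Real.pi) < w.im ∧ w.im < -(2 * Real.pi) ∧ -w.im * Real.cot w.im < w.re)}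

/-- The principal branch `W₀`: the solution `w` of `w eʷ = z` in the range of that branch. -/
def lambertW0 (z : ℂ) : ℂ :=
  Classical.epsilon fun w : ℂ => w ∈ lambertRangeZero ∧ w * Complex.exp w = z

/-- The branch `W₋₁` (for `z ≠ 0`): the solution `w` of `w eʷ = z` in the range of that branch. -/
def lambertWNegOne (z : ℂ) : ℂ :=
  Classical.epsilon fun w : ℂ => w ∈ lambertRangeNegOne ∧ w * Complex.exp w = z

/-! ### The quadratrix and the turning points -/

/-- Parametrization of the quadratrix by the imaginary part, `ζ(κ) = κ cot(2δκ) + iκ`, with its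
continuous value `ζ(0) = 1/(2δ)` at the vertex. -/
def quadZeta (δ κ : ℝ) : ℂ :=
  if κ = 0 then 1 / (2 * (δ : ℂ)) else (κ * Real.cot (2 * δ * κ) : ℝ) + κ * Complex.I

/-- `E(ζ) = -ζ + (1 + log(2δζ)) / (2δ)`, which is real on the quadratrix. -/
def levelE (δ : ℝ) (ζ : ℂ) : ℂ :=
  -ζ + 1 / (2 * (δ : ℂ)) * (1 + Complex.log (2 * δ * ζ))

/-- `ζ_max = -W₋₁(-exp(2δ u_max - 1)) / (2δ)`, where `u_max = u₀ xm`. -/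
def zetaMax (δ : ℝ) (u₀ : ℝ → ℝ) (xm : ℝ) : ℂ :=
  -(1 / (2 * (δ : ℂ))) * lambertWNegOne (-Complex.exp (2 * δ * u₀ xm - 1))

/-- `κ_max = Im ζ_max`. -/
def kappaMax (δ : ℝ) (u₀ : ℝ → ℝ) (xm : ℝ) : ℝ := (zetaMax δ u₀ xm).im

/-- The right turning point `x₊(ζ) ≥ xm`, given by `u₀(x₊(ζ)) = E(ζ)`. (For `ζ = ζ(κ)` with
`0 < κ ≤ κ_max` there is exactly one such point, so the supremum just picks it.) -/
def turningRight (δ : ℝ) (u₀ : ℝ → ℝ) (xm : ℝ) (ζ : ℂ) : ℝ :=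
  sSup {x : ℝ | xm ≤ x ∧ (u₀ x : ℂ) = levelE δ ζ}

/-- The left turning point `x₋(ζ) ≤ xm`, given by `u₀(x₋(ζ)) = E(ζ)`. -/
def turningLeft (δ : ℝ) (u₀ : ℝ → ℝ) (xm : ℝ) (ζ : ℂ) : ℝ :=
  sSup {x : ℝ | x ≤ xm ∧ (u₀ x : ℂ) = levelE δ ζ}

/-- The argument `-2δζ exp(-2δ(ζ + u))` of the Lambert functions. -/
def lambertArg (δ : ℝ) (ζ : ℂ) (u : ℝ) : ℂ :=
  -(2 * δ * ζ) * Complex.exp (-(2 * δ) * (ζ + u))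

/-! ### The Weyl law -/

/-- The integrand `W₀ - W₋₁` of the Weyl law, which is real in the classically allowed region. -/
def weylIntegrand (δ : ℝ) (u₀ : ℝ → ℝ) (ζ : ℂ) (x : ℝ) : ℝ :=
  (lambertW0 (lambertArg δ ζ (u₀ x)) - lambertWNegOne (lambertArg δ ζ (u₀ x))).re

/-- `R(ζ) = (1/4δ) ∫_{x₋(ζ)}^{x₊(ζ)} (W₀ - W₋₁) dx`; at the vertex `ζ = 1/(2δ)` the turning points
are `±∞`. -/
def weylR (δ : ℝ) (u₀ : ℝ → ℝ) (xm : ℝ) (ζ : ℂ) : ℝ :=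
  if ζ = 1 / (2 * (δ : ℂ)) then 1 / (4 * δ) * ∫ x, weylIntegrand δ u₀ ζ x
  else 1 / (4 * δ) *
    ∫ x in (turningLeft δ u₀ xm ζ)..(turningRight δ u₀ xm ζ), weylIntegrand δ u₀ ζ x

/-- The Weyl density `ρ^Wyl(κ) = -d/dκ R(ζ(κ))`. -/
def rhoWeyl (δ : ℝ) (u₀ : ℝ → ℝ) (xm : ℝ) (κ : ℝ) : ℝ :=
  -deriv (fun s : ℝ => weylR δ u₀ xm (quadZeta δ s)) κ

/-! ### The energy functional -/

/-- The right tail integral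
`θ₊(ζ) = Im ζ · x₊(ζ) + ∫_{x₊(ζ)}^∞ Im (ζ + W₋₁(-2δζ exp(-2δ(ζ + u₀(x)))) / (2δ)) dx`.
(At the vertex `κ = 0`, where `x₊ = +∞`, both terms of this definition are `0`.) -/
def thetaPlus (δ : ℝ) (u₀ : ℝ → ℝ) (xm : ℝ) (ζ : ℂ) : ℝ :=
  ζ.im * turningRight δ u₀ xm ζ +
    ∫ x in Ioi (turningRight δ u₀ xm ζ),
      (ζ + 1 / (2 * (δ : ℂ)) * lambertWNegOne (lambertArg δ ζ (u₀ x))).im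

/-- The external potential `V(ζ; x, t) = x Im ζ + t Im (ζ - 1/(2δ))² - θ₊(ζ)`. -/
def potentialV (δ : ℝ) (u₀ : ℝ → ℝ) (xm x t : ℝ) (ζ : ℂ) : ℝ :=
  x * ζ.im + t * ((ζ - 1 / (2 * (δ : ℂ))) ^ 2).im - thetaPlus δ u₀ xm ζ

/-- Lebesgue measure on `[0, κ_max]`. -/
def kappaMeasure (δ : ℝ) (u₀ : ℝ → ℝ) (xm : ℝ) : Measure ℝ :=
  volume.restrict (Icc 0 (kappaMax δ u₀ xm))

/-- The kernel `log |(lam - ζ(η)^*) / (lam - ζ(η))|`. -/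
def logKernel (δ : ℝ) (lam : ℂ) (η : ℝ) : ℝ :=
  Real.log ‖(lam - (starRingEnd ℂ) (quadZeta δ η)) / (lam - quadZeta δ η)‖

/-- The logarithmic potential
`L[ρ](lam) = (1/π) ∫_0^{κ_max} log |(lam - ζ(η)^*) / (lam - ζ(η))| ρ(η) dη`. -/
def logPotential (δ : ℝ) (u₀ : ℝ → ℝ) (xm : ℝ) (ρ : ℝ → ℝ) (lam : ℂ) : ℝ :=
  1 / Real.pi * ∫ η, logKernel δ lam η * ρ η ∂(kappaMeasure δ u₀ xm)

/-- The integrand `(V(ζ(κ)) + L[ρ](ζ(κ)) / 2) ρ(κ)` of the energy. -/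
def energyDensity (δ : ℝ) (u₀ : ℝ → ℝ) (xm x t : ℝ) (ρ : ℝ → ℝ) (κ : ℝ) : ℝ :=
  (potentialV δ u₀ xm x t (quadZeta δ κ) +
    1 / 2 * logPotential δ u₀ xm ρ (quadZeta δ κ)) * ρ κ

/-- The energy `E[ρ](x, t) = ∫_0^{κ_max} (V(ζ(κ); x, t) + L[ρ](ζ(κ)) / 2) ρ(κ) dκ`. -/
def energy (δ : ℝ) (u₀ : ℝ → ℝ) (xm x t : ℝ) (ρ : ℝ → ℝ) : ℝ :=
  ∫ κ, energyDensity δ u₀ xm x t ρ κ ∂(kappaMeasure δ u₀ xm)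

/-- The set `𝒜` of admissible densities: measurable `ρ` on `[0, κ_max]` with `0 ≤ ρ ≤ ρ^Wyl`.
Densities are only distinguished up to null sets. -/
def admissibleDensities (δ : ℝ) (u₀ : ℝ → ℝ) (xm : ℝ) : Set (ℝ → ℝ) :=
  {ρ | AEMeasurable ρ (kappaMeasure δ u₀ xm) ∧
    ∀ᵐ κ ∂(kappaMeasure δ u₀ xm), 0 ≤ ρ κ ∧ ρ κ ≤ rhoWeyl δ u₀ xm κ}

/-- `ρ` is a minimizing density: it lies in `𝒜` and minimizes the energy over `𝒜`. -/
def IsMinimizingDensity (δ : ℝ) (u₀ : ℝ → ℝ) (xm x t : ℝ) (ρ : ℝ → ℝ) : Prop :=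
  ρ ∈ admissibleDensities δ u₀ xm ∧
    IsMinOn (energy δ u₀ xm x t) (admissibleDensities δ u₀ xm) ρ

/-- The function `δE/δρ{ρ}(ζ; x, t) = V(ζ; x, t) + L[ρ](ζ)`. -/
def energyDerivative (δ : ℝ) (u₀ : ℝ → ℝ) (xm x t : ℝ) (ρ : ℝ → ℝ) (ζ : ℂ) : ℝ :=
  potentialV δ u₀ xm x t ζ + logPotential δ u₀ xm ρ ζ

/-- The set `I₊` of voids. -/
def voids (δ : ℝ) (u₀ : ℝ → ℝ) (xm x t : ℝ) (ρ : ℝ → ℝ) : Set ℝ :=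
  {κ | κ ∈ Icc 0 (kappaMax δ u₀ xm) ∧ 0 < energyDerivative δ u₀ xm x t ρ (quadZeta δ κ)}

/-- The set `I₀` of bands. -/
def bands (δ : ℝ) (u₀ : ℝ → ℝ) (xm x t : ℝ) (ρ : ℝ → ℝ) : Set ℝ :=
  {κ | κ ∈ Icc 0 (kappaMax δ u₀ xm) ∧ energyDerivative δ u₀ xm x t ρ (quadZeta δ κ) = 0}

/-- The set `I₋` of saturations. -/
def saturations (δ : ℝ) (u₀ : ℝ → ℝ) (xm x t : ℝ) (ρ : ℝ → ℝ) : Set ℝ :=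
  {κ | κ ∈ Icc 0 (kappaMax δ u₀ xm) ∧ energyDerivative δ u₀ xm x t ρ (quadZeta δ κ) < 0}

/-- The variational conditions, for almost every `κ ∈ [0, κ_max]`. -/
def VariationalConditions (δ : ℝ) (u₀ : ℝ → ℝ) (xm x t : ℝ) (ρ : ℝ → ℝ) : Prop :=
  ∀ᵐ κ ∂(kappaMeasure δ u₀ xm),
    (κ ∈ voids δ u₀ xm x t ρ → ρ κ = 0) ∧
    (κ ∈ bands δ u₀ xm x t ρ → 0 ≤ ρ κ ∧ ρ κ ≤ rhoWeyl δ u₀ xm κ) ∧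
    (κ ∈ saturations δ u₀ xm x t ρ → ρ κ = rhoWeyl δ u₀ xm κ)

/-- `V + L[ρ]` represents the Fréchet derivative at `ρ` of the energy, as a functional on
`𝒜 ⊆ L¹[0, κ_max]`: the map `h ↦ ∫ (V + L[ρ]) h dκ` is a continuous linear functional on `L¹` and
is the Fréchet derivative of the energy at `ρ` relative to `𝒜`. -/
def IsFrechetDerivativeOfEnergy (δ : ℝ) (u₀ : ℝ → ℝ) (xm x t : ℝ)
    (ρ : Lp ℝ 1 (kappaMeasure δ u₀ xm)) : Prop :=
  ∃ D : Lp ℝ 1 (kappaMeasure δ u₀ xm) →L[ℝ] ℝ,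
    (∀ h : Lp ℝ 1 (kappaMeasure δ u₀ xm),
      Integrable (fun κ => energyDerivative δ u₀ xm x t ρ (quadZeta δ κ) * h κ)
        (kappaMeasure δ u₀ xm) ∧
      D h = ∫ κ, energyDerivative δ u₀ xm x t ρ (quadZeta δ κ) * h κ
        ∂(kappaMeasure δ u₀ xm)) ∧
    HasFDerivWithinAt
      (fun f : Lp ℝ 1 (kappaMeasure δ u₀ xm) => energy δ u₀ xm x t f) D
      {f : Lp ℝ 1 (kappaMeasure δ u₀ xm) | (f : ℝ → ℝ) ∈ admissibleDensities δ u₀ xm} ρ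

end ILW

end

/-! The energy is a quadratic functional: `E[ρ + g] = E[ρ] + ∫ (V + L[ρ]) g + (1/2π) ∬ K g g`
(`energy_add`), where the kernel `K = logKernel` is the Green function of the upper half-plane
restricted to the quadratrix. Everything follows from two facts about `K`: it is strictly positive
definite, and its potentials are uniformly controlled on densities dominated by `ρ^Wyl`.

Positivity comes from an explicit Gram representation. Off the diagonal, `K(κ, η)` is the real part
of an integral of `2 e_p(κ) conj (e_p(η))` over truncated exponentials `e_p` (`integral_gramFun`).
The interaction energy of `f` is therefore an integral of `2 |∫ f e_p|²`, and it vanishes only for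
`f = 0`, because tail integrals determine a function. Hence the energy is convex, minimality is
equivalent to the first order inequality `∫ (V + L[ρ]) (σ - ρ) ≥ 0` for all admissible `σ`, and the
minimizer is unique. Testing the inequality with the `σ` that makes its integrand as small as
possible pointwise gives the variational conditions.

Control of potentials comes from the Weyl law. On the quadratrix the Lambert arguments are negative
reals, so `R(ζ(κ))` becomes `(1/4δ) ∫ lambertGap (levelFun (2δκ) - 2δ u₀(y)) dy`, with a decreasing,
square-root Hölder integrand. The moment condition makes `u₀ ^ (3/8)` integrable, and interpolation
shows that `R` is monotone and Hölder with exponent `1/8` (`exists_weylR_holder`). The measure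
`ρ^Wyl dκ` thus gives mass `O(r ^ (1/8))` to intervals of length `r`, so cutting the logarithm at
height `T` bounds potentials by `T ‖g‖₁ + C exp (-T/8)` (`exists_kernelPotential_bound`). With `T =
0` they are bounded; for suitable `T` the quadratic term is `o(‖g‖₁)`, which is the Fréchet
derivative.

For existence, densities are written `ρ = ρ^Wyl φ` with `0 ≤ φ ≤ 1` in `L²(ρ^Wyl dκ)`, where a
continuous convex function attains its minimum on a closed bounded convex set. -/

namespace ILW

/-! ### The level function on the quadratrix -/

/-- `2δ E(ζ(κ))` as a function of `b = 2δκ`. -/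
noncomputable def levelFun (b : ℝ) : ℝ := 1 - Real.log (Real.sinc b) - Real.cos b / Real.sinc b

lemma sinc_pos_of_mem {b : ℝ} (h0 : 0 ≤ b) (h1 : b < Real.pi) : 0 < Real.sinc b := by
  rcases h0.eq_or_lt with rfl | h0
  · simp
  · rw [Real.sinc_of_ne_zero h0.ne']
    exact div_pos (Real.sin_pos_of_pos_of_lt_pi h0 h1) h0

lemma levelFun_zero : levelFun 0 = 0 := by simp [levelFun]

lemma continuousOn_levelFun : ContinuousOn levelFun (Ico 0 Real.pi) := by
  intro b hb
  have h := (sinc_pos_of_mem hb.1 hb.2).ne'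
  have hc := Real.continuous_sinc.continuousAt (x := b)
  unfold levelFun
  exact ((continuousAt_const.sub (hc.log h)).sub
    (Real.continuous_cos.continuousAt.div hc h)).continuousWithinAt

/-- The derivative is arranged as `b` plus a nonnegative term, so that at least quadratic growth can
be read off. -/
lemma hasDerivAt_levelFun {b : ℝ} (h0 : 0 < b) (h1 : b < Real.pi) :
    HasDerivAt levelFun
      (b + (Real.sin b - b * Real.cos b) ^ 2 / (b * Real.sin b ^ 2)) b := by
  have hs := Real.sin_pos_of_pos_of_lt_pi h0 h1
  have hq : HasDerivAt Real.sinc ((Real.cos b * b - Real.sin b * 1) / b ^ 2) b := by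
    have := (Real.hasDerivAt_sin b).div (hasDerivAt_id b) h0.ne'
    refine this.congr_of_eventuallyEq ?_
    filter_upwards [eventually_ne_nhds h0.ne'] with y hy
    simp [Real.sinc_of_ne_zero hy]
  have hp := sinc_pos_of_mem h0.le h1
  have := ((hasDerivAt_const b (1 : ℝ)).sub (hq.log hp.ne')).sub
    ((Real.hasDerivAt_cos b).div hq hp.ne')
  unfold levelFun
  refine this.congr_deriv ?_
  rw [Real.sinc_of_ne_zero h0.ne']
  field_simp
  ring_nf

/-- Quadratic growth is what makes the inverse function, the Lambert angle, Hölder with exponent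
`1/2`. -/
lemma levelFun_sub_ge {a b : ℝ} (ha : 0 ≤ a) (hab : a ≤ b) (hb : b < Real.pi) :
    (b ^ 2 - a ^ 2) / 2 ≤ levelFun b - levelFun a := by
  have hm : MonotoneOn (fun b => levelFun b - b ^ 2 / 2) (Ico 0 Real.pi) := by
    have hd : ∀ b ∈ interior (Ico 0 Real.pi), HasDerivAt (fun b => levelFun b - b ^ 2 / 2)
        ((Real.sin b - b * Real.cos b) ^ 2 / (b * Real.sin b ^ 2)) b := by
      intro b hb
      rw [interior_Ico] at hb
      refine ((hasDerivAt_levelFun hb.1 hb.2).sub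
        ((hasDerivAt_pow 2 b).div_const 2)).congr_deriv ?_
      ring
    refine monotoneOn_of_deriv_nonneg (convex_Ico _ _)
      (continuousOn_levelFun.sub (by fun_prop))
      (fun b hb => (hd b hb).differentiableAt.differentiableWithinAt) ?_
    intro b hb
    rw [(hd b hb).deriv]
    rw [interior_Ico] at hb
    have := hb.1
    positivity
  have := hm ⟨ha, hab.trans_lt hb⟩ ⟨ha.trans hab, hb⟩ hab
  simp only at this
  linarith

lemma sq_sub_le_levelFun_sub {a b : ℝ} (ha : 0 ≤ a) (hab : a ≤ b) (hb : b < Real.pi) :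
    (b - a) ^ 2 / 2 ≤ levelFun b - levelFun a :=
  le_trans (by nlinarith) (levelFun_sub_ge ha hab hb)

lemma strictMonoOn_levelFun : StrictMonoOn levelFun (Ico 0 Real.pi) := by
  intro a ha b hb hab
  have := sq_sub_le_levelFun_sub ha.1 hab.le hb.2
  have : 0 < (b - a) ^ 2 := by have := sub_pos.2 hab; positivity
  linarith

lemma levelFun_nonneg {b : ℝ} (h0 : 0 ≤ b) (h1 : b < Real.pi) : 0 ≤ levelFun b := by
  have := levelFun_sub_ge le_rfl h0 h1
  rw [levelFun_zero] at this
  nlinarith [sq_nonneg b]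

lemma exists_levelFun_eq {s : ℝ} (hs : 0 ≤ s) : ∃ b ∈ Ico 0 Real.pi, levelFun b = s := by
  -- Near `π` the term `-log sinc` blows up, while past `π / 2` the cosine term has a favourable
  -- sign.
  have ht : Tendsto (fun b => - Real.log (Real.sinc b)) (𝓝[<] Real.pi) atTop := by
    refine tendsto_neg_atBot_atTop.comp (Real.tendsto_log_nhdsGT_zero.comp ?_)
    refine tendsto_nhdsWithin_iff.2 ⟨?_, ?_⟩
    · have := (Real.continuous_sinc.tendsto Real.pi).mono_left (nhdsWithin_le_nhds (s := Iio Real.pi))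
      rwa [Real.sinc_of_ne_zero Real.pi_ne_zero, Real.sin_pi, zero_div] at this
    · filter_upwards [Ioo_mem_nhdsLT Real.pi_pos] with b hb
      exact sinc_pos_of_mem hb.1.le hb.2
  have h2 : Real.pi / 2 < Real.pi := by linarith [Real.pi_pos]
  obtain ⟨c, hcs, hc⟩ := ((ht.eventually_ge_atTop s).and (Ioo_mem_nhdsLT h2)).exists
  have hc0 : 0 ≤ c := by linarith [hc.1, Real.pi_pos]
  have hge : s ≤ levelFun c := by
    have h1 : Real.cos c ≤ 0 := Real.cos_nonpos_of_pi_div_two_le_of_le hc.1.le (by linarith [hc.2])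
    have := div_nonpos_of_nonpos_of_nonneg h1 (sinc_pos_of_mem hc0 hc.2).le
    unfold levelFun
    linarith
  have := intermediate_value_Icc hc0
    (continuousOn_levelFun.mono (Icc_subset_Ico_right hc.2))
  obtain ⟨b, hb, hb'⟩ := this ⟨by rwa [levelFun_zero], hge⟩
  exact ⟨b, ⟨hb.1, hb.2.trans_lt hc.2⟩, hb'⟩

lemma sin_sub_mul_cos_nonneg {b : ℝ} (h0 : 0 ≤ b) (h1 : b < Real.pi) :
    0 ≤ Real.sin b - b * Real.cos b := by
  rcases le_or_gt (Real.cos b) 0 with hc | hc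
  · have := Real.sin_nonneg_of_nonneg_of_le_pi h0 h1.le
    nlinarith
  · have hb2 : b < Real.pi / 2 := by
      by_contra h
      exact absurd (Real.cos_nonpos_of_pi_div_two_le_of_le (not_lt.1 h) (by linarith)) (not_le.2 hc)
    have := Real.le_tan h0 hb2
    rw [Real.tan_eq_sin_div_cos, le_div_iff₀ hc] at this
    linarith

/-- Since `b cos b ≤ sin b`, the last term of the level function is at most `1`. A bound on the
level therefore keeps `b` away from `π`, and so bounds both the slope of the level function and the
real part of `ζ`. -/
lemma inv_sinc_le {b : ℝ} (h0 : 0 ≤ b) (h1 : b < Real.pi) :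
    (Real.sinc b)⁻¹ ≤ Real.exp (levelFun b) := by
  have hp := sinc_pos_of_mem h0 h1
  rw [← Real.log_le_iff_le_exp (by positivity), Real.log_inv, levelFun]
  have : Real.cos b / Real.sinc b ≤ 1 := by
    rw [div_le_one hp]
    rcases h0.eq_or_lt with rfl | h0
    · simp
    · rw [Real.sinc_of_ne_zero h0.ne', le_div_iff₀ h0]
      linarith [sin_sub_mul_cos_nonneg h0.le h1]
  linarith

/-- The level function is Lipschitz on compact subintervals of `[0, π)`. -/
lemma exists_levelFun_sub_le {B : ℝ} (hB0 : 0 ≤ B) (hB : B < Real.pi) :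
    ∃ C > 0, ∀ a b, 0 ≤ a → a ≤ b → b ≤ B → levelFun b - levelFun a ≤ C * (b - a) := by
  refine ⟨Real.pi + Real.pi ^ 3 * Real.exp (levelFun B) ^ 2, by positivity, ?_⟩
  intro a b ha hab hb
  have hsub : Icc (0 : ℝ) B ⊆ Ico 0 Real.pi := Icc_subset_Ico_right hB
  refine (convex_Icc (0 : ℝ) B).image_sub_le_mul_sub_of_deriv_le
    (continuousOn_levelFun.mono hsub) ?_ ?_ a ⟨ha, hab.trans hb⟩ b ⟨ha.trans hab, hb⟩ hab
  · intro x hx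
    rw [interior_Icc] at hx
    exact (hasDerivAt_levelFun hx.1 (hx.2.trans hB)).differentiableAt.differentiableWithinAt
  · intro x hx
    rw [interior_Icc] at hx
    have hxp := hx.2.trans hB
    rw [(hasDerivAt_levelFun hx.1 hxp).deriv]
    have hx0 := hx.1
    have h1 := sin_sub_mul_cos_nonneg hx0.le hxp
    -- Third order vanishing at `0` compensates the denominator `x * sin x ^ 2` of the derivative.
    have h2 : Real.sin x - x * Real.cos x ≤ x * x ^ 2 := by
      have h3 := Real.sin_le hx0.le
      have h4 := Real.one_sub_sq_div_two_le_cos (x := x)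
      nlinarith [mul_le_mul_of_nonneg_left h4 hx0.le, pow_pos hx0 3]
    have hs := Real.sin_pos_of_pos_of_lt_pi hx0 hxp
    have h5 : x / Real.sin x ≤ Real.exp (levelFun B) := by
      have := inv_sinc_le hx0.le hxp
      rw [Real.sinc_of_ne_zero hx0.ne', inv_div] at this
      exact this.trans (Real.exp_le_exp.2 (strictMonoOn_levelFun.monotoneOn
        ⟨hx0.le, hxp⟩ ⟨hB0, hB⟩ hx.2.le))
    have h6 : (Real.sin x - x * Real.cos x) ^ 2 / (x * Real.sin x ^ 2)
        ≤ x ^ 3 * (x / Real.sin x) ^ 2 := by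
      rw [div_pow, mul_div_assoc', div_le_div_iff₀ (by positivity) (by positivity)]
      have := pow_le_pow_left₀ h1 h2 2
      have h7 := mul_le_mul_of_nonneg_right this (by positivity : 0 ≤ Real.sin x ^ 2)
      calc _ ≤ _ := h7
        _ = _ := by ring
    have h8 : x ^ 3 * (x / Real.sin x) ^ 2 ≤ Real.pi ^ 3 * Real.exp (levelFun B) ^ 2 := by
      gcongr
    linarith

end ILW

namespace ILW

/-! ### The Lambert branches on the negative real axis -/

lemma mul_exp_eq_ofReal_iff {w : ℂ} {r : ℝ} : w * Complex.exp w = r ↔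
    Real.exp w.re * (w.re * Real.cos w.im - w.im * Real.sin w.im) = r ∧
      w.re * Real.sin w.im + w.im * Real.cos w.im = 0 := by
  rw [Complex.ext_iff]
  simp only [Complex.mul_re, Complex.mul_im, Complex.exp_re, Complex.exp_im, Complex.ofReal_re,
    Complex.ofReal_im]
  refine and_congr ?_ ?_
  · rw [show w.re * (Real.exp w.re * Real.cos w.im) - w.im * (Real.exp w.re * Real.sin w.im) =
      Real.exp w.re * (w.re * Real.cos w.im - w.im * Real.sin w.im) by ring]
  · rw [show w.re * (Real.exp w.re * Real.sin w.im) + w.im * (Real.exp w.re * Real.cos w.im) =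
      Real.exp w.re * (w.re * Real.sin w.im + w.im * Real.cos w.im) by ring]
    simp [Real.exp_ne_zero]

/-- Vanishing of the imaginary part of `w eʷ` puts `w` on the curves bounding the ranges; the second
identity lets the sign of `r` decide which strips contain solutions. -/
lemma re_eq_of_mul_exp_eq {w : ℂ} {r : ℝ} (h : w * Complex.exp w = r)
    (hs : Real.sin w.im ≠ 0) : w.re = -w.im * Real.cot w.im ∧
      r = -(Real.exp w.re * (w.im / Real.sin w.im)) := by
  obtain ⟨h1, h2⟩ := mul_exp_eq_ofReal_iff.1 h
  have hre : w.re = -w.im * Real.cot w.im := by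
    rw [Real.cot_eq_cos_div_sin]
    field_simp
    linarith
  refine ⟨hre, ?_⟩
  rw [← h1]
  field_simp
  have := Real.sin_sq_add_cos_sq w.im
  have h3 : Real.sin w.im * (w.re * Real.cos w.im - w.im * Real.sin w.im) = - w.im := by
    linear_combination Real.cos w.im * h2 - w.im * this
  linear_combination h3

/-- Solutions of `w eʷ = r` with `r < 0` in the range of `W₋₁`. -/
lemma of_mem_lambertRangeNegOne {w : ℂ} {r : ℝ} (hr : r < 0) (hw : w ∈ lambertRangeNegOne)
    (h : w * Complex.exp w = r) : (w.im = 0 ∧ w.re ≤ -1) ∨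
      (-Real.pi < w.im ∧ w.im < 0 ∧ w.re = -w.im * Real.cot w.im) := by
  have hpi := Real.pi_pos
  rcases hw with hw | ⟨h1, h2, h3⟩ | ⟨h1, h2⟩ | ⟨h1, h2, h3⟩
  · exact Or.inl hw
  · refine Or.inr ⟨h1, h2, ?_⟩
    exact (re_eq_of_mul_exp_eq h (Real.sin_neg_of_neg_of_neg_pi_lt h2 h1).ne).1
  -- Here the sine is nonnegative. Where it is positive, the formula for `r` gives `r > 0`; where it
  -- vanishes, `Im w` would have to vanish.
  · exfalso
    have hs : 0 ≤ Real.sin w.im := by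
      rw [← Real.sin_add_two_pi]
      exact Real.sin_nonneg_of_nonneg_of_le_pi (by linarith) (by linarith)
    rcases hs.eq_or_lt with hs | hs
    · have h4 := (mul_exp_eq_ofReal_iff.1 h).2
      rw [← hs, mul_zero, zero_add] at h4
      have h5 := Real.sin_sq_add_cos_sq w.im
      rcases mul_eq_zero.1 h4 with h4 | h4
      · linarith
      · rw [← hs, h4] at h5
        norm_num at h5
    · have := (re_eq_of_mul_exp_eq h hs.ne').2
      have h6 : w.im / Real.sin w.im < 0 := div_neg_of_neg_of_pos (by linarith) hs
      nlinarith [Real.exp_pos w.re]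
  · exfalso
    have hs : Real.sin w.im < 0 := by
      rw [← Real.sin_add_two_pi]
      exact Real.sin_neg_of_neg_of_neg_pi_lt (by linarith) (by linarith)
    exact h3.ne' (re_eq_of_mul_exp_eq h hs.ne).1

/-- Solutions of `w eʷ = r` with `r < 0` in the range of `W₀`. -/
lemma of_mem_lambertRangeZero {w : ℂ} {r : ℝ} (hw : w ∈ lambertRangeZero)
    (h : w * Complex.exp w = r) : (w.im = 0 ∧ -1 ≤ w.re) ∨
      (0 < w.im ∧ w.im < Real.pi ∧ w.re = -w.im * Real.cot w.im) := by
  rcases hw with hw | ⟨h1, h2, h3⟩ | ⟨h1, h2, h3⟩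
  · exact Or.inl hw
  · refine Or.inr ⟨h1, h2, ?_⟩
    exact (re_eq_of_mul_exp_eq h (Real.sin_pos_of_pos_of_lt_pi h1 h2).ne').1
  · exact absurd (re_eq_of_mul_exp_eq h (Real.sin_neg_of_neg_of_neg_pi_lt h2 h1).ne).1 h3.ne'

lemma mul_cot_eq {b : ℝ} (h0 : b ≠ 0) : b * Real.cot b = Real.cos b / Real.sinc b := by
  rw [Real.sinc_of_ne_zero h0, Real.cot_eq_cos_div_sin]
  field_simp

lemma exp_levelFun_sub_one {b : ℝ} (h0 : 0 ≤ b) (h1 : b < Real.pi) :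
    Real.exp (levelFun b - 1) = Real.exp (-(Real.cos b / Real.sinc b)) / Real.sinc b := by
  rw [levelFun, show 1 - Real.log (Real.sinc b) - Real.cos b / Real.sinc b - 1 =
    -(Real.cos b / Real.sinc b) - Real.log (Real.sinc b) by ring, Real.exp_sub,
    Real.exp_log (sinc_pos_of_mem h0 h1)]

/-- If a non-real `w` with `|Im w| < π` on the curve `Re w = -Im w cot (Im w)` solves
`w eʷ = -exp (s - 1)`, then `s` is the value of the level function at `|Im w|`. -/
lemma levelFun_abs_im {w : ℂ} {s : ℝ} (h0 : w.im ≠ 0) (h1 : |w.im| < Real.pi)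
    (h : w * Complex.exp w = (-Real.exp (s - 1) : ℝ)) : levelFun |w.im| = s := by
  have hp := sinc_pos_of_mem (abs_nonneg _) h1
  have hab : Real.sinc |w.im| = Real.sinc w.im := by
    rcases abs_choice w.im with h | h <;> rw [h]
    exact Real.sinc_neg _
  have hs : Real.sin w.im ≠ 0 := by
    rw [hab, Real.sinc_of_ne_zero h0] at hp
    intro h
    simp [h] at hp
  obtain ⟨h2, h3⟩ := re_eq_of_mul_exp_eq h hs
  have h4 : Real.exp (levelFun |w.im| - 1) = Real.exp (s - 1) := by
    rw [exp_levelFun_sub_one (abs_nonneg _) h1, Real.cos_abs, hab, ← mul_cot_eq h0,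
      ← neg_mul, ← h2, Real.sinc_of_ne_zero h0]
    rw [neg_inj] at h3
    rw [h3]
    field_simp
  have := Real.exp_injective h4
  linarith

/-- Writing the negative axis as `-exp (s - 1)` places the branch point `-1/e` at `s = 0`. For `s >
0` the value of `W₋₁` lies on this curve, at the height where the level function equals `s`. -/
lemma curve_mul_exp {b : ℝ} (h0 : 0 < b) (h1 : b < Real.pi) :
    (⟨-b * Real.cot b, -b⟩ : ℂ) * Complex.exp ⟨-b * Real.cot b, -b⟩ =
      (-Real.exp (levelFun b - 1) : ℝ) := by
  have hs := Real.sin_pos_of_pos_of_lt_pi h0 h1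
  have h5 := Real.sin_sq_add_cos_sq b
  rw [mul_exp_eq_ofReal_iff]
  simp only [Real.cos_neg, Real.sin_neg]
  constructor
  · rw [exp_levelFun_sub_one h0.le h1, ← mul_cot_eq h0.ne', Real.sinc_of_ne_zero h0.ne',
      Real.cot_eq_cos_div_sin, ← neg_mul]
    have h6 : -b * (Real.cos b / Real.sin b) * Real.cos b - -b * -Real.sin b =
        - (b / Real.sin b) := by
      field_simp
      linear_combination -h5
    rw [h6]
    field_simp
  · rw [Real.cot_eq_cos_div_sin]
    field_simp
    ring

lemma real_mul_exp_eq_iff {w : ℂ} {s : ℝ} (h0 : w.im = 0) (hw : w.re < 0) :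
    w * Complex.exp w = (-Real.exp (s - 1) : ℝ) ↔ -w.re - 1 - Real.log (-w.re) = -s := by
  rw [mul_exp_eq_ofReal_iff, h0]
  simp only [Real.cos_zero, mul_one, Real.sin_zero, mul_zero, sub_zero, add_zero,
    and_true]
  have hp : 0 < -w.re := by linarith
  have h1 : Real.exp w.re * w.re = -Real.exp (Real.log (-w.re) + w.re) := by
    rw [Real.exp_add, Real.exp_log hp]
    ring
  rw [h1, neg_inj, Real.exp_eq_exp]
  constructor <;> intro h <;> linarith

/-! ### The function `p - 1 - log p` -/

/-- The function `r - log r - (r + 1/r) / 2` has derivative `(1 - 1/r)² / 2`, and is compared at `r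
= p / q` and `r = 1`. The result, with its counterpart on `(0, 1]`, says that both real branches
have square-root behaviour at the branch point. -/
lemma sub_log_sub_of_one_le {p q : ℝ} (hq : 1 ≤ q) (hqp : q ≤ p) :
    (p - q) ^ 2 / (2 * (p * q)) ≤ (p - 1 - Real.log p) - (q - 1 - Real.log q) := by
  have hq0 : 0 < q := by linarith
  have hm : MonotoneOn (fun r : ℝ => r - Real.log r - (r + r⁻¹) / 2) (Ici 1) := by
    have hd : ∀ r ∈ interior (Ici (1 : ℝ)),
        HasDerivAt (fun r : ℝ => r - Real.log r - (r + r⁻¹) / 2) ((1 - r⁻¹) ^ 2 / 2) r := by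
      intro r hr
      rw [interior_Ici] at hr
      have hr0 : r ≠ 0 := by have : (1 : ℝ) < r := hr; positivity
      refine (((hasDerivAt_id r).sub (Real.hasDerivAt_log hr0)).sub
        (((hasDerivAt_id r).add (hasDerivAt_inv hr0)).div_const 2)).congr_deriv ?_
      field_simp
      ring
    refine monotoneOn_of_deriv_nonneg (convex_Ici 1) ?_
      (fun r hr => (hd r hr).differentiableAt.differentiableWithinAt) ?_
    · have : ∀ r ∈ Ici (1 : ℝ), r ≠ 0 := fun r hr => by
        have : (1 : ℝ) ≤ r := hr
        positivity
      exact (continuousOn_id.sub (continuousOn_id.log this)).sub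
        ((continuousOn_id.add (continuousOn_id.inv₀ this)).div_const 2)
    · intro r hr
      rw [(hd r hr).deriv]
      positivity
  have hr1 : 1 ≤ p / q := (one_le_div hq0).2 hqp
  have h := hm (self_mem_Ici) hr1 hr1
  simp only [Real.log_one, inv_one] at h
  have hp0 : 0 < p := by linarith
  rw [Real.log_div hp0.ne' hq0.ne', inv_div] at h
  have h2 : p / q - 1 ≤ p - q := by
    rw [div_sub_one hq0.ne', div_le_iff₀ hq0]
    nlinarith
  have h3 : (p - q) ^ 2 / (2 * (p * q)) = (p / q + q / p) / 2 - 1 := by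
    field_simp
    ring
  rw [h3]
  linarith

lemma sub_log_sub_of_le_one {p q : ℝ} (hp : 0 < p) (hpq : p ≤ q) (hq : q ≤ 1) :
    (q - p) ^ 2 / 2 ≤ (p - 1 - Real.log p) - (q - 1 - Real.log q) := by
  have hm : AntitoneOn (fun r : ℝ => r - Real.log r - (1 - r) ^ 2 / 2) (Ioc 0 1) := by
    have hd : ∀ r ∈ Ioc (0 : ℝ) 1,
        HasDerivAt (fun r : ℝ => r - Real.log r - (1 - r) ^ 2 / 2) (-((1 - r) ^ 2 / r)) r := by
      intro r hr
      have hr0 : r ≠ 0 := hr.1.ne'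
      refine (((hasDerivAt_id r).sub (Real.hasDerivAt_log hr0)).sub
        ((((hasDerivAt_id r).const_sub 1).pow 2).div_const 2)).congr_deriv ?_
      simp only [id]
      field_simp
      ring
    refine antitoneOn_of_deriv_nonpos (convex_Ioc 0 1)
      (fun r hr => (hd r hr).continuousAt.continuousWithinAt)
      (fun r hr => (hd r (interior_subset hr)).differentiableAt.differentiableWithinAt) ?_
    intro r hr
    have h := interior_subset hr
    rw [(hd r h).deriv]
    have := h.1
    exact neg_nonpos.2 (by positivity)
  have h := hm ⟨hp, hpq.trans hq⟩ ⟨hp.trans_le hpq, hq⟩ hpq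
  simp only at h
  nlinarith [mul_nonneg (sub_nonneg.2 hpq) (sub_nonneg.2 hq)]

/-! ### Values of the branches -/

lemma lambertWNegOne_spec_of_pos {s : ℝ} (hs : 0 < s) : ∃ b ∈ Ioo 0 Real.pi, levelFun b = s ∧
    lambertWNegOne (-Real.exp (s - 1) : ℝ) = ⟨-b * Real.cot b, -b⟩ := by
  obtain ⟨b, hb, hbs⟩ := exists_levelFun_eq hs.le
  have hb0 : 0 < b := hb.1.lt_of_ne (by rintro rfl; rw [levelFun_zero] at hbs; exact hs.ne hbs)
  refine ⟨b, ⟨hb0, hb.2⟩, hbs, ?_⟩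
  have hex : ∃ w : ℂ, w ∈ lambertRangeNegOne ∧ w * Complex.exp w = (-Real.exp (s - 1) : ℝ) := by
    refine ⟨⟨-b * Real.cot b, -b⟩, Or.inr (Or.inl ⟨?_, ?_, ?_⟩), ?_⟩
    · simpa using hb.2
    · simpa using hb0
    · simp [Real.cot_eq_cos_div_sin, div_neg]
    · rw [curve_mul_exp hb0 hb.2, hbs]
  obtain ⟨h1, h2⟩ := Classical.epsilon_spec hex
  change lambertWNegOne _ ∈ _ at h1
  change lambertWNegOne _ * Complex.exp (lambertWNegOne _) = _ at h2
  set w := lambertWNegOne (-Real.exp (s - 1) : ℝ) with hw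
  have hr : -Real.exp (s - 1) < 0 := neg_lt_zero.2 (Real.exp_pos _)
  -- A real root is impossible for `s > 0` because `p - 1 - log p ≥ 0`; the nonreal root is unique
  -- because the level function is injective.
  rcases of_mem_lambertRangeNegOne hr h1 h2 with ⟨h3, h4⟩ | ⟨h3, h4, h5⟩
  · have := (real_mul_exp_eq_iff h3 (by linarith)).1 h2
    have h6 := Real.log_le_sub_one_of_pos (x := -w.re) (by linarith)
    linarith
  · have h6 := levelFun_abs_im h4.ne (by rw [abs_of_neg h4]; linarith) h2
    have h7 : |w.im| = b := strictMonoOn_levelFun.injOn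
      ⟨abs_nonneg _, by rw [abs_of_neg h4]; linarith⟩ hb (h6.trans hbs.symm)
    have h8 : w.im = -b := by rw [abs_of_neg h4] at h7; linarith
    rw [h8] at h5
    refine Complex.ext ?_ h8
    simp [h5, Real.cot_eq_cos_div_sin, div_neg]

lemma exists_one_le_sub_log_eq {s : ℝ} (hs : 0 ≤ s) : ∃ p, 1 ≤ p ∧ p - 1 - Real.log p = s := by
  -- As `P` is a square, `log P = 2 log (2 (s + 1))` is at most linear in `s`, so `P - 1 - log P`
  -- exceeds `s`.
  set P : ℝ := 4 * (s + 1) ^ 2 with hP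
  have hP1 : 1 ≤ P := by nlinarith
  have hc : ContinuousOn (fun p : ℝ => p - 1 - Real.log p) (Icc 1 P) := by
    refine (continuousOn_id.sub continuousOn_const).sub (continuousOn_id.log ?_)
    intro r hr
    have := hr.1
    simp only [id]
    positivity
  have hlog : Real.log P ≤ 2 * (2 * (s + 1) - 1) := by
    rw [show P = (2 * (s + 1)) ^ 2 by ring, Real.log_pow]
    have := Real.log_le_sub_one_of_pos (x := 2 * (s + 1)) (by linarith)
    push_cast
    linarith
  obtain ⟨p, hp, hps⟩ := intermediate_value_Icc hP1 hc (show s ∈ Icc _ _ by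
    constructor
    · simpa using hs
    · show s ≤ P - 1 - Real.log P
      nlinarith)
  exact ⟨p, hp.1, hps⟩

lemma exists_le_one_sub_log_eq {s : ℝ} (hs : 0 ≤ s) :
    ∃ p, 0 < p ∧ p ≤ 1 ∧ p - 1 - Real.log p = s := by
  set P : ℝ := Real.exp (-(s + 1)) with hP
  have hP0 : 0 < P := Real.exp_pos _
  have hP1 : P ≤ 1 := Real.exp_le_one_iff.2 (by linarith)
  have hc : ContinuousOn (fun p : ℝ => p - 1 - Real.log p) (Icc P 1) := by
    refine (continuousOn_id.sub continuousOn_const).sub (continuousOn_id.log ?_)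
    intro r hr
    exact (hP0.trans_le hr.1).ne'
  obtain ⟨p, hp, hps⟩ := intermediate_value_Icc' hP1 hc (show s ∈ Icc _ _ by
    constructor
    · simpa using hs
    · show s ≤ P - 1 - Real.log P
      rw [hP, Real.log_exp]
      linarith)
  exact ⟨p, hP0.trans_le hp.1, hp.2, hps⟩

lemma lambertWNegOne_spec_of_nonpos {s : ℝ} (hs : s ≤ 0) : ∃ p, 1 ≤ p ∧
    p - 1 - Real.log p = -s ∧ lambertWNegOne (-Real.exp (s - 1) : ℝ) = (-p : ℝ) := by
  obtain ⟨q, hq, hqs⟩ := exists_one_le_sub_log_eq (neg_nonneg.2 hs)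
  have hex : ∃ w : ℂ, w ∈ lambertRangeNegOne ∧ w * Complex.exp w = (-Real.exp (s - 1) : ℝ) := by
    refine ⟨(-q : ℝ), Or.inl ⟨Complex.ofReal_im _, ?_⟩, ?_⟩
    · rw [Complex.ofReal_re]
      linarith
    · rw [real_mul_exp_eq_iff (Complex.ofReal_im _) (by rw [Complex.ofReal_re]; linarith),
        Complex.ofReal_re, neg_neg, hqs]
  obtain ⟨h1, h2⟩ := Classical.epsilon_spec hex
  change lambertWNegOne _ ∈ _ at h1
  change lambertWNegOne _ * Complex.exp (lambertWNegOne _) = _ at h2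
  set w := lambertWNegOne (-Real.exp (s - 1) : ℝ) with hw
  have hr : -Real.exp (s - 1) < 0 := neg_lt_zero.2 (Real.exp_pos _)
  rcases of_mem_lambertRangeNegOne hr h1 h2 with ⟨h3, h4⟩ | ⟨h3, h4, h5⟩
  · refine ⟨-w.re, by linarith, (real_mul_exp_eq_iff h3 (by linarith)).1 h2, ?_⟩
    rw [neg_neg]
    exact Complex.ext rfl (by simpa using h3)
  -- A nonreal root would have positive level, contradicting `s ≤ 0`.
  · have h7 : |w.im| < Real.pi := by rw [abs_of_neg h4]; linarith
    have h6 := levelFun_abs_im h4.ne h7 h2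
    have := strictMonoOn_levelFun ⟨le_rfl, Real.pi_pos⟩ ⟨abs_nonneg _, h7⟩ (abs_pos.2 h4.ne)
    rw [h6, levelFun_zero] at this
    linarith

lemma lambertW0_spec_of_nonpos {s : ℝ} (hs : s ≤ 0) : ∃ p, 0 < p ∧ p ≤ 1 ∧
    p - 1 - Real.log p = -s ∧ lambertW0 (-Real.exp (s - 1) : ℝ) = (-p : ℝ) := by
  obtain ⟨q, hq, hq1, hqs⟩ := exists_le_one_sub_log_eq (neg_nonneg.2 hs)
  have hex : ∃ w : ℂ, w ∈ lambertRangeZero ∧ w * Complex.exp w = (-Real.exp (s - 1) : ℝ) := by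
    refine ⟨(-q : ℝ), Or.inl ⟨Complex.ofReal_im _, ?_⟩, ?_⟩
    · rw [Complex.ofReal_re]
      linarith
    · rw [real_mul_exp_eq_iff (Complex.ofReal_im _) (by rw [Complex.ofReal_re]; linarith),
        Complex.ofReal_re, neg_neg, hqs]
  obtain ⟨h1, h2⟩ := Classical.epsilon_spec hex
  change lambertW0 _ ∈ _ at h1
  change lambertW0 _ * Complex.exp (lambertW0 _) = _ at h2
  set w := lambertW0 (-Real.exp (s - 1) : ℝ) with hw
  rcases of_mem_lambertRangeZero h1 h2 with ⟨h3, h4⟩ | ⟨h3, h4, h5⟩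
  · have h5 : w.re < 0 := by
      have := (mul_exp_eq_ofReal_iff.1 h2).1
      rw [h3] at this
      simp only [Real.cos_zero, mul_one, zero_mul, sub_zero] at this
      by_contra h
      have h6 := mul_nonneg (Real.exp_pos w.re).le (not_lt.1 h)
      linarith [Real.exp_pos (s - 1)]
    refine ⟨-w.re, by linarith, by linarith, (real_mul_exp_eq_iff h3 h5).1 h2, ?_⟩
    rw [neg_neg]
    exact Complex.ext rfl (by simpa using h3)
  · have h7 : |w.im| < Real.pi := by rwa [abs_of_pos h3]
    have h6 := levelFun_abs_im h3.ne' h7 h2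
    have := strictMonoOn_levelFun ⟨le_rfl, Real.pi_pos⟩ ⟨abs_nonneg _, h7⟩ (abs_pos.2 h3.ne')
    rw [h6, levelFun_zero] at this
    linarith

/-! ### The angle and the gap -/

/-- The angle `b ∈ [0, π)` at which the level function equals `max s 0`. -/
noncomputable def lambertAngle (s : ℝ) : ℝ := -(lambertWNegOne (-Real.exp (s - 1) : ℝ)).im

lemma lambertAngle_spec (s : ℝ) :
    lambertAngle s ∈ Ico 0 Real.pi ∧ levelFun (lambertAngle s) = max s 0 := by
  rcases le_or_gt s 0 with hs | hs
  · obtain ⟨p, -, -, h⟩ := lambertWNegOne_spec_of_nonpos hs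
    rw [lambertAngle, h, Complex.ofReal_im, neg_zero, levelFun_zero, max_eq_right hs]
    exact ⟨⟨le_rfl, Real.pi_pos⟩, rfl⟩
  · obtain ⟨b, hb, h1, h⟩ := lambertWNegOne_spec_of_pos hs
    simp only [lambertAngle, h, neg_neg, max_eq_left hs.le, h1, and_true]
    exact Ioo_subset_Ico_self hb

lemma lambertAngle_levelFun {b : ℝ} (hb : b ∈ Ico 0 Real.pi) : lambertAngle (levelFun b) = b := by
  refine strictMonoOn_levelFun.injOn (lambertAngle_spec _).1 hb ?_
  rw [(lambertAngle_spec _).2, max_eq_left (levelFun_nonneg hb.1 hb.2)]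

lemma lambertAngle_of_nonpos {s : ℝ} (hs : s ≤ 0) : lambertAngle s = 0 := by
  refine strictMonoOn_levelFun.injOn (lambertAngle_spec _).1 ⟨le_rfl, Real.pi_pos⟩ ?_
  rw [(lambertAngle_spec _).2, max_eq_right hs, levelFun_zero]

lemma lambertAngle_mono : Monotone lambertAngle := by
  intro s t hst
  rw [← strictMonoOn_levelFun.le_iff_le (lambertAngle_spec _).1 (lambertAngle_spec _).1,
    (lambertAngle_spec _).2, (lambertAngle_spec _).2]
  exact max_le_max_right 0 hst

/-- Inverse form of the quadratic growth of the level function; truncation at `0` does not increase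
differences. -/
lemma lambertAngle_sub_le {s t : ℝ} (hst : s ≤ t) :
    lambertAngle t - lambertAngle s ≤ Real.sqrt (2 * (t - s)) := by
  refine Real.le_sqrt_of_sq_le ?_
  have h := sq_sub_le_levelFun_sub (lambertAngle_spec s).1.1 (lambertAngle_mono hst)
    (lambertAngle_spec t).1.2
  rw [(lambertAngle_spec _).2, (lambertAngle_spec _).2] at h
  have : max t 0 - max s 0 ≤ t - s := by
    rcases max_cases t 0 with h1 | h1 <;> rcases max_cases s 0 with h2 | h2 <;> linarith
  linarith

/-- The difference `W₀ - W₋₁` at `-exp (s - 1)` for `s ≤ 0`, extended by `0`. -/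
noncomputable def lambertGap (s : ℝ) : ℝ :=
  if s ≤ 0 then
    (lambertW0 (-Real.exp (s - 1) : ℝ) - lambertWNegOne (-Real.exp (s - 1) : ℝ)).re else 0

lemma lambertGap_of_nonneg {s : ℝ} (hs : 0 ≤ s) : lambertGap s = 0 := by
  rcases hs.eq_or_lt with rfl | hs
  · obtain ⟨p, hp, h1, h⟩ := lambertWNegOne_spec_of_nonpos le_rfl
    obtain ⟨q, hq0, hq, h1', h'⟩ := lambertW0_spec_of_nonpos le_rfl
    have h2 := sub_log_sub_of_one_le le_rfl hp
    have h3 := sub_log_sub_of_le_one hq0 hq le_rfl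
    rw [h1, Real.log_one] at h2
    rw [h1', Real.log_one] at h3
    have hp1 : p = 1 := by
      have : (p - 1) ^ 2 ≤ 0 := by
        by_contra hc
        have : 0 < (p - 1) ^ 2 / (2 * (p * 1)) := div_pos (not_le.1 hc) (by linarith)
        linarith
      nlinarith
    have hq1 : q = 1 := by nlinarith
    rw [lambertGap, if_pos le_rfl, h, h', hp1, hq1]
    simp
  · simp [lambertGap, hs]

/-- The gap is decreasing and Hölder continuous on left-bounded sets. -/
lemma exists_lambertGap_bound (S : ℝ) (hS : 0 ≤ S) : ∃ C > 0, ∀ s t, -S ≤ s → s ≤ t →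
    0 ≤ lambertGap s - lambertGap t ∧ lambertGap s - lambertGap t ≤ C * Real.sqrt (t - s) := by
  -- `P` is the largest value of `-W₋₁` for `s ≥ -S`. It enters because the lower bound for `p - 1 -
  -- log p` weakens as `p` grows.
  obtain ⟨P, hP1, hPS⟩ := exists_one_le_sub_log_eq hS
  refine ⟨Real.sqrt (2 * (P * P)) + Real.sqrt 2, by positivity, ?_⟩
  have key : ∀ s t, -S ≤ s → s ≤ t → t ≤ 0 → 0 ≤ lambertGap s - lambertGap t ∧
      lambertGap s - lambertGap t ≤ (Real.sqrt (2 * (P * P)) + Real.sqrt 2) * Real.sqrt (t - s) := by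
    intro s t hs hst ht
    obtain ⟨p, hp, h1, h⟩ := lambertWNegOne_spec_of_nonpos (hst.trans ht)
    obtain ⟨q, hq0, hq, h2, h'⟩ := lambertW0_spec_of_nonpos (hst.trans ht)
    obtain ⟨p', hp', h1', hh⟩ := lambertWNegOne_spec_of_nonpos ht
    obtain ⟨q', hq0', hq', h2', hh'⟩ := lambertW0_spec_of_nonpos ht
    have e1 : lambertGap s = p - q := by
      rw [lambertGap, if_pos (hst.trans ht), h, h', Complex.sub_re, Complex.ofReal_re,
        Complex.ofReal_re]
      ring
    have e2 : lambertGap t = p' - q' := by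
      rw [lambertGap, if_pos ht, hh, hh', Complex.sub_re, Complex.ofReal_re, Complex.ofReal_re]
      ring
    have mono1 : ∀ {a b : ℝ}, 1 ≤ a → 1 ≤ b →
        a - 1 - Real.log a ≤ b - 1 - Real.log b → a ≤ b := by
      intro a b ha hb hab
      by_contra hc
      have h5 := sub_log_sub_of_one_le hb (not_le.1 hc).le
      have : 0 < (a - b) ^ 2 / (2 * (a * b)) := by
        have := sub_pos.2 (not_le.1 hc)
        positivity
      linarith
    have hpp : p' ≤ p := mono1 hp' hp (by linarith)
    have hpP : p ≤ P := mono1 hp hP1 (by linarith)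
    have hqq : q ≤ q' := by
      by_contra hc
      have h5 := sub_log_sub_of_le_one hq0' (not_le.1 hc).le hq
      have : 0 < (q - q') ^ 2 := by
        have := sub_pos.2 (not_le.1 hc)
        positivity
      linarith
    have b1 : p - p' ≤ Real.sqrt (2 * (P * P)) * Real.sqrt (t - s) := by
      rw [← Real.sqrt_mul (by positivity)]
      refine Real.le_sqrt_of_sq_le ?_
      have h5 := sub_log_sub_of_one_le hp' hpp
      rw [div_le_iff₀ (by positivity)] at h5
      have h6 : p * p' ≤ P * P := mul_le_mul hpP (hpp.trans hpP) (by linarith) (by linarith)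
      have h7 : (p - 1 - Real.log p - (p' - 1 - Real.log p')) = t - s := by linarith
      rw [h7] at h5
      nlinarith [mul_le_mul_of_nonneg_left h6 (sub_nonneg.2 hst)]
    have b2 : q' - q ≤ Real.sqrt 2 * Real.sqrt (t - s) := by
      rw [← Real.sqrt_mul (by positivity)]
      refine Real.le_sqrt_of_sq_le ?_
      have h5 := sub_log_sub_of_le_one hq0 hqq hq'
      linarith
    rw [e1, e2]
    constructor <;> linarith
  intro s t hs hst
  rcases le_or_gt t 0 with ht | ht
  · exact key s t hs hst ht
  · rcases le_or_gt s 0 with hs0 | hs0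
    · have h := key s 0 hs hs0 le_rfl
      rw [lambertGap_of_nonneg le_rfl] at h
      rw [lambertGap_of_nonneg ht.le]
      refine ⟨h.1, h.2.trans ?_⟩
      gcongr
    · rw [lambertGap_of_nonneg ht.le, lambertGap_of_nonneg hs0.le]
      simp only [sub_zero, le_refl, true_and]
      positivity

lemma lambertGap_antitone : Antitone lambertGap := by
  intro s t hst
  obtain ⟨C, -, h⟩ := exists_lambertGap_bound |s| (abs_nonneg s)
  have := (h s t (neg_abs_le s) hst).1
  linarith

end ILW

namespace ILW

variable {δ : ℝ} {u₀ : ℝ → ℝ} {xm : ℝ}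

/-! ### The quadratrix -/

lemma quadZeta_zero (δ : ℝ) : quadZeta δ 0 = 1 / (2 * (δ : ℂ)) := by simp [quadZeta]

lemma quadZeta_of_ne {κ : ℝ} (hκ : κ ≠ 0) (δ : ℝ) :
    quadZeta δ κ = ⟨κ * Real.cot (2 * δ * κ), κ⟩ := by
  rw [quadZeta, if_neg hκ]
  apply Complex.ext
  · rw [Complex.add_re, Complex.ofReal_re, Complex.re_ofReal_mul, Complex.I_re, mul_zero, add_zero]
  · rw [Complex.add_im, Complex.ofReal_im, Complex.im_ofReal_mul, Complex.I_im, mul_one, zero_add]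

lemma quadZeta_im (δ κ : ℝ) : (quadZeta δ κ).im = κ := by
  by_cases hκ : κ = 0
  · rw [hκ, quadZeta_zero, show (1 : ℂ) / (2 * (δ : ℂ)) = ((1 / (2 * δ) : ℝ) : ℂ) by push_cast; rfl,
      Complex.ofReal_im]
  · rw [quadZeta_of_ne hκ]

lemma two_mul_quadZeta (δ : ℝ) {κ : ℝ} (hκ : κ ≠ 0) : 2 * (δ : ℂ) * quadZeta δ κ =
    ⟨2 * δ * κ * Real.cot (2 * δ * κ), 2 * δ * κ⟩ := by
  rw [quadZeta_of_ne hκ]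
  apply Complex.ext
  · simp
    ring
  · simp

/-- On the quadratrix `-2δζ` is the curve point at angle `b = 2δκ`, so the argument is real and
negative. This reduces all Lambert values to the negative axis, with `s = levelFun b - 2δu`. -/
lemma lambertArg_quadZeta (hδ : 0 < δ) {κ : ℝ} (h0 : 0 ≤ κ) (h1 : 2 * δ * κ < Real.pi) (u : ℝ) :
    lambertArg δ (quadZeta δ κ) u =
      (-Real.exp (levelFun (2 * δ * κ) - 2 * δ * u - 1) : ℝ) := by
  have key : -(2 * (δ : ℂ) * quadZeta δ κ) * Complex.exp (-(2 * (δ : ℂ) * quadZeta δ κ)) =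
      (-Real.exp (levelFun (2 * δ * κ) - 1) : ℝ) := by
    rcases h0.eq_or_lt with rfl | h0
    · rw [quadZeta_zero, mul_one_div_cancel (by simp [hδ.ne']), mul_zero, levelFun_zero]
      push_cast
      ring_nf
    · have hb : 0 < 2 * δ * κ := by positivity
      rw [← curve_mul_exp hb h1, two_mul_quadZeta δ h0.ne']
      have : -(⟨2 * δ * κ * Real.cot (2 * δ * κ), 2 * δ * κ⟩ : ℂ) =
          ⟨-(2 * δ * κ) * Real.cot (2 * δ * κ), -(2 * δ * κ)⟩ := by
        apply Complex.ext <;> simp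
      rw [this]
  rw [lambertArg, show -(2 * (δ : ℂ)) * (quadZeta δ κ + u) =
    -(2 * (δ : ℂ) * quadZeta δ κ) + (-(2 * δ * u) : ℝ) by push_cast; ring, Complex.exp_add,
    ← mul_assoc, key, ← Complex.ofReal_exp, ← Complex.ofReal_mul]
  congr 1
  rw [neg_mul, ← Real.exp_add]
  ring_nf

/-- In polar form `2δζ = exp (i b) / sinc b`, and `0 < b < π` makes the principal logarithm equal to
`-log (sinc b) + i b`. -/
lemma levelE_quadZeta (hδ : 0 < δ) {κ : ℝ} (h0 : 0 < κ) (h1 : 2 * δ * κ < Real.pi) :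
    levelE δ (quadZeta δ κ) = (levelFun (2 * δ * κ) / (2 * δ) : ℝ) := by
  set b := 2 * δ * κ with hb
  have hb0 : 0 < b := by positivity
  have hs := sinc_pos_of_mem hb0.le h1
  have hsin := Real.sin_pos_of_pos_of_lt_pi hb0 h1
  have hexp : 2 * (δ : ℂ) * quadZeta δ κ =
      Complex.exp ((-Real.log (Real.sinc b) : ℝ) + b * Complex.I) := by
    rw [two_mul_quadZeta δ h0.ne', ← hb]
    apply Complex.ext
    · rw [Complex.exp_re]
      simp only [Complex.add_re, Complex.ofReal_re, Complex.mul_re, Complex.I_re, mul_zero,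
        Complex.ofReal_im, Complex.I_im, sub_self, add_zero, Complex.add_im, Complex.mul_im,
        mul_one, zero_add, Real.exp_neg, Real.exp_log hs]
      rw [mul_cot_eq hb0.ne']
      ring
    · rw [Complex.exp_im]
      simp only [Complex.add_re, Complex.ofReal_re, Complex.mul_re, Complex.I_re, mul_zero,
        Complex.ofReal_im, Complex.I_im, sub_self, add_zero, Complex.add_im, Complex.mul_im,
        mul_one, zero_add, Real.exp_neg, Real.exp_log hs]
      rw [Real.sinc_of_ne_zero hb0.ne']
      field_simp
  have him : ((-Real.log (Real.sinc b) : ℝ) + b * Complex.I : ℂ).im = b := by simp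
  have hlog : Complex.log (2 * (δ : ℂ) * quadZeta δ κ) =
      (-Real.log (Real.sinc b) : ℝ) + b * Complex.I := by
    rw [hexp, Complex.log_exp] <;> rw [him] <;> linarith [Real.pi_pos]
  have h2 : 2 * (δ : ℂ) * quadZeta δ κ = (Real.cos b / Real.sinc b : ℝ) + b * Complex.I := by
    rw [two_mul_quadZeta δ h0.ne', ← hb, mul_cot_eq hb0.ne']
    apply Complex.ext
    · rw [Complex.add_re, Complex.ofReal_re, Complex.re_ofReal_mul, Complex.I_re, mul_zero,
        add_zero]
    · rw [Complex.add_im, Complex.ofReal_im, Complex.im_ofReal_mul, Complex.I_im, mul_one,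
        zero_add]
  have hδ' : (2 * (δ : ℂ)) ≠ 0 := by simp [hδ.ne']
  rw [levelE, hlog]
  have h3 : quadZeta δ κ = ((Real.cos b / Real.sinc b : ℝ) + b * Complex.I) / (2 * (δ : ℂ)) := by
    rw [← h2, mul_div_cancel_left₀ _ hδ']
  rw [h3, levelFun]
  push_cast
  ring

lemma kappaMax_eq (hδ : 0 < δ) (u₀ : ℝ → ℝ) (xm : ℝ) :
    2 * δ * kappaMax δ u₀ xm = lambertAngle (2 * δ * u₀ xm) := by
  have h : -Complex.exp (2 * δ * u₀ xm - 1) = (-Real.exp (2 * δ * u₀ xm - 1) : ℝ) := by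
    push_cast
    ring
  have h2 : -(1 / (2 * (δ : ℂ))) = ((-(1 / (2 * δ)) : ℝ) : ℂ) := by push_cast; ring
  rw [kappaMax, zetaMax, h, h2, Complex.im_ofReal_mul, lambertAngle]
  field_simp

lemma kappaMax_nonneg (hδ : 0 < δ) (u₀ : ℝ → ℝ) (xm : ℝ) : 0 ≤ kappaMax δ u₀ xm := by
  have h := (lambertAngle_spec (2 * δ * u₀ xm)).1.1
  rw [← kappaMax_eq hδ] at h
  by_contra hc
  have := mul_pos (by positivity : 0 < 2 * δ) (neg_pos.2 (not_le.1 hc))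
  linarith

lemma two_mul_kappaMax_lt (hδ : 0 < δ) (u₀ : ℝ → ℝ) (xm : ℝ) :
    2 * δ * kappaMax δ u₀ xm < Real.pi := by
  rw [kappaMax_eq hδ]
  exact (lambertAngle_spec _).1.2

lemma two_mul_mem (hδ : 0 < δ) {κ : ℝ} (hκ : κ ∈ Icc 0 (kappaMax δ u₀ xm)) :
    2 * δ * κ ∈ Ico 0 Real.pi := by
  refine ⟨mul_nonneg (by positivity) hκ.1, lt_of_le_of_lt ?_ (two_mul_kappaMax_lt hδ u₀ xm)⟩
  exact mul_le_mul_of_nonneg_left hκ.2 (by positivity)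

lemma levelFun_two_mul_le (hδ : 0 < δ) (hpos : 0 ≤ u₀ xm) {κ : ℝ}
    (hκ : κ ∈ Icc 0 (kappaMax δ u₀ xm)) : levelFun (2 * δ * κ) ≤ 2 * δ * u₀ xm := by
  have h1 := strictMonoOn_levelFun.monotoneOn (two_mul_mem hδ hκ)
    (two_mul_mem hδ ⟨kappaMax_nonneg hδ u₀ xm, le_rfl⟩)
    (mul_le_mul_of_nonneg_left hκ.2 (by positivity))
  rwa [kappaMax_eq hδ, (lambertAngle_spec _).2, max_eq_left (by positivity)] at h1

/-! ### Turning points -/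

namespace IsAdmissibleInitialCondition

variable (hu : IsAdmissibleInitialCondition u₀ xm)
include hu

lemma continuous : Continuous u₀ := hu.contDiff.continuous

lemma hasDerivAt (x : ℝ) : HasDerivAt u₀ (deriv u₀ x) x :=
  (hu.contDiff.differentiable (by norm_num) x).hasDerivAt

/-- By Darboux's theorem a nowhere vanishing derivative has constant sign on the half-line, and a
positive sign would contradict maximality at `xm`. -/
lemma strictAntiOn : StrictAntiOn u₀ (Ici xm) := by
  have h := hasDerivWithinAt_forall_lt_or_forall_gt_of_forall_ne (convex_Ioi xm)
    (fun x _ => (hu.hasDerivAt x).hasDerivWithinAt) (m := 0)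
    (fun x hx => hu.deriv_ne_zero x (ne_of_gt hx))
  rcases h with h | h
  · exact strictAntiOn_of_deriv_neg (convex_Ici _) hu.continuous.continuousOn
      (fun x hx => h x (by rwa [interior_Ici] at hx))
  · have := strictMonoOn_of_deriv_pos (convex_Ici xm) hu.continuous.continuousOn
      (fun x hx => h x (by rwa [interior_Ici] at hx))
    have h2 := this self_mem_Ici (show xm + 1 ∈ Ici xm by simp) (by linarith)
    exact absurd (hu.le_max (xm + 1)) (not_le.2 h2)

lemma strictMonoOn : StrictMonoOn u₀ (Iic xm) := by
  have h := hasDerivWithinAt_forall_lt_or_forall_gt_of_forall_ne (convex_Iio xm)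
    (fun x _ => (hu.hasDerivAt x).hasDerivWithinAt) (m := 0)
    (fun x hx => hu.deriv_ne_zero x (ne_of_lt hx))
  rcases h with h | h
  · have := strictAntiOn_of_deriv_neg (convex_Iic xm) hu.continuous.continuousOn
      (fun x hx => h x (by rwa [interior_Iic] at hx))
    have h2 := this (show xm - 1 ∈ Iic xm by simp) self_mem_Iic (by linarith)
    exact absurd (hu.le_max (xm - 1)) (not_le.2 h2)
  · exact strictMonoOn_of_deriv_pos (convex_Iic _) hu.continuous.continuousOn
      (fun x hx => h x (by rwa [interior_Iic] at hx))

lemma exists_right {E : ℝ} (h0 : 0 < E) (h1 : E ≤ u₀ xm) : ∃ x, xm ≤ x ∧ u₀ x = E := by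
  obtain ⟨y, hy1, hy2⟩ := ((hu.tendsto_atTop.eventually (gt_mem_nhds h0)).and
    (eventually_ge_atTop xm)).exists
  obtain ⟨x, hx, hxE⟩ := intermediate_value_Icc' hy2 hu.continuous.continuousOn ⟨hy1.le, h1⟩
  exact ⟨x, hx.1, hxE⟩

lemma exists_left {E : ℝ} (h0 : 0 < E) (h1 : E ≤ u₀ xm) : ∃ x, x ≤ xm ∧ u₀ x = E := by
  obtain ⟨y, hy1, hy2⟩ := ((hu.tendsto_atBot.eventually (gt_mem_nhds h0)).and
    (eventually_le_atBot xm)).exists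
  obtain ⟨x, hx, hxE⟩ := intermediate_value_Icc hy2 hu.continuous.continuousOn ⟨hy1.le, h1⟩
  exact ⟨x, hx.2, hxE⟩

lemma level_pos_le (hδ : 0 < δ) {κ : ℝ} (hκ : κ ∈ Ioc 0 (kappaMax δ u₀ xm)) :
    0 < levelFun (2 * δ * κ) / (2 * δ) ∧ levelFun (2 * δ * κ) / (2 * δ) ≤ u₀ xm := by
  have hmem := two_mul_mem hδ ⟨hκ.1.le, hκ.2⟩
  constructor
  · have := strictMonoOn_levelFun ⟨le_rfl, Real.pi_pos⟩ hmem
      (mul_pos (by positivity) hκ.1)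
    rw [levelFun_zero] at this
    positivity
  · rw [div_le_iff₀ (by positivity), mul_comm (u₀ xm)]
    exact levelFun_two_mul_le hδ (hu.pos xm).le ⟨hκ.1.le, hκ.2⟩

lemma turningRight_spec (hδ : 0 < δ) {κ : ℝ} (hκ : κ ∈ Ioc 0 (kappaMax δ u₀ xm)) :
    xm ≤ turningRight δ u₀ xm (quadZeta δ κ) ∧
      2 * δ * u₀ (turningRight δ u₀ xm (quadZeta δ κ)) = levelFun (2 * δ * κ) := by
  obtain ⟨h0, h1⟩ := hu.level_pos_le hδ hκ
  obtain ⟨x, hx, hxE⟩ := hu.exists_right h0 h1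
  have : {y : ℝ | xm ≤ y ∧ (u₀ y : ℂ) = levelE δ (quadZeta δ κ)} = {x} := by
    ext y
    rw [mem_ofPred_eq, levelE_quadZeta hδ hκ.1 (two_mul_mem hδ ⟨hκ.1.le, hκ.2⟩).2,
      Complex.ofReal_inj, ← hxE, mem_singleton_iff]
    exact ⟨fun h => hu.strictAntiOn.injOn h.1 hx h.2, by rintro rfl; exact ⟨hx, rfl⟩⟩
  rw [turningRight, this, csSup_singleton, hxE]
  exact ⟨hx, by field_simp⟩

lemma turningLeft_spec (hδ : 0 < δ) {κ : ℝ} (hκ : κ ∈ Ioc 0 (kappaMax δ u₀ xm)) :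
    turningLeft δ u₀ xm (quadZeta δ κ) ≤ xm ∧
      2 * δ * u₀ (turningLeft δ u₀ xm (quadZeta δ κ)) = levelFun (2 * δ * κ) := by
  obtain ⟨h0, h1⟩ := hu.level_pos_le hδ hκ
  obtain ⟨x, hx, hxE⟩ := hu.exists_left h0 h1
  have : {y : ℝ | y ≤ xm ∧ (u₀ y : ℂ) = levelE δ (quadZeta δ κ)} = {x} := by
    ext y
    rw [mem_ofPred_eq, levelE_quadZeta hδ hκ.1 (two_mul_mem hδ ⟨hκ.1.le, hκ.2⟩).2,
      Complex.ofReal_inj, ← hxE, mem_singleton_iff]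
    exact ⟨fun h => hu.strictMonoOn.injOn h.1 hx h.2, by rintro rfl; exact ⟨hx, rfl⟩⟩
  rw [turningLeft, this, csSup_singleton, hxE]
  exact ⟨hx, by field_simp⟩

/-! ### The Weyl law and the tail integral as integrals over fixed domains -/

omit hu in
lemma weylIntegrand_eq (hδ : 0 < δ) {κ : ℝ} (hκ : κ ∈ Icc 0 (kappaMax δ u₀ xm)) {y : ℝ}
    (hy : levelFun (2 * δ * κ) ≤ 2 * δ * u₀ y) :
    weylIntegrand δ u₀ (quadZeta δ κ) y = lambertGap (levelFun (2 * δ * κ) - 2 * δ * u₀ y) := by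
  rw [weylIntegrand, lambertArg_quadZeta hδ hκ.1 (two_mul_mem hδ hκ).2, lambertGap,
    if_pos (by linarith)]

/-- The gap vanishes exactly where it should: outside the turning points its argument is
nonnegative. The moving endpoints disappear, the vertex is included, and `κ` enters only through a
monotone integrand. -/
lemma weylR_quadZeta (hδ : 0 < δ) {κ : ℝ} (hκ : κ ∈ Icc 0 (kappaMax δ u₀ xm)) :
    weylR δ u₀ xm (quadZeta δ κ) =
      1 / (4 * δ) * ∫ y, lambertGap (levelFun (2 * δ * κ) - 2 * δ * u₀ y) := by
  rcases hκ.1.eq_or_lt with rfl | h0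
  · rw [weylR, if_pos (quadZeta_zero δ)]
    congr 1
    refine integral_congr_ae (Eventually.of_forall fun y => ?_)
    refine weylIntegrand_eq hδ hκ ?_
    rw [mul_zero, levelFun_zero]
    have := hu.pos y
    positivity
  · have hne : quadZeta δ κ ≠ 1 / (2 * (δ : ℂ)) := by
      intro h
      have h' := congrArg Complex.im h
      rw [← quadZeta_zero, quadZeta_im, quadZeta_im] at h'
      exact h0.ne' h'
    obtain ⟨hr, hr'⟩ := hu.turningRight_spec hδ ⟨h0, hκ.2⟩
    obtain ⟨hl, hl'⟩ := hu.turningLeft_spec hδ ⟨h0, hκ.2⟩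
    rw [weylR, if_neg hne, intervalIntegral.integral_of_le (hl.trans hr)]
    congr 1
    set r := turningRight δ u₀ xm (quadZeta δ κ)
    set l := turningLeft δ u₀ xm (quadZeta δ κ)
    have hδ2 : 0 < 2 * δ := by positivity
    rw [← setIntegral_eq_integral_of_forall_compl_eq_zero (s := Ioc l r)
      (f := fun y => lambertGap (levelFun (2 * δ * κ) - 2 * δ * u₀ y))]
    · refine setIntegral_congr_fun measurableSet_Ioc fun y hy => weylIntegrand_eq hδ hκ ?_
      rcases le_total y xm with h | h
      · rw [← hl']
        exact mul_le_mul_of_nonneg_left (hu.strictMonoOn.monotoneOn hl h hy.1.le) hδ2.le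
      · rw [← hr']
        exact mul_le_mul_of_nonneg_left (hu.strictAntiOn.antitoneOn h hr hy.2) hδ2.le
    · intro y hy
      refine lambertGap_of_nonneg (sub_nonneg.2 ?_)
      rcases lt_or_ge l y with h | h
      · have h2 : r < y := by
          by_contra hc
          exact hy ⟨h, not_lt.1 hc⟩
        rw [← hr']
        exact mul_le_mul_of_nonneg_left
          (hu.strictAntiOn.antitoneOn hr (hr.trans h2.le) h2.le) hδ2.le
      · rw [← hl']
        exact mul_le_mul_of_nonneg_left
          (hu.strictMonoOn.monotoneOn (h.trans hl) hl h) hδ2.le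

end IsAdmissibleInitialCondition

/-- The integrand of the tail integral on the quadratrix, extended by `κ` to the classically
allowed region. -/
noncomputable def tailIntegrand (δ : ℝ) (u₀ : ℝ → ℝ) (κ y : ℝ) : ℝ :=
  κ - lambertAngle (levelFun (2 * δ * κ) - 2 * δ * u₀ y) / (2 * δ)

lemma thetaIntegrand_eq (hδ : 0 < δ) {κ : ℝ} (hκ : κ ∈ Icc 0 (kappaMax δ u₀ xm)) (y : ℝ) :
    (quadZeta δ κ + 1 / (2 * (δ : ℂ)) *
      lambertWNegOne (lambertArg δ (quadZeta δ κ) (u₀ y))).im = tailIntegrand δ u₀ κ y := by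
  rw [lambertArg_quadZeta hδ hκ.1 (two_mul_mem hδ hκ).2, Complex.add_im, quadZeta_im,
    show (1 : ℂ) / (2 * (δ : ℂ)) = ((1 / (2 * δ) : ℝ) : ℂ) by push_cast; rfl,
    Complex.im_ofReal_mul, tailIntegrand, lambertAngle]
  ring

/-- `2δκ` is itself the angle at level `levelFun (2δκ)`, so the integrand is a difference of two
angles whose arguments differ by `2δ u₀(y)`. -/
lemma tailIntegrand_bound (hδ : 0 < δ) {κ : ℝ} (hκ : κ ∈ Icc 0 (kappaMax δ u₀ xm)) {y : ℝ}
    (hy : 0 ≤ u₀ y) : 0 ≤ tailIntegrand δ u₀ κ y ∧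
      tailIntegrand δ u₀ κ y ≤ Real.sqrt (4 * δ) / (2 * δ) * Real.sqrt (u₀ y) := by
  have hle : levelFun (2 * δ * κ) - 2 * δ * u₀ y ≤ levelFun (2 * δ * κ) := by
    have : 0 ≤ 2 * δ * u₀ y := by positivity
    linarith
  have h1 := lambertAngle_mono hle
  have h2 := lambertAngle_sub_le hle
  rw [lambertAngle_levelFun (two_mul_mem hδ hκ)] at h1 h2
  have h3 : tailIntegrand δ u₀ κ y =
      (2 * δ * κ - lambertAngle (levelFun (2 * δ * κ) - 2 * δ * u₀ y)) / (2 * δ) := by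
    rw [tailIntegrand]
    field_simp
  rw [h3, div_mul_eq_mul_div, ← Real.sqrt_mul (by positivity)]
  constructor
  · exact div_nonneg (by linarith) (by positivity)
  · gcongr
    refine h2.trans (le_of_eq ?_)
    congr 1
    ring

namespace IsAdmissibleInitialCondition

variable (hu : IsAdmissibleInitialCondition u₀ xm)
include hu

lemma measurable_tailIntegrand (δ κ : ℝ) : Measurable (tailIntegrand δ u₀ κ) := by
  unfold tailIntegrand
  exact measurable_const.sub ((lambertAngle_mono.measurable.comp
    (measurable_const.sub (hu.continuous.measurable.const_mul _))).div_const _)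

/-! ### Consequences of the moment condition -/

/-- Weighted arithmetic-geometric mean: `u₀ ^ (3/8)` is a product of powers `3/8` of `(1 + y²) u₀`
and `5/8` of `(1 + y²) ^ (-3/5)`, both integrable. The exponent must exceed `1/3` for the second
factor to be integrable, and stay below `1/2` to leave a positive Hölder exponent for the Weyl law.
-/
lemma integrable_rpow : Integrable (fun y => u₀ y ^ (3 / 8 : ℝ)) := by
  have h2 : Integrable (fun y : ℝ => (1 + ‖y‖ ^ 2) ^ (-(6 / 5) / 2 : ℝ)) :=
    integrable_rpow_neg_one_add_norm_sq (by simp; norm_num)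
  refine (hu.integrable_moment.add h2).mono'
    (hu.continuous.rpow_const (fun x => Or.inr (by norm_num))).aestronglyMeasurable
    (Eventually.of_forall fun y => ?_)
  have hp := hu.pos y
  have hq : (0 : ℝ) < 1 + y ^ 2 := by positivity
  rw [Real.norm_of_nonneg (by positivity)]
  have := Real.geom_mean_le_arith_mean2_weighted (w₁ := 3 / 8) (w₂ := 5 / 8)
    (p₁ := (y ^ 2 + 1) * u₀ y) (p₂ := (1 + y ^ 2) ^ (-(6 / 5) / 2 : ℝ)) (by norm_num)
    (by norm_num) (by positivity) (by positivity) (by norm_num)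
  have h3 : ((y ^ 2 + 1) * u₀ y) ^ (3 / 8 : ℝ) * ((1 + y ^ 2) ^ (-(6 / 5) / 2 : ℝ)) ^ (5 / 8 : ℝ)
      = u₀ y ^ (3 / 8 : ℝ) := by
    rw [Real.mul_rpow (by positivity) hp.le, ← Real.rpow_mul hq.le, add_comm (y ^ 2) 1,
      mul_right_comm, ← Real.rpow_add hq]
    norm_num
  rw [h3] at this
  simp only [Pi.add_apply, Real.norm_eq_abs, sq_abs]
  have h4 : 0 ≤ (y ^ 2 + 1) * u₀ y := by positivity
  have h5 : 0 ≤ (1 + y ^ 2) ^ (-(6 / 5) / 2 : ℝ) := by positivity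
  linarith

lemma integrable_sqrt : Integrable (fun y => Real.sqrt (u₀ y)) := by
  refine (hu.integrable_rpow.const_mul (u₀ xm ^ (1 / 8 : ℝ))).mono'
    hu.continuous.sqrt.aestronglyMeasurable (Eventually.of_forall fun y => ?_)
  have hp := hu.pos y
  rw [Real.norm_of_nonneg (by positivity), Real.sqrt_eq_rpow,
    show (1 / 2 : ℝ) = 1 / 8 + 3 / 8 by norm_num, Real.rpow_add hp]
  gcongr
  exact hu.le_max y

lemma integrable_tailIntegrand (hδ : 0 < δ) {κ : ℝ} (hκ : κ ∈ Icc 0 (kappaMax δ u₀ xm)) :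
    Integrable (tailIntegrand δ u₀ κ) := by
  refine (hu.integrable_sqrt.const_mul (Real.sqrt (4 * δ) / (2 * δ))).mono'
    (hu.measurable_tailIntegrand δ κ).aestronglyMeasurable (Eventually.of_forall fun y => ?_)
  have := tailIntegrand_bound hδ hκ (hu.pos y).le
  rw [Real.norm_of_nonneg this.1]
  exact this.2

/-- Between `xm` and the turning point the angle is `0` and the integrand is the constant `κ`, which
accounts for `κ (x₊ - xm)`. The domain becomes independent of `κ`, as needed for measurability and
bounds. -/
lemma thetaPlus_quadZeta (hδ : 0 < δ) {κ : ℝ} (hκ : κ ∈ Ioc 0 (kappaMax δ u₀ xm)) :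
    thetaPlus δ u₀ xm (quadZeta δ κ) = κ * xm + ∫ y in Ioi xm, tailIntegrand δ u₀ κ y := by
  have hκ' : κ ∈ Icc 0 (kappaMax δ u₀ xm) := ⟨hκ.1.le, hκ.2⟩
  obtain ⟨hr, hr'⟩ := hu.turningRight_spec hδ hκ
  rw [thetaPlus, quadZeta_im]
  set r := turningRight δ u₀ xm (quadZeta δ κ)
  simp_rw [thetaIntegrand_eq hδ hκ']
  have hint := hu.integrable_tailIntegrand hδ hκ'
  rw [← Ioc_union_Ioi_eq_Ioi hr, setIntegral_union (Ioc_disjoint_Ioi le_rfl) measurableSet_Ioi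
    hint.integrableOn hint.integrableOn]
  have : ∫ y in Ioc xm r, tailIntegrand δ u₀ κ y = ∫ y in Ioc xm r, κ := by
    refine setIntegral_congr_fun measurableSet_Ioc fun y hy => ?_
    have h2 : levelFun (2 * δ * κ) ≤ 2 * δ * u₀ y := by
      rw [← hr']
      exact mul_le_mul_of_nonneg_left (hu.strictAntiOn.antitoneOn hy.1.le hr hy.2) (by positivity)
    simp only [tailIntegrand]
    rw [lambertAngle_of_nonpos (by linarith), zero_div, sub_zero]
  rw [this, setIntegral_const, measureReal_def, Real.volume_Ioc,
    ENNReal.toReal_ofReal (by linarith), smul_eq_mul]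
  ring

end IsAdmissibleInitialCondition

end ILW

namespace ILW

variable {δ : ℝ} {u₀ : ℝ → ℝ} {xm : ℝ}

/-! ### The measure on the spectral interval -/

lemma measurable_levelFun : Measurable levelFun := by
  unfold levelFun
  exact (measurable_const.sub (Real.measurable_log.comp Real.continuous_sinc.measurable)).sub
    (Real.measurable_cos.div Real.continuous_sinc.measurable)

lemma measurable_quadZeta (δ : ℝ) : Measurable (quadZeta δ) := by
  have h : Measurable Real.cot := by
    have : Real.cot = fun x => Real.cos x / Real.sin x := funext Real.cot_eq_cos_div_sin
    rw [this]
    exact Real.measurable_cos.div Real.measurable_sin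
  unfold quadZeta
  refine Measurable.ite (measurableSet_singleton 0) measurable_const ?_
  exact (Complex.measurable_ofReal.comp (measurable_id.mul (h.comp (measurable_id.const_mul _)))).add
    (Complex.measurable_ofReal.mul_const _)

instance isFiniteMeasure_kappaMeasure : IsFiniteMeasure (kappaMeasure δ u₀ xm) := by
  unfold kappaMeasure
  infer_instance

instance nullSingletonClass_kappaMeasure : NullSingletonClass (kappaMeasure δ u₀ xm) := by
  unfold kappaMeasure
  infer_instance

lemma ae_kappaMeasure_mem : ∀ᵐ κ ∂(kappaMeasure δ u₀ xm), κ ∈ Ioo 0 (kappaMax δ u₀ xm) := by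
  rw [kappaMeasure, ← restrict_Ioo_eq_restrict_Icc]
  exact ae_restrict_mem measurableSet_Ioo

/-! ### Hölder continuity of the Weyl law -/

/-- Interpolation between the two bounds with weights `3/4` and `1/4`. -/
lemma le_rpow_mul_rpow_of_le_sqrt {d x y : ℝ} (hd : 0 ≤ d) (hx : 0 ≤ x) (hy : 0 ≤ y)
    (h1 : d ≤ Real.sqrt x) (h2 : d ≤ Real.sqrt y) : d ≤ x ^ (3 / 8 : ℝ) * y ^ (1 / 8 : ℝ) := by
  have h3 : Real.sqrt x ^ (3 / 4 : ℝ) = x ^ (3 / 8 : ℝ) := by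
    rw [Real.sqrt_eq_rpow, ← Real.rpow_mul hx]
    norm_num
  have h4 : Real.sqrt y ^ (1 / 4 : ℝ) = y ^ (1 / 8 : ℝ) := by
    rw [Real.sqrt_eq_rpow, ← Real.rpow_mul hy]
    norm_num
  calc d = d ^ (3 / 4 : ℝ) * d ^ (1 / 4 : ℝ) := by
        rw [← Real.rpow_add_of_nonneg hd (by norm_num) (by norm_num)]
        norm_num
    _ ≤ Real.sqrt x ^ (3 / 4 : ℝ) * Real.sqrt y ^ (1 / 4 : ℝ) := by gcongr
    _ = _ := by rw [h3, h4]

namespace IsAdmissibleInitialCondition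

variable (hu : IsAdmissibleInitialCondition u₀ xm)
include hu

/-- The difference of gaps is bounded by a multiple of `√(2δ u₀(y))`, which is integrable but not
small, and by the same multiple of the square root of the level increment, which is small but not
integrable in `y`. Interpolating gives `u₀ ^ (3/8)` times the increment to the power `1/8`. -/
lemma exists_weylR_holder (hδ : 0 < δ) : ∃ C > 0, ∀ a b, 0 ≤ a → a ≤ b →
    b ≤ kappaMax δ u₀ xm →
      0 ≤ weylR δ u₀ xm (quadZeta δ a) - weylR δ u₀ xm (quadZeta δ b) ∧
      weylR δ u₀ xm (quadZeta δ a) - weylR δ u₀ xm (quadZeta δ b) ≤ C * (b - a) ^ (1 / 8 : ℝ) := by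
  have hum := hu.pos xm
  obtain ⟨CF, hCF, hF⟩ := exists_lambertGap_bound (2 * δ * u₀ xm) (by positivity)
  obtain ⟨CL, hCL, hL⟩ := exists_levelFun_sub_le
    (mul_nonneg (by positivity) (kappaMax_nonneg hδ u₀ xm)) (two_mul_kappaMax_lt hδ u₀ xm)
  have hI : 0 ≤ ∫ y, u₀ y ^ (3 / 8 : ℝ) :=
    integral_nonneg fun y => Real.rpow_nonneg (hu.pos y).le _
  refine ⟨1 / (4 * δ) * (CF * (2 * δ) ^ (3 / 8 : ℝ) * (CL * (2 * δ)) ^ (1 / 8 : ℝ) *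
    ((∫ y, u₀ y ^ (3 / 8 : ℝ)) + 1)), by positivity, ?_⟩
  have hlow : ∀ κ ∈ Icc 0 (kappaMax δ u₀ xm), ∀ y,
      0 ≤ lambertGap (levelFun (2 * δ * κ) - 2 * δ * u₀ y) ∧
      lambertGap (levelFun (2 * δ * κ) - 2 * δ * u₀ y) ≤ CF * Real.sqrt (2 * δ * u₀ y) := by
    intro κ hκ y
    have he := levelFun_nonneg (two_mul_mem hδ hκ).1 (two_mul_mem hδ hκ).2
    have h1 : -(2 * δ * u₀ xm) ≤ -(2 * δ * u₀ y) :=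
      neg_le_neg (mul_le_mul_of_nonneg_left (hu.le_max y) (by positivity))
    have h2 : 0 ≤ 2 * δ * u₀ y := by
      have := hu.pos y
      positivity
    have h3 := (hF _ _ h1 (neg_nonpos.2 h2)).2
    rw [lambertGap_of_nonneg le_rfl, sub_zero, zero_sub, neg_neg] at h3
    constructor
    · rw [← lambertGap_of_nonneg (le_max_right (levelFun (2 * δ * κ) - 2 * δ * u₀ y) 0)]
      exact lambertGap_antitone (le_max_left _ _)
    · exact (lambertGap_antitone (by linarith)).trans h3
  have hint : ∀ κ ∈ Icc 0 (kappaMax δ u₀ xm),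
      Integrable (fun y => lambertGap (levelFun (2 * δ * κ) - 2 * δ * u₀ y)) := by
    intro κ hκ
    refine (hu.integrable_sqrt.const_mul (CF * Real.sqrt (2 * δ))).mono'
      (lambertGap_antitone.measurable.comp (measurable_const.sub
        (hu.continuous.measurable.const_mul _))).aestronglyMeasurable
      (Eventually.of_forall fun y => ?_)
    have h := hlow κ hκ y
    rw [Real.norm_of_nonneg h.1, mul_assoc CF, ← Real.sqrt_mul (by positivity)]
    exact h.2
  intro a b ha hab hb
  have ha' : a ∈ Icc 0 (kappaMax δ u₀ xm) := ⟨ha, hab.trans hb⟩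
  have hb' : b ∈ Icc 0 (kappaMax δ u₀ xm) := ⟨ha.trans hab, hb⟩
  have hmul : 2 * δ * a ≤ 2 * δ * b := mul_le_mul_of_nonneg_left hab (by positivity)
  have hmono := strictMonoOn_levelFun.monotoneOn (two_mul_mem hδ ha') (two_mul_mem hδ hb') hmul
  rw [hu.weylR_quadZeta hδ ha', hu.weylR_quadZeta hδ hb', ← mul_sub,
    ← integral_sub (hint a ha') (hint b hb')]
  have hD : ∀ y, 0 ≤ lambertGap (levelFun (2 * δ * a) - 2 * δ * u₀ y) -
      lambertGap (levelFun (2 * δ * b) - 2 * δ * u₀ y) := fun y =>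
    sub_nonneg.2 (lambertGap_antitone (by linarith))
  constructor
  · exact mul_nonneg (by positivity) (integral_nonneg hD)
  have hΔ : levelFun (2 * δ * b) - levelFun (2 * δ * a) ≤ CL * (2 * δ) * (b - a) := by
    have := hL (2 * δ * a) (2 * δ * b) (by positivity) hmul
      (mul_le_mul_of_nonneg_left hb (by positivity))
    linarith
  have hDle : ∀ y, lambertGap (levelFun (2 * δ * a) - 2 * δ * u₀ y) -
      lambertGap (levelFun (2 * δ * b) - 2 * δ * u₀ y) ≤
      (CF * (2 * δ) ^ (3 / 8 : ℝ) * (CL * (2 * δ)) ^ (1 / 8 : ℝ) * (b - a) ^ (1 / 8 : ℝ)) *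
        u₀ y ^ (3 / 8 : ℝ) := by
    intro y
    have hy := hu.pos y
    have h1 := (hlow a ha' y).2
    have h2 := (hlow b hb' y).1
    have hle : -(2 * δ * u₀ xm) ≤ levelFun (2 * δ * a) - 2 * δ * u₀ y := by
      have := mul_le_mul_of_nonneg_left (hu.le_max y) (by positivity : 0 ≤ 2 * δ)
      have := levelFun_nonneg (two_mul_mem hδ ha').1 (two_mul_mem hδ ha').2
      linarith
    have h3 := (hF _ _ hle (show _ ≤ levelFun (2 * δ * b) - 2 * δ * u₀ y by linarith)).2
    rw [sub_sub_sub_cancel_right] at h3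
    have h4 := le_rpow_mul_rpow_of_le_sqrt (d := (lambertGap (levelFun (2 * δ * a) - 2 * δ * u₀ y) -
      lambertGap (levelFun (2 * δ * b) - 2 * δ * u₀ y)) / CF) (x := 2 * δ * u₀ y)
      (y := levelFun (2 * δ * b) - levelFun (2 * δ * a)) (div_nonneg (hD y) hCF.le)
      (by positivity) (by linarith) (by rw [div_le_iff₀ hCF]; linarith)
      (by rw [div_le_iff₀ hCF]; linarith)
    rw [div_le_iff₀ hCF] at h4
    refine h4.trans ?_
    have h5 : (levelFun (2 * δ * b) - levelFun (2 * δ * a)) ^ (1 / 8 : ℝ) ≤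
        (CL * (2 * δ)) ^ (1 / 8 : ℝ) * (b - a) ^ (1 / 8 : ℝ) := by
      rw [← Real.mul_rpow (by positivity) (sub_nonneg.2 hab)]
      exact Real.rpow_le_rpow (by linarith) hΔ (by norm_num)
    rw [Real.mul_rpow (by positivity) hy.le]
    calc _ ≤ (2 * δ) ^ (3 / 8 : ℝ) * u₀ y ^ (3 / 8 : ℝ) *
          ((CL * (2 * δ)) ^ (1 / 8 : ℝ) * (b - a) ^ (1 / 8 : ℝ)) * CF := by gcongr
      _ = _ := by ring
  have := integral_mono ((hint a ha').sub (hint b hb')) (hu.integrable_rpow.const_mul _) hDle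
  rw [integral_const_mul] at this
  have hba : 0 ≤ (b - a) ^ (1 / 8 : ℝ) := Real.rpow_nonneg (sub_nonneg.2 hab) _
  calc _ ≤ 1 / (4 * δ) * ((CF * (2 * δ) ^ (3 / 8 : ℝ) * (CL * (2 * δ)) ^ (1 / 8 : ℝ) *
        (b - a) ^ (1 / 8 : ℝ)) * ((∫ y, u₀ y ^ (3 / 8 : ℝ)) + 1)) := by
        gcongr
        exact this.trans (by gcongr; linarith)
    _ = _ := by ring

/-! ### The Weyl density -/

lemma monotoneOn_neg_weylR (hδ : 0 < δ) :
    MonotoneOn (fun s => -weylR δ u₀ xm (quadZeta δ s)) (Icc 0 (kappaMax δ u₀ xm)) := by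
  obtain ⟨C, -, h⟩ := hu.exists_weylR_holder hδ
  intro a ha b hb hab
  have := (h a b ha.1 hab hb.2).1
  simp only
  linarith

omit hu in
lemma deriv_neg_weylR (δ : ℝ) (u₀ : ℝ → ℝ) (xm : ℝ) :
    deriv (fun s => -weylR δ u₀ xm (quadZeta δ s)) = rhoWeyl δ u₀ xm := by
  funext κ
  rw [deriv.fun_neg, rhoWeyl]

omit hu in
lemma measurable_rhoWeyl (δ : ℝ) (u₀ : ℝ → ℝ) (xm : ℝ) : Measurable (rhoWeyl δ u₀ xm) :=
  (measurable_deriv _).neg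

lemma rhoWeyl_nonneg (hδ : 0 < δ) :
    ∀ᵐ κ ∂(kappaMeasure δ u₀ xm), 0 ≤ rhoWeyl δ u₀ xm κ := by
  filter_upwards [ae_kappaMeasure_mem] with κ hκ
  rw [← deriv_neg_weylR, ← derivWithin_of_mem_nhds (Icc_mem_nhds hκ.1 hκ.2)]
  exact (hu.monotoneOn_neg_weylR hδ).derivWithin_nonneg

/-- The derivative of a monotone function is integrable on a compact interval; no smoothness of `R`
is needed. -/
lemma integrable_rhoWeyl (hδ : 0 < δ) : Integrable (rhoWeyl δ u₀ xm) (kappaMeasure δ u₀ xm) := by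
  have h0 := kappaMax_nonneg hδ u₀ xm
  have := (uIcc_of_le h0 ▸ hu.monotoneOn_neg_weylR hδ :
    MonotoneOn _ (uIcc 0 (kappaMax δ u₀ xm))).intervalIntegrable_deriv
  rwa [deriv_neg_weylR, intervalIntegrable_iff_integrableOn_Icc_of_le h0] at this

/-- The measure with density `ρ^Wyl` has Hölder continuous distribution function. -/
lemma exists_setLIntegral_rhoWeyl_le (hδ : 0 < δ) : ∃ C > 0, ∀ κ r : ℝ, 0 ≤ r →
    ∫⁻ η in Metric.closedBall κ r, ENNReal.ofReal (rhoWeyl δ u₀ xm η) ∂(kappaMeasure δ u₀ xm) ≤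
      ENNReal.ofReal (C * (2 * r) ^ (1 / 8 : ℝ)) := by
  obtain ⟨C, hC, h⟩ := hu.exists_weylR_holder hδ
  refine ⟨C, hC, fun κ r hr => ?_⟩
  rw [kappaMeasure, Measure.restrict_restrict Metric.isClosed_closedBall.measurableSet,
    Real.closedBall_eq_Icc, Icc_inter_Icc]
  set a := max (κ - r) 0 with ha
  set b := min (κ + r) (kappaMax δ u₀ xm) with hb
  rcases lt_or_ge b a with hab | hab
  · simp [Icc_eq_empty (not_le.2 hab)]
  have ha0 : 0 ≤ a := le_max_right _ _
  have hbk : b ≤ kappaMax δ u₀ xm := min_le_right _ _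
  have hsub : Icc a b ⊆ Icc 0 (kappaMax δ u₀ xm) := Icc_subset_Icc ha0 hbk
  -- For a monotone function the integral of the derivative is at most the increment. This
  -- inequality suffices, so absolute continuity of `R` is not required.
  have hmem := ((uIcc_of_le hab).symm ▸ (hu.monotoneOn_neg_weylR hδ).mono hsub :
    MonotoneOn _ (uIcc a b)).intervalIntegral_deriv_mem_uIcc
  rw [deriv_neg_weylR] at hmem
  have hh := h a b ha0 hab hbk
  rw [uIcc_of_le (by linarith)] at hmem
  have hint : IntegrableOn (rhoWeyl δ u₀ xm) (Icc a b) :=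
    IntegrableOn.mono_set (hu.integrable_rhoWeyl hδ) hsub
  have hnn : 0 ≤ᵐ[volume.restrict (Icc a b)] rhoWeyl δ u₀ xm :=
    ae_restrict_of_ae_restrict_of_subset hsub (hu.rhoWeyl_nonneg hδ)
  rw [← ofReal_integral_eq_lintegral_ofReal hint hnn, integral_Icc_eq_integral_Ioc,
    ← intervalIntegral.integral_of_le hab]
  refine ENNReal.ofReal_le_ofReal ?_
  have h1 : (b - a) ^ (1 / 8 : ℝ) ≤ (2 * r) ^ (1 / 8 : ℝ) := by
    refine Real.rpow_le_rpow (by linarith) ?_ (by norm_num)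
    have := le_max_left (κ - r) 0
    have := min_le_left (κ + r) (kappaMax δ u₀ xm)
    linarith
  have := hmem.2
  have := hh.2
  nlinarith

/-- Uniform smallness of the truncated logarithmic potential of `ρ^Wyl`. -/
lemma exists_log_tail (hδ : 0 < δ) (A : ℝ) (hA : 0 ≤ A) : ∃ C > 0, ∀ T : ℝ, 0 ≤ T → ∀ κ : ℝ,
    Integrable (fun η => max (Real.log (A / |κ - η|) - T) 0 * rhoWeyl δ u₀ xm η)
      (kappaMeasure δ u₀ xm) ∧
    ∫ η, max (Real.log (A / |κ - η|) - T) 0 * rhoWeyl δ u₀ xm η ∂(kappaMeasure δ u₀ xm) ≤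
      C * Real.exp (-(1 / 8) * T) := by
  obtain ⟨C, hC, h⟩ := hu.exists_setLIntegral_rhoWeyl_le hδ
  -- The factor `8` is `∫ exp (-t/8) dt` over `t > 0`; adding `1` keeps the constant positive when
  -- `A = 0`.
  refine ⟨8 * (C * (2 * A) ^ (1 / 8 : ℝ)) + 1, by positivity, fun T hT κ => ?_⟩
  set ν := kappaMeasure δ u₀ xm
  set w := rhoWeyl δ u₀ xm with hw
  set f : ℝ → ℝ := fun η => max (Real.log (A / |κ - η|) - T) 0 with hf
  have hwm : Measurable w := measurable_rhoWeyl δ u₀ xm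
  have hfm : Measurable f := by
    refine Measurable.max ((Real.measurable_log.comp (measurable_const.div ?_)).sub_const T)
      measurable_const
    exact (continuous_const.sub continuous_id).abs.measurable
  have hf0 : ∀ η, 0 ≤ f η := fun η => le_max_right _ _
  set m := ν.withDensity (fun η => ENNReal.ofReal (w η)) with hm
  -- A superlevel set lies in an interval of radius `A exp (-(T + t))`, so its Weyl mass decays
  -- exponentially and the layer cake formula applies.
  have hexp : ∀ t ∈ Ioi (0 : ℝ), m {η | t ≤ f η} ≤
      ENNReal.ofReal (C * (2 * A) ^ (1 / 8 : ℝ) * Real.exp (-(1 / 8) * T) *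
        Real.exp (-(1 / 8) * t)) := by
    intro t ht
    rw [mem_Ioi] at ht
    have hsub : {η | t ≤ f η} ⊆ Metric.closedBall κ (A * Real.exp (-(T + t))) := by
      intro η hη
      have h1 : T + t ≤ Real.log (A / |κ - η|) := by
        rcases le_max_iff.1 (show t ≤ max _ _ from hη) with h | h <;> linarith
      -- With the conventions `A / 0 = 0` and `log 0 = 0`, the point `η = κ` is excluded because `T
      -- + t > 0`.
      have hne : 0 < |κ - η| := by
        rcases (abs_nonneg (κ - η)).eq_or_lt with h2 | h2
        · rw [← h2] at h1
          simp at h1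
          linarith
        · exact h2
      have hA' : 0 < A := by
        rcases hA.eq_or_lt with h2 | h2
        · rw [← h2] at h1
          simp at h1
          linarith
        · exact h2
      rw [Metric.mem_closedBall, dist_comm, Real.dist_eq]
      rw [Real.le_log_iff_exp_le (by positivity), le_div_iff₀ hne] at h1
      rw [Real.exp_neg, ← div_eq_mul_inv, le_div_iff₀ (Real.exp_pos _)]
      linarith
    refine (measure_mono hsub).trans ?_
    rw [hm, withDensity_apply _ Metric.isClosed_closedBall.measurableSet]
    refine (h κ _ (by positivity)).trans (ENNReal.ofReal_le_ofReal (le_of_eq ?_))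
    rw [← mul_assoc 2 A, Real.mul_rpow (by positivity) (Real.exp_pos _).le, ← Real.exp_mul,
      mul_assoc (C * _), ← Real.exp_add, mul_assoc]
    ring_nf
  have hlint : ∫⁻ η, ENNReal.ofReal (f η * w η) ∂ν ≤
      ENNReal.ofReal (8 * (C * (2 * A) ^ (1 / 8 : ℝ)) * Real.exp (-(1 / 8) * T)) := by
    have h1 : ∫⁻ η, ENNReal.ofReal (f η * w η) ∂ν = ∫⁻ η, ENNReal.ofReal (f η) ∂m := by
      rw [hm, lintegral_withDensity_eq_lintegral_mul _ hwm.ennreal_ofReal hfm.ennreal_ofReal]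
      refine lintegral_congr fun η => ?_
      rw [ENNReal.ofReal_mul (hf0 η), mul_comm, Pi.mul_apply]
    rw [h1, lintegral_eq_lintegral_meas_le m (Eventually.of_forall hf0) hfm.aemeasurable]
    have hint : Integrable (fun t => C * (2 * A) ^ (1 / 8 : ℝ) * Real.exp (-(1 / 8) * T) *
        Real.exp (-(1 / 8) * t)) (volume.restrict (Ioi 0)) :=
      (integrableOn_exp_mul_Ioi (by norm_num) 0).const_mul _
    refine (setLIntegral_mono (by fun_prop) hexp).trans ?_
    rw [← ofReal_integral_eq_lintegral_ofReal hint
      (Eventually.of_forall fun t => by positivity), integral_const_mul,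
      integral_exp_mul_Ioi (by norm_num)]
    refine ENNReal.ofReal_le_ofReal (le_of_eq ?_)
    rw [mul_zero, Real.exp_zero]
    ring
  have hnn : 0 ≤ᵐ[ν] fun η => f η * w η := by
    filter_upwards [hu.rhoWeyl_nonneg hδ] with η hη
    exact mul_nonneg (hf0 η) hη
  constructor
  · refine ⟨(hfm.mul hwm).aestronglyMeasurable, ?_⟩
    rw [hasFiniteIntegral_iff_ofReal hnn]
    exact hlint.trans_lt ENNReal.ofReal_lt_top
  · rw [integral_eq_lintegral_of_nonneg_ae hnn (hfm.mul hwm).aestronglyMeasurable]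
    refine (ENNReal.toReal_mono ENNReal.ofReal_ne_top hlint).trans ?_
    rw [ENNReal.toReal_ofReal (by positivity)]
    gcongr
    linarith

/-! ### The external potential -/

lemma aestronglyMeasurable_potentialV (hδ : 0 < δ) (x t : ℝ) :
    AEStronglyMeasurable (fun κ => potentialV δ u₀ xm x t (quadZeta δ κ))
      (kappaMeasure δ u₀ xm) := by
  have hz := measurable_quadZeta δ
  have h1 : Measurable fun κ => x * (quadZeta δ κ).im +
      t * ((quadZeta δ κ - 1 / (2 * (δ : ℂ))) ^ 2).im :=
    ((Complex.measurable_im.comp hz).const_mul x).add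
      ((Complex.measurable_im.comp ((hz.sub_const _).pow_const 2)).const_mul t)
  have h2 : Measurable (Function.uncurry (tailIntegrand δ u₀)) := by
    have hl : Measurable fun p : ℝ × ℝ => levelFun (2 * δ * p.1) - 2 * δ * u₀ p.2 :=
      (measurable_levelFun.comp (measurable_fst.const_mul _)).sub
        ((hu.continuous.measurable.comp measurable_snd).const_mul _)
    exact measurable_fst.sub ((lambertAngle_mono.measurable.comp hl).div_const _)
  have h3 : StronglyMeasurable fun κ => ∫ y in Ioi xm, tailIntegrand δ u₀ κ y :=
    h2.stronglyMeasurable.integral_prod_right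
  refine (h1.sub ((measurable_id.mul_const xm).add h3.measurable)).aestronglyMeasurable.congr ?_
  filter_upwards [ae_kappaMeasure_mem] with κ hκ
  simp only [potentialV, Pi.sub_apply, Pi.add_apply, id]
  rw [hu.thetaPlus_quadZeta hδ ⟨hκ.1, hκ.2.le⟩]

lemma exists_potentialV_bound (hδ : 0 < δ) (x t : ℝ) : ∃ C, ∀ᵐ κ ∂(kappaMeasure δ u₀ xm),
    |potentialV δ u₀ xm x t (quadZeta δ κ)| ≤ C := by
  set k := kappaMax δ u₀ xm with hk
  set R := Real.exp (2 * δ * u₀ xm) / (2 * δ) + 1 / (2 * δ) with hR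
  set J := ∫ y, Real.sqrt (4 * δ) / (2 * δ) * Real.sqrt (u₀ y) with hJ
  refine ⟨|x| * k + |t| * (2 * R * k) + (k * |xm| + J), ?_⟩
  filter_upwards [ae_kappaMeasure_mem] with κ hκ
  have hκ' : κ ∈ Icc 0 k := ⟨hκ.1.le, hκ.2.le⟩
  have hmem := two_mul_mem hδ hκ'
  have hk0 : 0 ≤ k := hκ.1.le.trans hκ.2.le
  have hsq : ((quadZeta δ κ - 1 / (2 * (δ : ℂ))) ^ 2).im =
      2 * ((quadZeta δ κ).re - 1 / (2 * δ)) * κ := by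
    rw [show (1 : ℂ) / (2 * (δ : ℂ)) = ((1 / (2 * δ) : ℝ) : ℂ) by push_cast; rfl, sq,
      Complex.mul_im, Complex.sub_re, Complex.sub_im, Complex.ofReal_re, Complex.ofReal_im,
      quadZeta_im]
    ring
  have hre : |(quadZeta δ κ).re - 1 / (2 * δ)| ≤ R := by
    have hb : 2 * δ * κ ≠ 0 := by
      have := hκ.1
      positivity
    have h1 : (quadZeta δ κ).re = Real.cos (2 * δ * κ) / Real.sinc (2 * δ * κ) / (2 * δ) := by
      rw [← mul_cot_eq hb, quadZeta_of_ne hκ.1.ne']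
      field_simp
    have hs := sinc_pos_of_mem hmem.1 hmem.2
    have h2 : |(quadZeta δ κ).re| ≤ Real.exp (2 * δ * u₀ xm) / (2 * δ) := by
      rw [h1, abs_div, abs_div, abs_of_pos hs, abs_of_pos (by positivity : 0 < 2 * δ)]
      gcongr
      calc |Real.cos (2 * δ * κ)| / Real.sinc (2 * δ * κ) ≤ 1 / Real.sinc (2 * δ * κ) := by
            gcongr
            exact Real.abs_cos_le_one _
        _ ≤ Real.exp (levelFun (2 * δ * κ)) := by
            rw [one_div]
            exact inv_sinc_le hmem.1 hmem.2
        _ ≤ _ := Real.exp_le_exp.2 (levelFun_two_mul_le hδ (hu.pos xm).le hκ')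
    calc _ ≤ |(quadZeta δ κ).re| + |1 / (2 * δ)| := abs_sub _ _
      _ ≤ R := by
        rw [abs_of_pos (by positivity : 0 < 1 / (2 * δ))]
        linarith
  have hR0 : 0 ≤ R := (abs_nonneg _).trans hre
  have hθ : |thetaPlus δ u₀ xm (quadZeta δ κ)| ≤ k * |xm| + J := by
    rw [hu.thetaPlus_quadZeta hδ ⟨hκ.1, hκ.2.le⟩]
    refine (abs_add_le _ _).trans (add_le_add ?_ ?_)
    · rw [abs_mul, abs_of_pos hκ.1]
      exact mul_le_mul_of_nonneg_right hκ.2.le (abs_nonneg _)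
    · have hint := hu.integrable_tailIntegrand hδ hκ'
      have hb := fun y => tailIntegrand_bound hδ hκ' (hu.pos y).le
      rw [abs_of_nonneg (integral_nonneg fun y => (hb y).1)]
      refine (setIntegral_le_integral hint (Eventually.of_forall fun y => (hb y).1)).trans ?_
      exact integral_mono hint (hu.integrable_sqrt.const_mul _) fun y => (hb y).2
  rw [potentialV, hsq, quadZeta_im]
  refine (abs_sub _ _).trans (add_le_add ((abs_add_le _ _).trans (add_le_add ?_ ?_)) hθ)
  · rw [abs_mul, abs_of_pos hκ.1]
    exact mul_le_mul_of_nonneg_left hκ.2.le (abs_nonneg _)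
  · rw [abs_mul, abs_mul, abs_mul, abs_two, abs_of_pos hκ.1]
    have := hκ.1
    have := hκ.2.le
    gcongr

end IsAdmissibleInitialCondition

end ILW

namespace ILW

variable {δ : ℝ} {u₀ : ℝ → ℝ} {xm : ℝ}

/-! ### The logarithmic kernel -/

lemma logKernel_quadZeta (δ κ η : ℝ) : logKernel δ (quadZeta δ κ) η =
    1 / 2 * Real.log ((((quadZeta δ κ).re - (quadZeta δ η).re) ^ 2 + (κ + η) ^ 2) /
      (((quadZeta δ κ).re - (quadZeta δ η).re) ^ 2 + (κ - η) ^ 2)) := by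
  have h : ∀ z : ℂ, Real.log ‖z‖ = 1 / 2 * Real.log (Complex.normSq z) := by
    intro z
    rw [Complex.normSq_eq_norm_sq, Real.log_pow]
    push_cast
    ring
  rw [logKernel, h, map_div₀]
  simp only [Complex.normSq_apply, Complex.sub_re, Complex.sub_im, Complex.conj_re,
    Complex.conj_im, quadZeta_im]
  ring_nf

lemma logKernel_symm (δ κ η : ℝ) :
    logKernel δ (quadZeta δ κ) η = logKernel δ (quadZeta δ η) κ := by
  rw [logKernel_quadZeta, logKernel_quadZeta, add_comm η κ, ← neg_sub κ η, neg_sq,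
    ← neg_sub (quadZeta δ κ).re, neg_sq]

lemma measurable_logKernel (δ : ℝ) :
    Measurable (Function.uncurry fun κ η => logKernel δ (quadZeta δ κ) η) := by
  have hz := measurable_quadZeta δ
  have h1 : Measurable fun p : ℝ × ℝ => quadZeta δ p.1 := hz.comp measurable_fst
  have h2 : Measurable fun p : ℝ × ℝ => quadZeta δ p.2 := hz.comp measurable_snd
  have h3 : Measurable fun p : ℝ × ℝ => (starRingEnd ℂ) (quadZeta δ p.2) :=
    Complex.continuous_conj.measurable.comp h2
  exact Real.measurable_log.comp ((h1.sub h3).div (h1.sub h2)).norm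

lemma logKernel_nonneg {κ η : ℝ} (hκ : 0 ≤ κ) (hη : 0 ≤ η) :
    0 ≤ logKernel δ (quadZeta δ κ) η := by
  rw [logKernel_quadZeta]
  set X := ((quadZeta δ κ).re - (quadZeta δ η).re) ^ 2
  have hX : 0 ≤ X := sq_nonneg _
  have h1 : 0 ≤ X + (κ - η) ^ 2 := by positivity
  rcases h1.eq_or_lt with h0 | h0
  · rw [← h0, div_zero, Real.log_zero, mul_zero]
  · refine mul_nonneg (by norm_num) (Real.log_nonneg ?_)
    rw [one_le_div h0]
    nlinarith [mul_nonneg hκ hη]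

/-- The quotient is largest at `X = 0`. The resulting majorant of the kernel no longer involves the
real parts of `ζ`. -/
lemma half_log_le {X A B : ℝ} (hB : 0 < B) (hBA : B ≤ A) :
    1 / 2 * Real.log ((X ^ 2 + A ^ 2) / (X ^ 2 + B ^ 2)) ≤ Real.log (A / B) := by
  have hA : 0 < A := hB.trans_le hBA
  have h1 : Real.log (A / B) = 1 / 2 * Real.log ((A / B) ^ 2) := by
    rw [Real.log_pow]
    push_cast
    ring
  rw [h1]
  refine mul_le_mul_of_nonneg_left (Real.log_le_log (by positivity) ?_) (by norm_num)
  rw [div_pow, div_le_div_iff₀ (by positivity) (by positivity)]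
  nlinarith [mul_nonneg (sq_nonneg X) (sub_nonneg.2 (pow_le_pow_left₀ hB.le hBA 2))]

lemma abs_sub_le_add {κ η : ℝ} (hκ : 0 ≤ κ) (hη : 0 ≤ η) : |κ - η| ≤ κ + η := by
  rw [abs_le]
  constructor <;> linarith

lemma logKernel_le {κ η : ℝ} (hκ : 0 ≤ κ) (hη : 0 ≤ η) :
    logKernel δ (quadZeta δ κ) η ≤ Real.log ((κ + η) / |κ - η|) := by
  rcases eq_or_ne κ η with rfl | hne
  · simp [logKernel_quadZeta]
  · rw [logKernel_quadZeta, ← sq_abs (κ - η)]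
    exact half_log_le (abs_pos.2 (sub_ne_zero.2 hne)) (abs_sub_le_add hκ hη)

lemma log_add_div_le {κ η k : ℝ} (hκ : κ ∈ Icc 0 k) (hη : η ∈ Icc 0 k) :
    Real.log ((κ + η) / |κ - η|) ≤ Real.log (2 * k / |κ - η|) := by
  rcases eq_or_ne κ η with rfl | hne
  · simp
  · have h1 := abs_pos.2 (sub_ne_zero.2 hne)
    have h2 := h1.trans_le (abs_sub_le_add hκ.1 hη.1)
    refine Real.log_le_log (by positivity) ?_
    gcongr
    linarith [hκ.2, hη.2]

/-! ### A Gram representation of the kernel -/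

/-- Feature functions of the Green function of the upper half-plane: for `p = (τ, k)`, the
exponential `exp (k (i ζ(η) + τ))` on `η > τ`. -/
noncomputable def gramFun (δ : ℝ) (p : ℝ × ℝ) (η : ℝ) : ℂ :=
  if p.1 < η then Complex.exp (p.2 * (Complex.I * quadZeta δ η + p.1)) else 0

/-- The parameter space of the feature functions, the quadrant `τ, k > 0`. -/
noncomputable def gramMeasure : Measure (ℝ × ℝ) :=
  (volume.restrict (Ioi 0)).prod (volume.restrict (Ioi 0))

instance : SFinite gramMeasure := by
  unfold gramMeasure
  infer_instance

lemma measurable_gramFun (δ : ℝ) :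
    Measurable (Function.uncurry fun (p : ℝ × ℝ) η => gramFun δ p η) := by
  unfold gramFun Function.uncurry
  refine Measurable.ite (measurableSet_lt (measurable_fst.comp measurable_fst) measurable_snd)
    ?_ measurable_const
  have h1 : Measurable fun q : (ℝ × ℝ) × ℝ => quadZeta δ q.2 :=
    (measurable_quadZeta δ).comp measurable_snd
  have h2 : Measurable fun q : (ℝ × ℝ) × ℝ => (q.1.1 : ℂ) :=
    Complex.measurable_ofReal.comp (measurable_fst.comp measurable_fst)
  have h3 : Measurable fun q : (ℝ × ℝ) × ℝ => (q.1.2 : ℂ) :=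
    Complex.measurable_ofReal.comp (measurable_snd.comp measurable_fst)
  exact Complex.measurable_exp.comp (h3.mul ((h1.const_mul _).add h2))

lemma gramFun_mul_conj (δ : ℝ) (p : ℝ × ℝ) (κ η : ℝ) :
    gramFun δ p κ * (starRingEnd ℂ) (gramFun δ p η) =
      if p.1 < min κ η then Complex.exp (⟨-(κ + η - 2 * p.1),
        (quadZeta δ κ).re - (quadZeta δ η).re⟩ * p.2) else 0 := by
  by_cases h1 : p.1 < κ
  · by_cases h2 : p.1 < η
    · rw [if_pos (lt_min h1 h2), gramFun, gramFun, if_pos h1, if_pos h2, ← Complex.exp_conj,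
        ← Complex.exp_add]
      congr 1
      apply Complex.ext <;> simp [quadZeta_im] <;> ring
    · rw [if_neg (by simp [h2]), gramFun, gramFun, if_neg h2, map_zero, mul_zero]
  · rw [if_neg (by simp [h1]), gramFun, if_neg h1, zero_mul]

lemma integral_deriv_log {X A B : ℝ} (hB : 0 < B) (hBA : B ≤ A) :
    ∫ τ in (0 : ℝ)..((A - B) / 2), 2 * (A - 2 * τ) / (X ^ 2 + (A - 2 * τ) ^ 2) =
      1 / 2 * Real.log ((X ^ 2 + A ^ 2) / (X ^ 2 + B ^ 2)) := by
  have hA : 0 < A := hB.trans_le hBA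
  have hm : 0 ≤ (A - B) / 2 := by linarith
  have hpos : ∀ τ ∈ uIcc 0 ((A - B) / 2), 0 < X ^ 2 + (A - 2 * τ) ^ 2 := by
    intro τ hτ
    rw [uIcc_of_le hm] at hτ
    have : 0 < A - 2 * τ := by linarith [hτ.2]
    positivity
  have hd : ∀ τ ∈ uIcc 0 ((A - B) / 2), HasDerivAt
      (fun τ => -(1 / 2) * Real.log (X ^ 2 + (A - 2 * τ) ^ 2))
      (2 * (A - 2 * τ) / (X ^ 2 + (A - 2 * τ) ^ 2)) τ := by
    intro τ hτ
    have h1 : HasDerivAt (fun τ : ℝ => X ^ 2 + (A - 2 * τ) ^ 2) (-4 * (A - 2 * τ)) τ := by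
      refine (((((hasDerivAt_id τ).const_mul 2).const_sub A).pow 2).const_add (X ^ 2)).congr_deriv ?_
      simp only [id]
      ring
    refine ((h1.log (hpos τ hτ).ne').const_mul _).congr_deriv ?_
    ring
  rw [intervalIntegral.integral_eq_sub_of_hasDerivAt hd]
  · rw [show A - 2 * ((A - B) / 2) = B by ring, mul_zero, sub_zero,
      Real.log_div (by positivity) (by positivity)]
    ring
  · refine ContinuousOn.intervalIntegrable ?_
    refine ContinuousOn.div (by fun_prop) (by fun_prop) fun τ hτ => (hpos τ hτ).ne'

lemma min_eq_half (κ η : ℝ) : min κ η = (κ + η - |κ - η|) / 2 := by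
  rcases le_total κ η with h | h
  · rw [min_eq_left h, abs_of_nonpos (sub_nonpos.2 h)]
    ring
  · rw [min_eq_right h, abs_of_nonneg (sub_nonneg.2 h)]
    ring

/-- Integration over the frequency. -/
lemma integral_gramFun_inner (δ : ℝ) {κ η τ : ℝ} (hτ : τ < min κ η) :
    Integrable (fun k => 2 * (gramFun δ (τ, k) κ * (starRingEnd ℂ) (gramFun δ (τ, k) η)))
      (volume.restrict (Ioi 0)) ∧
    (∫ k in Ioi 0, 2 * (gramFun δ (τ, k) κ * (starRingEnd ℂ) (gramFun δ (τ, k) η))).re =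
      2 * (κ + η - 2 * τ) /
        (((quadZeta δ κ).re - (quadZeta δ η).re) ^ 2 + (κ + η - 2 * τ) ^ 2) ∧
    ∫ k in Ioi 0, ‖2 * (gramFun δ (τ, k) κ * (starRingEnd ℂ) (gramFun δ (τ, k) η))‖ =
      2 * (κ + η - 2 * τ) / (0 ^ 2 + (κ + η - 2 * τ) ^ 2) := by
  have hc : 0 < κ + η - 2 * τ := by
    have := lt_min_iff.1 hτ
    linarith
  simp only [gramFun_mul_conj, if_pos hτ]
  set a : ℂ := ⟨-(κ + η - 2 * τ), (quadZeta δ κ).re - (quadZeta δ η).re⟩ with ha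
  have hare : a.re < 0 := by simpa [ha] using hc
  refine ⟨(integrableOn_exp_mul_complex_Ioi hare 0).const_mul 2, ?_, ?_⟩
  · rw [integral_const_mul, integral_exp_mul_complex_Ioi hare, Complex.ofReal_zero, mul_zero,
      Complex.exp_zero, show (2 : ℂ) = ((2 : ℝ) : ℂ) by norm_num, Complex.re_ofReal_mul,
      Complex.div_re, Complex.normSq_apply, ha]
    simp
    ring
  · have : ∀ k : ℝ, ‖2 * Complex.exp (a * k)‖ = 2 * Real.exp (a.re * k) := by
      intro k
      rw [norm_mul, Complex.norm_exp, Complex.re_mul_ofReal]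
      simp
    simp_rw [this]
    rw [integral_const_mul, integral_exp_mul_Ioi hare, mul_zero, Real.exp_zero,
      show a.re = -(κ + η - 2 * τ) from rfl, neg_div_neg_eq]
    field_simp
    ring

lemma gramFun_mul_conj_eq_zero (δ : ℝ) {κ η τ : ℝ} (hτ : min κ η ≤ τ) (k : ℝ) :
    2 * (gramFun δ (τ, k) κ * (starRingEnd ℂ) (gramFun δ (τ, k) η)) = 0 := by
  rw [gramFun_mul_conj, if_neg (not_lt.2 hτ), mul_zero]

/-- Gram representation of the kernel off the diagonal. -/
lemma integral_gramFun (δ : ℝ) {κ η : ℝ} (hκ : 0 < κ) (hη : 0 < η) (hne : κ ≠ η) :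
    Integrable (fun p => 2 * (gramFun δ p κ * (starRingEnd ℂ) (gramFun δ p η))) gramMeasure ∧
    (∫ p, 2 * (gramFun δ p κ * (starRingEnd ℂ) (gramFun δ p η)) ∂gramMeasure).re =
      logKernel δ (quadZeta δ κ) η ∧
    ∫ p, ‖2 * (gramFun δ p κ * (starRingEnd ℂ) (gramFun δ p η))‖ ∂gramMeasure =
      Real.log ((κ + η) / |κ - η|) := by
  have hB : 0 < |κ - η| := abs_pos.2 (sub_ne_zero.2 hne)
  have hBA := abs_sub_le_add hκ.le hη.le
  have hm : 0 ≤ min κ η := le_min hκ.le hη.le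
  have hmeas : Measurable fun p => 2 * (gramFun δ p κ * (starRingEnd ℂ) (gramFun δ p η)) := by
    have h1 : ∀ x, Measurable fun p => gramFun δ p x := fun x =>
      (measurable_gramFun δ).comp (measurable_id.prodMk measurable_const)
    exact ((h1 κ).mul (Complex.continuous_conj.measurable.comp (h1 η))).const_mul 2
  -- integrals over the first variable of functions supported on `(0, min κ η)`
  have outer : ∀ X : ℝ, ∀ g : ℝ → ℝ, (∀ τ < min κ η, g τ =
      2 * (κ + η - 2 * τ) / (X ^ 2 + (κ + η - 2 * τ) ^ 2)) → (∀ τ, min κ η ≤ τ → g τ = 0) →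
      Integrable g (volume.restrict (Ioi 0)) ∧ ∫ τ in Ioi 0, g τ =
        1 / 2 * Real.log ((X ^ 2 + (κ + η) ^ 2) / (X ^ 2 + |κ - η| ^ 2)) := by
    intro X g hg1 hg2
    have hcont : ContinuousOn (fun τ : ℝ => 2 * (κ + η - 2 * τ) / (X ^ 2 + (κ + η - 2 * τ) ^ 2))
        (Icc 0 (min κ η)) := by
      refine ContinuousOn.div (by fun_prop) (by fun_prop) fun τ hτ => ?_
      have h2 := hτ.2
      rw [min_eq_half] at h2
      have : 0 < κ + η - 2 * τ := by linarith
      positivity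
    have hioo : IntegrableOn g (Ioo 0 (min κ η)) :=
      (hcont.integrableOn_Icc.mono_set Ioo_subset_Icc_self).congr_fun
        (fun τ hτ => (hg1 τ hτ.2).symm) measurableSet_Ioo
    have hzero : ∀ τ ∈ Ioi 0 \ Ioo 0 (min κ η), g τ = 0 := fun τ hτ =>
      hg2 τ (not_lt.1 fun h => hτ.2 ⟨hτ.1, h⟩)
    refine ⟨hioo.of_forall_sdiff_eq_zero measurableSet_Ioi hzero, ?_⟩
    rw [setIntegral_eq_of_subset_of_forall_sdiff_eq_zero measurableSet_Ioi Ioo_subset_Ioi_self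
      hzero, setIntegral_congr_fun measurableSet_Ioo (fun τ hτ => hg1 τ hτ.2),
      ← integral_Ioc_eq_integral_Ioo, ← intervalIntegral.integral_of_le hm, min_eq_half,
      integral_deriv_log hB hBA]
  -- Taking norms removes the phase, so the absolute integral is the case `X = 0`; this is why the
  -- logarithmic majorant of the kernel appears.
  have hnorm := outer 0 (fun τ => ∫ k in Ioi 0,
      ‖2 * (gramFun δ (τ, k) κ * (starRingEnd ℂ) (gramFun δ (τ, k) η))‖)
    (fun τ hτ => (integral_gramFun_inner δ hτ).2.2)
    (fun τ hτ => by simp only [gramFun_mul_conj_eq_zero δ hτ, norm_zero, integral_zero])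
  have hint : Integrable (fun p => 2 * (gramFun δ p κ * (starRingEnd ℂ) (gramFun δ p η)))
      gramMeasure := by
    rw [gramMeasure, integrable_prod_iff hmeas.aestronglyMeasurable]
    refine ⟨Eventually.of_forall fun τ => ?_, hnorm.1⟩
    rcases lt_or_ge τ (min κ η) with hτ | hτ
    · exact (integral_gramFun_inner δ hτ).1
    · simp only [gramFun_mul_conj_eq_zero δ hτ]
      exact integrable_zero _ _ _
  refine ⟨hint, ?_, ?_⟩
  · have hre := outer ((quadZeta δ κ).re - (quadZeta δ η).re) (fun τ => (∫ k in Ioi 0,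
        2 * (gramFun δ (τ, k) κ * (starRingEnd ℂ) (gramFun δ (τ, k) η))).re)
      (fun τ hτ => (integral_gramFun_inner δ hτ).2.1)
      (fun τ hτ => by
        simp only [gramFun_mul_conj_eq_zero δ hτ, integral_zero, Complex.zero_re])
    rw [logKernel_quadZeta, ← sq_abs (κ - η), ← hre.2, gramMeasure, integral_prod _ hint]
    exact (integral_re hint.integral_prod_left).symm
  · rw [gramMeasure, integral_prod _ hint.norm, hnorm.2]
    have : (0 ^ 2 + (κ + η) ^ 2) / (0 ^ 2 + |κ - η| ^ 2) = ((κ + η) / |κ - η|) ^ 2 := by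
      rw [div_pow]
      norm_num
    rw [this, Real.log_pow]
    push_cast
    ring

end ILW

namespace ILW

variable {δ : ℝ} {u₀ : ℝ → ℝ} {xm : ℝ}

/-! ### Functions determined by their integrals over half-lines -/

/-- Half-lines form a π-system generating the Borel sets. Complements require the total integral to
vanish, which follows by exhausting the line with `(-n, ∞)`. -/
lemma ae_eq_zero_of_forall_setIntegral_Ioi_eq_zero {μ : Measure ℝ} {g : ℝ → ℂ}
    (hg : Integrable g μ) (h : ∀ τ, ∫ η in Ioi τ, g η ∂μ = 0) : g =ᵐ[μ] 0 := by
  have htot : ∫ η, g η ∂μ = 0 := by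
    have hmono : Monotone fun n : ℕ => Ioi (-(n : ℝ)) := fun a b hab =>
      Ioi_subset_Ioi (neg_le_neg (Nat.cast_le.2 hab))
    have hU : ⋃ n : ℕ, Ioi (-(n : ℝ)) = univ := by
      refine eq_univ_of_forall fun x => mem_iUnion.2 ?_
      obtain ⟨n, hn⟩ := exists_nat_gt (-x)
      exact ⟨n, by rw [mem_Ioi]; linarith⟩
    have := tendsto_setIntegral_of_monotone (μ := μ) (f := g) (fun n => measurableSet_Ioi) hmono
      hg.integrableOn
    simp only [h, hU, setIntegral_univ] at this
    exact (tendsto_nhds_unique this tendsto_const_nhds)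
  refine hg.ae_eq_zero_of_forall_setIntegral_eq_zero fun s hs _ => ?_
  refine MeasurableSpace.induction_on_inter (C := fun s _ => ∫ η in s, g η ∂μ = 0)
    ((BorelSpace.measurable_eq (α := ℝ)).trans (borel_eq_generateFrom_Ioi ℝ)) isPiSystem_Ioi
    (by simp) ?_ ?_ ?_ s hs
  · rintro _ ⟨τ, rfl⟩
    exact h τ
  · intro t ht h0
    rw [setIntegral_compl ht hg, h0, htot, sub_zero]
  · intro f hd hm h0
    have := hasSum_integral_iUnion hm hd hg.integrableOn
    simp only [h0] at this
    exact this.unique hasSum_zero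

/-- Tail integrals over open half-lines are right continuous in the endpoint, and a set of full
measure accumulates at every point from the right. -/
lemma setIntegral_Ioi_eq_zero_of_ae {μ : Measure ℝ} {g : ℝ → ℂ} (hg : Integrable g μ) (s₀ : ℝ)
    (h : ∀ᵐ τ ∂(volume.restrict (Ioi s₀)), ∫ η in Ioi τ, g η ∂μ = 0) {s : ℝ} (hs : s₀ ≤ s) :
    ∫ η in Ioi s, g η ∂μ = 0 := by
  have hlim : Tendsto (fun t => ∫ η, (Ioi t).indicator g η ∂μ) (𝓝[>] s)
      (𝓝 (∫ η, (Ioi s).indicator g η ∂μ)) := by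
    refine tendsto_integral_filter_of_dominated_convergence (fun η => ‖g η‖) ?_ ?_ hg.norm ?_
    · exact Eventually.of_forall fun t => hg.aestronglyMeasurable.indicator measurableSet_Ioi
    · exact Eventually.of_forall fun t => Eventually.of_forall fun η =>
        norm_indicator_le_norm_self _ _
    · refine Eventually.of_forall fun η => ?_
      rcases lt_or_ge s η with hη | hη
      · refine tendsto_const_nhds.congr' ?_
        filter_upwards [Ioo_mem_nhdsGT hη] with t ht
        rw [indicator_of_mem (mem_Ioi.2 hη), indicator_of_mem (mem_Ioi.2 ht.2)]
      · refine tendsto_const_nhds.congr' ?_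
        filter_upwards [self_mem_nhdsWithin] with t ht
        rw [indicator_of_notMem (notMem_Ioi.2 hη),
          indicator_of_notMem (notMem_Ioi.2 (hη.trans (mem_Ioi.1 ht).le))]
  simp only [integral_indicator measurableSet_Ioi] at hlim
  refine tendsto_nhds_unique_of_frequently_eq hlim tendsto_const_nhds (frequently_iff.2 ?_)
  intro U hU
  obtain ⟨u, hu, hsub⟩ := (mem_nhdsGT_iff_exists_Ioo_subset).1 hU
  have hne : (ae (volume.restrict (Ioo s u))).NeBot := by
    rw [ae_neBot, Ne, Measure.restrict_eq_zero, Real.volume_Ioo, ENNReal.ofReal_eq_zero, not_le]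
    exact sub_pos.2 hu
  have h2 := ae_restrict_of_ae_restrict_of_subset
    (Ioo_subset_Ioi_self.trans (Ioi_subset_Ioi hs) : Ioo s u ⊆ Ioi s₀) h
  obtain ⟨t, ht, ht'⟩ := (h2.and (ae_restrict_mem measurableSet_Ioo)).exists
  exact ⟨t, hsub ht', ht⟩

/-! ### Potentials of densities dominated by the Weyl density -/

/-- Measurable densities `f` with `|f| ≤ ρ^Wyl` almost everywhere. -/
def IsWeylDominated (δ : ℝ) (u₀ : ℝ → ℝ) (xm : ℝ) (f : ℝ → ℝ) : Prop :=
  AEMeasurable f (kappaMeasure δ u₀ xm) ∧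
    ∀ᵐ κ ∂(kappaMeasure δ u₀ xm), |f κ| ≤ rhoWeyl δ u₀ xm κ

/-- The potential of `f` on the quadratrix, without the factor `1/π`. -/
noncomputable def kernelPotential (δ : ℝ) (u₀ : ℝ → ℝ) (xm : ℝ) (f : ℝ → ℝ) (κ : ℝ) : ℝ :=
  ∫ η, logKernel δ (quadZeta δ κ) η * f η ∂(kappaMeasure δ u₀ xm)

lemma aestronglyMeasurable_kernelPotential {f : ℝ → ℝ}
    (hf : AEMeasurable f (kappaMeasure δ u₀ xm)) :
    AEStronglyMeasurable (kernelPotential δ u₀ xm f) (kappaMeasure δ u₀ xm) := by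
  have h : AEStronglyMeasurable (fun p : ℝ × ℝ => logKernel δ (quadZeta δ p.1) p.2 * f p.2)
      ((kappaMeasure δ u₀ xm).prod (kappaMeasure δ u₀ xm)) :=
    (measurable_logKernel δ).aestronglyMeasurable.mul hf.aestronglyMeasurable.comp_snd
  exact h.integral_prod_right'

lemma ae_prod_kappaMeasure :
    ∀ᵐ x ∂((kappaMeasure δ u₀ xm).prod (kappaMeasure δ u₀ xm)),
      x.1 ∈ Ioo 0 (kappaMax δ u₀ xm) ∧ x.2 ∈ Ioo 0 (kappaMax δ u₀ xm) ∧ x.1 ≠ x.2 := by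
  have hm : MeasurableSet {x : ℝ × ℝ | x.1 ∈ Ioo 0 (kappaMax δ u₀ xm) ∧
      x.2 ∈ Ioo 0 (kappaMax δ u₀ xm) ∧ x.1 ≠ x.2} :=
    (measurable_fst measurableSet_Ioo).inter ((measurable_snd measurableSet_Ioo).inter
      (measurableSet_eq_fun measurable_fst measurable_snd).compl)
  rw [Measure.ae_prod_iff_ae_ae hm]
  filter_upwards [ae_kappaMeasure_mem] with κ hκ
  filter_upwards [ae_kappaMeasure_mem, (Measure.ae_ne (kappaMeasure δ u₀ xm) κ)] with η hη hne
  exact ⟨hκ, hη, hne.symm⟩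

namespace IsAdmissibleInitialCondition

variable (hu : IsAdmissibleInitialCondition u₀ xm)
include hu

omit hu in
lemma ae_kernel_bounds {κ : ℝ} (hκ : κ ∈ Icc 0 (kappaMax δ u₀ xm)) :
    ∀ᵐ η ∂(kappaMeasure δ u₀ xm), 0 ≤ logKernel δ (quadZeta δ κ) η ∧
      logKernel δ (quadZeta δ κ) η ≤ Real.log ((κ + η) / |κ - η|) ∧
      Real.log ((κ + η) / |κ - η|) ≤ Real.log (2 * kappaMax δ u₀ xm / |κ - η|) := by
  filter_upwards [ae_kappaMeasure_mem] with η hη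
  exact ⟨logKernel_nonneg hκ.1 hη.1.le, logKernel_le hκ.1 hη.1.le,
    log_add_div_le hκ ⟨hη.1.le, hη.2.le⟩⟩

omit hu in
lemma measurable_logMajorant (κ : ℝ) : Measurable fun η => Real.log ((κ + η) / |κ - η|) :=
  Real.measurable_log.comp ((measurable_const.add measurable_id).div
    (continuous_const.sub continuous_id).abs.measurable)

/-- The majorant of the kernel has a bounded potential. -/
lemma exists_logMajorant_bound (hδ : 0 < δ) : ∃ C > 0, ∀ κ ∈ Icc 0 (kappaMax δ u₀ xm),
    ∀ f, IsWeylDominated δ u₀ xm f →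
      Integrable (fun η => Real.log ((κ + η) / |κ - η|) * |f η|) (kappaMeasure δ u₀ xm) ∧
      ∫ η, Real.log ((κ + η) / |κ - η|) * |f η| ∂(kappaMeasure δ u₀ xm) ≤ C := by
  obtain ⟨C, hC, h⟩ := hu.exists_log_tail hδ (2 * kappaMax δ u₀ xm)
    (mul_nonneg (by norm_num) (kappaMax_nonneg hδ u₀ xm))
  refine ⟨C, hC, fun κ hκ f hf => ?_⟩
  obtain ⟨h1, h2⟩ := h 0 le_rfl κ
  have hle : ∀ᵐ η ∂(kappaMeasure δ u₀ xm), 0 ≤ Real.log ((κ + η) / |κ - η|) * |f η| ∧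
      Real.log ((κ + η) / |κ - η|) * |f η| ≤
      max (Real.log (2 * kappaMax δ u₀ xm / |κ - η|) - 0) 0 * rhoWeyl δ u₀ xm η := by
    filter_upwards [ae_kernel_bounds hκ, hf.2] with η hη hfη
    have h0 := hη.1.trans hη.2.1
    refine ⟨mul_nonneg h0 (abs_nonneg _), mul_le_mul ?_ hfη (abs_nonneg _) (le_max_right _ _)⟩
    rw [sub_zero]
    exact hη.2.2.trans (le_max_left _ _)
  have hint : Integrable (fun η => Real.log ((κ + η) / |κ - η|) * |f η|)
      (kappaMeasure δ u₀ xm) := by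
    have hm : AEStronglyMeasurable (fun η => Real.log ((κ + η) / |κ - η|) * |f η|)
        (kappaMeasure δ u₀ xm) :=
      (measurable_logMajorant κ).aestronglyMeasurable.mul hf.1.aestronglyMeasurable.norm
    refine h1.mono' hm ?_
    filter_upwards [hle] with η hη
    rw [Real.norm_of_nonneg hη.1]
    exact hη.2
  rw [mul_zero, Real.exp_zero, mul_one] at h2
  have h3 := integral_mono_ae hint h1 (hle.mono fun η hη => hη.2)
  exact ⟨hint, h3.trans h2⟩

lemma integrable_kernel_mul (hδ : 0 < δ) {f : ℝ → ℝ} (hf : IsWeylDominated δ u₀ xm f) {κ : ℝ}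
    (hκ : κ ∈ Icc 0 (kappaMax δ u₀ xm)) :
    Integrable (fun η => logKernel δ (quadZeta δ κ) η * f η) (kappaMeasure δ u₀ xm) := by
  obtain ⟨C, -, h⟩ := hu.exists_logMajorant_bound hδ
  have hm : Measurable fun η => logKernel δ (quadZeta δ κ) η :=
    (measurable_logKernel δ).of_uncurry_left
  have hm' : AEStronglyMeasurable (fun η => logKernel δ (quadZeta δ κ) η * f η)
      (kappaMeasure δ u₀ xm) := hm.aestronglyMeasurable.mul hf.1.aestronglyMeasurable
  have hle : ∀ᵐ η ∂(kappaMeasure δ u₀ xm), ‖logKernel δ (quadZeta δ κ) η * f η‖ ≤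
      Real.log ((κ + η) / |κ - η|) * |f η| := by
    filter_upwards [ae_kernel_bounds (δ := δ) hκ] with η hη
    rw [norm_mul, Real.norm_of_nonneg hη.1]
    exact mul_le_mul_of_nonneg_right hη.2.1 (abs_nonneg _)
  exact (h κ hκ f hf).1.mono' hm' hle

lemma integrable_of_dominated (hδ : 0 < δ) {f : ℝ → ℝ} (hf : IsWeylDominated δ u₀ xm f) :
    Integrable f (kappaMeasure δ u₀ xm) :=
  (hu.integrable_rhoWeyl hδ).mono' hf.1.aestronglyMeasurable hf.2

/-- Potentials are bounded, and small if the `L¹` norm is small. -/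
lemma exists_kernelPotential_bound (hδ : 0 < δ) : ∃ C > 0, ∀ f, IsWeylDominated δ u₀ xm f →
    ∀ T, 0 ≤ T → ∀ κ ∈ Icc 0 (kappaMax δ u₀ xm), |kernelPotential δ u₀ xm f κ| ≤
      T * (∫ η, |f η| ∂(kappaMeasure δ u₀ xm)) + C * Real.exp (-(1 / 8) * T) := by
  obtain ⟨C, hC, h⟩ := hu.exists_log_tail hδ (2 * kappaMax δ u₀ xm)
    (mul_nonneg (by norm_num) (kappaMax_nonneg hδ u₀ xm))
  refine ⟨C, hC, fun f hf T hT κ hκ => ?_⟩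
  obtain ⟨h1, h2⟩ := h T hT κ
  have hfi := (hu.integrable_of_dominated hδ hf).abs
  have hle : ∀ᵐ η ∂(kappaMeasure δ u₀ xm), ‖logKernel δ (quadZeta δ κ) η * f η‖ ≤
      T * |f η| + max (Real.log (2 * kappaMax δ u₀ xm / |κ - η|) - T) 0 * rhoWeyl δ u₀ xm η := by
    filter_upwards [ae_kernel_bounds hκ, hf.2] with η hη hfη
    rw [norm_mul, Real.norm_of_nonneg hη.1, Real.norm_eq_abs]
    -- The part of the kernel below height `T` is paired with `|f|`, giving the `L¹` norm; the
    -- excess is paired with `ρ^Wyl`, giving the exponential tail.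
    have h3 : logKernel δ (quadZeta δ κ) η ≤
        T + max (Real.log (2 * kappaMax δ u₀ xm / |κ - η|) - T) 0 := by
      have := le_max_left (Real.log (2 * kappaMax δ u₀ xm / |κ - η|) - T) 0
      linarith [hη.2.1, hη.2.2]
    calc _ ≤ (T + max (Real.log (2 * kappaMax δ u₀ xm / |κ - η|) - T) 0) * |f η| :=
          mul_le_mul_of_nonneg_right h3 (abs_nonneg _)
      _ ≤ _ := by
        rw [add_mul]
        gcongr
  refine (norm_integral_le_of_norm_le ((hfi.const_mul T).add h1) hle).trans ?_
  rw [integral_add' (hfi.const_mul T) h1, integral_const_mul]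
  exact add_le_add_right h2 _

lemma exists_kernelPotential_le (hδ : 0 < δ) : ∃ C > 0, ∀ f, IsWeylDominated δ u₀ xm f →
    ∀ κ ∈ Icc 0 (kappaMax δ u₀ xm), |kernelPotential δ u₀ xm f κ| ≤ C := by
  obtain ⟨C, hC, h⟩ := hu.exists_kernelPotential_bound hδ
  refine ⟨C, hC, fun f hf κ hκ => ?_⟩
  simpa using h f hf 0 le_rfl κ hκ

/-! ### The interaction energy -/

/-- Integrability is proved for the majorant rather than the kernel because Fubini in the Gram
representation needs the integral of the norms, which equals this majorant. -/
lemma integrable_prod_logMajorant (hδ : 0 < δ) {f g : ℝ → ℝ} (hf : IsWeylDominated δ u₀ xm f)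
    (hg : IsWeylDominated δ u₀ xm g) :
    Integrable (fun x : ℝ × ℝ => Real.log ((x.1 + x.2) / |x.1 - x.2|) * |f x.2| * |g x.1|)
      ((kappaMeasure δ u₀ xm).prod (kappaMeasure δ u₀ xm)) := by
  obtain ⟨C, hC, h⟩ := hu.exists_logMajorant_bound hδ
  have hm : Measurable fun x : ℝ × ℝ => Real.log ((x.1 + x.2) / |x.1 - x.2|) :=
    Real.measurable_log.comp ((measurable_fst.add measurable_snd).div
      (continuous_fst.sub continuous_snd).abs.measurable)
  have hmeas : AEStronglyMeasurable
      (fun x : ℝ × ℝ => Real.log ((x.1 + x.2) / |x.1 - x.2|) * |f x.2| * |g x.1|)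
      ((kappaMeasure δ u₀ xm).prod (kappaMeasure δ u₀ xm)) :=
    (hm.aestronglyMeasurable.mul hf.1.aestronglyMeasurable.comp_snd.norm).mul
      hg.1.aestronglyMeasurable.comp_fst.norm
  rw [integrable_prod_iff hmeas]
  constructor
  · filter_upwards [ae_kappaMeasure_mem] with κ hκ
    exact (h κ ⟨hκ.1.le, hκ.2.le⟩ f hf).1.mul_const _
  · refine ((hu.integrable_of_dominated hδ hg).abs.const_mul C).mono'
      hmeas.norm.integral_prod_right' ?_
    filter_upwards [ae_kappaMeasure_mem] with κ hκ
    have hκ' : κ ∈ Icc 0 (kappaMax δ u₀ xm) := ⟨hκ.1.le, hκ.2.le⟩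
    rw [Real.norm_of_nonneg (integral_nonneg fun _ => norm_nonneg _)]
    have : ∀ᵐ η ∂(kappaMeasure δ u₀ xm),
        ‖Real.log ((κ + η) / |κ - η|) * |f η| * |g κ|‖ =
          Real.log ((κ + η) / |κ - η|) * |f η| * |g κ| := by
      filter_upwards [ae_kernel_bounds hκ'] with η hη
      exact Real.norm_of_nonneg
        (mul_nonneg (mul_nonneg (hη.1.trans hη.2.1) (abs_nonneg _)) (abs_nonneg _))
    rw [integral_congr_ae this, integral_mul_const]
    exact mul_le_mul_of_nonneg_right (h κ hκ' f hf).2 (abs_nonneg _)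

lemma integrable_prod_kernel (hδ : 0 < δ) {f g : ℝ → ℝ} (hf : IsWeylDominated δ u₀ xm f)
    (hg : IsWeylDominated δ u₀ xm g) :
    Integrable (fun x : ℝ × ℝ => logKernel δ (quadZeta δ x.1) x.2 * f x.2 * g x.1)
      ((kappaMeasure δ u₀ xm).prod (kappaMeasure δ u₀ xm)) := by
  refine (hu.integrable_prod_logMajorant hδ hf hg).mono'
    (((measurable_logKernel δ).aestronglyMeasurable.mul hf.1.aestronglyMeasurable.comp_snd).mul
      hg.1.aestronglyMeasurable.comp_fst) ?_
  filter_upwards [ae_prod_kappaMeasure] with x hx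
  rw [norm_mul, norm_mul, Real.norm_of_nonneg (logKernel_nonneg hx.1.1.le hx.2.1.1.le)]
  exact mul_le_mul_of_nonneg_right (mul_le_mul_of_nonneg_right
    (logKernel_le hx.1.1.le hx.2.1.1.le) (abs_nonneg _)) (abs_nonneg _)

lemma integral_kernelPotential_mul_symm (hδ : 0 < δ) {f g : ℝ → ℝ}
    (hf : IsWeylDominated δ u₀ xm f) (hg : IsWeylDominated δ u₀ xm g) :
    ∫ κ, kernelPotential δ u₀ xm f κ * g κ ∂(kappaMeasure δ u₀ xm) =
      ∫ κ, kernelPotential δ u₀ xm g κ * f κ ∂(kappaMeasure δ u₀ xm) := by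
  simp only [kernelPotential, ← integral_mul_const]
  rw [integral_integral_swap (f := fun κ η => logKernel δ (quadZeta δ κ) η * f η * g κ)
    (hu.integrable_prod_kernel hδ hf hg)]
  refine integral_congr_ae (Eventually.of_forall fun κ => integral_congr_ae
    (Eventually.of_forall fun η => ?_))
  simp only
  rw [logKernel_symm]
  ring

/-- Gram representation of the interaction energy. -/
lemma integral_kernelPotential_mul_self (hδ : 0 < δ) {f : ℝ → ℝ}
    (hf : IsWeylDominated δ u₀ xm f) :
    Integrable (fun p => 2 * Complex.normSq
      (∫ η, (f η : ℂ) * gramFun δ p η ∂(kappaMeasure δ u₀ xm))) gramMeasure ∧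
    ∫ κ, kernelPotential δ u₀ xm f κ * f κ ∂(kappaMeasure δ u₀ xm) =
      ∫ p, 2 * Complex.normSq (∫ η, (f η : ℂ) * gramFun δ p η ∂(kappaMeasure δ u₀ xm))
        ∂gramMeasure := by
  set ν := kappaMeasure δ u₀ xm
  set F : ℝ × ℝ → ℝ × ℝ → ℂ := fun x p =>
    ((f x.2 * f x.1 : ℝ) : ℂ) * (2 * (gramFun δ p x.1 * (starRingEnd ℂ) (gramFun δ p x.2))) with hF
  have hFm : AEStronglyMeasurable (Function.uncurry F) ((ν.prod ν).prod gramMeasure) := by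
    have h1 : AEStronglyMeasurable (fun x : ℝ × ℝ => ((f x.2 * f x.1 : ℝ) : ℂ)) (ν.prod ν) :=
      Complex.continuous_ofReal.comp_aestronglyMeasurable
        (hf.1.aestronglyMeasurable.comp_snd.mul hf.1.aestronglyMeasurable.comp_fst)
    have h2 : Measurable fun q : (ℝ × ℝ) × (ℝ × ℝ) => gramFun δ q.2 q.1.1 :=
      (measurable_gramFun δ).comp (measurable_snd.prodMk (measurable_fst.comp measurable_fst))
    have h3 : Measurable fun q : (ℝ × ℝ) × (ℝ × ℝ) => gramFun δ q.2 q.1.2 :=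
      (measurable_gramFun δ).comp (measurable_snd.prodMk (measurable_snd.comp measurable_fst))
    exact h1.comp_fst.mul ((h2.mul
      (Complex.continuous_conj.measurable.comp h3)).const_mul 2).aestronglyMeasurable
  have hFi : Integrable (Function.uncurry F) ((ν.prod ν).prod gramMeasure) := by
    rw [integrable_prod_iff hFm]
    constructor
    · filter_upwards [ae_prod_kappaMeasure] with x hx
      simp only [Function.uncurry, hF]
      exact (integral_gramFun δ hx.1.1 hx.2.1.1 hx.2.2).1.const_mul _
    · refine (hu.integrable_prod_logMajorant hδ hf hf).congr ?_
      filter_upwards [ae_prod_kappaMeasure] with x hx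
      simp only [Function.uncurry, hF]
      simp_rw [norm_mul ((f x.2 * f x.1 : ℝ) : ℂ)]
      rw [integral_const_mul, (integral_gramFun δ hx.1.1 hx.2.1.1 hx.2.2).2.2, Complex.norm_real,
        norm_mul]
      simp only [Real.norm_eq_abs]
      ring
  -- For fixed `p` the double integral factors into a complex number times its conjugate.
  have hinner : ∀ p, ∫ x, F x p ∂(ν.prod ν) =
      ((2 * Complex.normSq (∫ η, (f η : ℂ) * gramFun δ p η ∂ν) : ℝ) : ℂ) := by
    intro p
    have h1 : ∀ x : ℝ × ℝ, F x p = 2 * (((f x.1 : ℂ) * gramFun δ p x.1) *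
        (starRingEnd ℂ) ((f x.2 : ℂ) * gramFun δ p x.2)) := by
      intro x
      simp only [hF, map_mul, Complex.conj_ofReal]
      push_cast
      ring
    simp_rw [h1]
    rw [integral_const_mul, integral_prod_mul (fun x => (f x : ℂ) * gramFun δ p x)
      (fun x => (starRingEnd ℂ) ((f x : ℂ) * gramFun δ p x)), integral_conj, Complex.mul_conj]
    push_cast
    rfl
  have hout := hFi.integral_prod_right
  simp only [Function.uncurry, hinner] at hout
  refine ⟨by simpa using hout.re, ?_⟩
  have hswap := integral_integral_swap hFi
  simp only [hinner] at hswap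
  rw [integral_complex_ofReal] at hswap
  have hre := congrArg Complex.re hswap
  rw [Complex.ofReal_re] at hre
  rw [← hre]
  simp only [kernelPotential, ← integral_mul_const]
  rw [integral_integral (f := fun κ η => logKernel δ (quadZeta δ κ) η * f η * f κ)
    (hu.integrable_prod_kernel hδ hf hf)]
  refine Eq.trans ?_ (integral_re (𝕜 := ℂ) hFi.integral_prod_left)
  refine integral_congr_ae ?_
  filter_upwards [ae_prod_kappaMeasure] with x hx
  simp only [hF]
  rw [integral_const_mul]
  change _ = Complex.re _
  rw [Complex.re_ofReal_mul, (integral_gramFun δ hx.1.1 hx.2.1.1 hx.2.2).2.1]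
  ring

lemma integral_kernelPotential_mul_self_nonneg (hδ : 0 < δ) {f : ℝ → ℝ}
    (hf : IsWeylDominated δ u₀ xm f) :
    0 ≤ ∫ κ, kernelPotential δ u₀ xm f κ * f κ ∂(kappaMeasure δ u₀ xm) := by
  rw [(hu.integral_kernelPotential_mul_self hδ hf).2]
  exact integral_nonneg fun p => mul_nonneg zero_le_two (Complex.normSq_nonneg _)

/-- The interaction energy is strictly positive definite. -/
lemma ae_eq_zero_of_interaction_eq_zero (hδ : 0 < δ) {f : ℝ → ℝ} (hf : IsWeylDominated δ u₀ xm f)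
    (h : ∫ κ, kernelPotential δ u₀ xm f κ * f κ ∂(kappaMeasure δ u₀ xm) = 0) :
    f =ᵐ[kappaMeasure δ u₀ xm] 0 := by
  obtain ⟨hint, heq⟩ := hu.integral_kernelPotential_mul_self hδ hf
  rw [heq, integral_eq_zero_iff_of_nonneg
    (fun p => mul_nonneg zero_le_two (Complex.normSq_nonneg _)) hint] at h
  have h1 : ∀ᵐ q ∂gramMeasure, ∫ η, (f η : ℂ) * gramFun δ q.swap η ∂(kappaMeasure δ u₀ xm) = 0 := by
    have : ∀ᵐ p ∂gramMeasure, ∫ η, (f η : ℂ) * gramFun δ p η ∂(kappaMeasure δ u₀ xm) = 0 := by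
      filter_upwards [h] with p hp
      simpa using hp
    have hsw : Measure.map Prod.swap gramMeasure = gramMeasure := Measure.prod_swap
    rw [← hsw] at this
    exact ae_of_ae_map measurable_swap.aemeasurable this
  have h2 := Measure.ae_ae_of_ae_prod h1
  have hne : (ae (volume.restrict (Ioi (0 : ℝ)))).NeBot := by
    rw [ae_neBot, Ne, Measure.restrict_eq_zero, Real.volume_Ioi]
    exact ENNReal.top_ne_zero
  -- A single frequency `k > 0` is enough: for almost every `τ` the tail integral of `f exp (i k ζ)`
  -- beyond `τ` vanishes.
  obtain ⟨k, hk, hk0⟩ := (h2.and (ae_restrict_mem measurableSet_Ioi)).exists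
  rw [mem_Ioi] at hk0
  set g : ℝ → ℂ := fun η => (f η : ℂ) * Complex.exp (k * (Complex.I * quadZeta δ η)) with hg
  have hgi : Integrable g (kappaMeasure δ u₀ xm) := by
    refine (hu.integrable_of_dominated hδ hf).abs.mono' ?_ ?_
    · refine (Complex.continuous_ofReal.comp_aestronglyMeasurable hf.1.aestronglyMeasurable).mul ?_
      exact (Complex.measurable_exp.comp
        (((measurable_quadZeta δ).const_mul _).const_mul _)).aestronglyMeasurable
    · filter_upwards [ae_kappaMeasure_mem] with η hη
      rw [hg, norm_mul, Complex.norm_real, Complex.norm_exp, Complex.re_ofReal_mul]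
      simp only [Complex.mul_re, Complex.I_re, Complex.I_im, quadZeta_im, zero_mul, one_mul,
        zero_sub]
      refine mul_le_of_le_one_right (norm_nonneg _) (Real.exp_le_one_iff.2 ?_)
      nlinarith [mul_pos hk0 hη.1]
  have hz : ∀ᵐ τ ∂(volume.restrict (Ioi (0 : ℝ))),
      ∫ η in Ioi τ, g η ∂(kappaMeasure δ u₀ xm) = 0 := by
    filter_upwards [hk] with τ hτ
    have h3 : ∀ η, (f η : ℂ) * gramFun δ (k, τ).swap η =
        Complex.exp (k * τ) * (Ioi τ).indicator g η := by
      intro η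
      simp only [gramFun, Prod.swap, indicator, mem_Ioi, hg]
      split_ifs
      · rw [mul_add, Complex.exp_add]
        ring
      · simp
    simp_rw [h3] at hτ
    rw [integral_const_mul, integral_indicator measurableSet_Ioi] at hτ
    exact (mul_eq_zero.1 hτ).resolve_left (Complex.exp_ne_zero _)
  have hall : ∀ τ, ∫ η in Ioi τ, g η ∂(kappaMeasure δ u₀ xm) = 0 := by
    intro τ
    -- Negative `τ` may be replaced by `0`, since the measure is carried by positive `η`.
    rw [← setIntegral_Ioi_eq_zero_of_ae hgi 0 hz (le_max_right τ 0)]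
    refine setIntegral_congr_set ?_
    filter_upwards [ae_kappaMeasure_mem] with η hη
    refine propext ?_
    change τ < η ↔ max τ 0 < η
    rw [max_lt_iff]
    exact ⟨fun h => ⟨h, hη.1⟩, fun h => h.1⟩
  filter_upwards [ae_eq_zero_of_forall_setIntegral_Ioi_eq_zero hgi hall] with η hη
  simpa [hg, Complex.exp_ne_zero] using hη

end IsAdmissibleInitialCondition

end ILW

namespace ILW

variable {δ : ℝ} {u₀ : ℝ → ℝ} {xm : ℝ}

/-! ### Admissible densities -/

lemma isWeylDominated_of_mem {ρ : ℝ → ℝ} (h : ρ ∈ admissibleDensities δ u₀ xm) :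
    IsWeylDominated δ u₀ xm ρ := by
  refine ⟨h.1, ?_⟩
  filter_upwards [h.2] with κ hκ
  rw [abs_of_nonneg hκ.1]
  exact hκ.2

lemma isWeylDominated_sub {ρ σ : ℝ → ℝ} (hσ : σ ∈ admissibleDensities δ u₀ xm)
    (hρ : ρ ∈ admissibleDensities δ u₀ xm) : IsWeylDominated δ u₀ xm (σ - ρ) := by
  refine ⟨hσ.1.sub hρ.1, ?_⟩
  filter_upwards [hσ.2, hρ.2] with κ h1 h2
  rw [Pi.sub_apply, abs_le]
  constructor <;> linarith

lemma convex_admissibleDensities : Convex ℝ (admissibleDensities δ u₀ xm) := by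
  intro ρ hρ σ hσ a b ha hb hab
  refine ⟨(hρ.1.const_mul a).add (hσ.1.const_mul b), ?_⟩
  filter_upwards [hρ.2, hσ.2] with κ h1 h2
  simp only [Pi.add_apply, Pi.smul_apply, smul_eq_mul]
  constructor
  · exact add_nonneg (mul_nonneg ha h1.1) (mul_nonneg hb h2.1)
  · calc a * ρ κ + b * σ κ ≤ a * rhoWeyl δ u₀ xm κ + b * rhoWeyl δ u₀ xm κ :=
          add_le_add (mul_le_mul_of_nonneg_left h1.2 ha) (mul_le_mul_of_nonneg_left h2.2 hb)
      _ = rhoWeyl δ u₀ xm κ := by rw [← add_mul, hab, one_mul]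

lemma energyDerivative_eq (x t : ℝ) (ρ : ℝ → ℝ) (κ : ℝ) :
    energyDerivative δ u₀ xm x t ρ (quadZeta δ κ) =
      potentialV δ u₀ xm x t (quadZeta δ κ) + 1 / Real.pi * kernelPotential δ u₀ xm ρ κ := rfl

lemma energyDensity_eq (x t : ℝ) (ρ : ℝ → ℝ) (κ : ℝ) :
    energyDensity δ u₀ xm x t ρ κ = (potentialV δ u₀ xm x t (quadZeta δ κ) +
      1 / 2 * (1 / Real.pi * kernelPotential δ u₀ xm ρ κ)) * ρ κ := rfl

lemma kernelPotential_congr_ae {ρ σ : ℝ → ℝ} (h : ρ =ᵐ[kappaMeasure δ u₀ xm] σ) :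
    kernelPotential δ u₀ xm ρ = kernelPotential δ u₀ xm σ := by
  funext κ
  refine integral_congr_ae ?_
  filter_upwards [h] with η hη
  rw [hη]

lemma energy_congr_ae {ρ σ : ℝ → ℝ} (h : ρ =ᵐ[kappaMeasure δ u₀ xm] σ) (x t : ℝ) :
    energy δ u₀ xm x t ρ = energy δ u₀ xm x t σ := by
  refine integral_congr_ae ?_
  filter_upwards [h] with κ hκ
  rw [energyDensity_eq, energyDensity_eq, kernelPotential_congr_ae h, hκ]

lemma kernelPotential_smul (c : ℝ) (g : ℝ → ℝ) (κ : ℝ) :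
    kernelPotential δ u₀ xm (c • g) κ = c * kernelPotential δ u₀ xm g κ := by
  simp only [kernelPotential, Pi.smul_apply, smul_eq_mul]
  rw [← integral_const_mul]
  refine integral_congr_ae (Eventually.of_forall fun η => ?_)
  ring

namespace IsAdmissibleInitialCondition

variable (hu : IsAdmissibleInitialCondition u₀ xm)
include hu

lemma kernelPotential_add (hδ : 0 < δ) {f g : ℝ → ℝ} (hf : IsWeylDominated δ u₀ xm f)
    (hg : IsWeylDominated δ u₀ xm g) {κ : ℝ} (hκ : κ ∈ Icc 0 (kappaMax δ u₀ xm)) :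
    kernelPotential δ u₀ xm (f + g) κ =
      kernelPotential δ u₀ xm f κ + kernelPotential δ u₀ xm g κ := by
  simp only [kernelPotential, Pi.add_apply, mul_add]
  exact integral_add (hu.integrable_kernel_mul hδ hf hκ) (hu.integrable_kernel_mul hδ hg hκ)

/-! ### The energy as a quadratic functional -/

lemma integrable_potentialV_mul (hδ : 0 < δ) (x t : ℝ) {g : ℝ → ℝ}
    (hg : Integrable g (kappaMeasure δ u₀ xm)) :
    Integrable (fun κ => potentialV δ u₀ xm x t (quadZeta δ κ) * g κ) (kappaMeasure δ u₀ xm) := by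
  obtain ⟨C, hC⟩ := hu.exists_potentialV_bound hδ x t
  exact hg.bdd_mul (hu.aestronglyMeasurable_potentialV hδ x t) hC

lemma integrable_kernelPotential_mul (hδ : 0 < δ) {f g : ℝ → ℝ} (hf : IsWeylDominated δ u₀ xm f)
    (hg : Integrable g (kappaMeasure δ u₀ xm)) :
    Integrable (fun κ => kernelPotential δ u₀ xm f κ * g κ) (kappaMeasure δ u₀ xm) := by
  obtain ⟨C, -, hC⟩ := hu.exists_kernelPotential_le hδ
  refine hg.bdd_mul (c := C) (aestronglyMeasurable_kernelPotential hf.1) ?_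
  filter_upwards [ae_kappaMeasure_mem] with κ hκ
  exact hC f hf κ ⟨hκ.1.le, hκ.2.le⟩

lemma integrable_energyDensity (hδ : 0 < δ) (x t : ℝ) {f : ℝ → ℝ}
    (hf : IsWeylDominated δ u₀ xm f) :
    Integrable (energyDensity δ u₀ xm x t f) (kappaMeasure δ u₀ xm) := by
  have hi := hu.integrable_of_dominated hδ hf
  refine ((hu.integrable_potentialV_mul hδ x t hi).add
    ((hu.integrable_kernelPotential_mul hδ hf hi).const_mul (1 / 2 * (1 / Real.pi)))).congr ?_
  refine Eventually.of_forall fun κ => ?_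
  rw [energyDensity_eq, Pi.add_apply]
  ring

lemma integrable_energyDerivative_mul (hδ : 0 < δ) (x t : ℝ) {f g : ℝ → ℝ}
    (hf : IsWeylDominated δ u₀ xm f) (hg : Integrable g (kappaMeasure δ u₀ xm)) :
    Integrable (fun κ => energyDerivative δ u₀ xm x t f (quadZeta δ κ) * g κ)
      (kappaMeasure δ u₀ xm) := by
  refine ((hu.integrable_potentialV_mul hδ x t hg).add
    ((hu.integrable_kernelPotential_mul hδ hf hg).const_mul (1 / Real.pi))).congr ?_
  refine Eventually.of_forall fun κ => ?_
  simp only [energyDerivative_eq, Pi.add_apply]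
  ring

lemma aestronglyMeasurable_energyDerivative (hδ : 0 < δ) (x t : ℝ) {f : ℝ → ℝ}
    (hf : IsWeylDominated δ u₀ xm f) :
    AEStronglyMeasurable (fun κ => energyDerivative δ u₀ xm x t f (quadZeta δ κ))
      (kappaMeasure δ u₀ xm) :=
  (hu.aestronglyMeasurable_potentialV hδ x t).add
    ((aestronglyMeasurable_kernelPotential hf.1).const_mul _)

lemma exists_energyDerivative_bound (hδ : 0 < δ) (x t : ℝ) : ∃ C, ∀ f, IsWeylDominated δ u₀ xm f →
    ∀ᵐ κ ∂(kappaMeasure δ u₀ xm), |energyDerivative δ u₀ xm x t f (quadZeta δ κ)| ≤ C := by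
  obtain ⟨C, hC⟩ := hu.exists_potentialV_bound hδ x t
  obtain ⟨C', -, hC'⟩ := hu.exists_kernelPotential_le hδ
  refine ⟨C + 1 / Real.pi * C', fun f hf => ?_⟩
  filter_upwards [hC, ae_kappaMeasure_mem] with κ h1 hκ
  rw [energyDerivative_eq]
  refine (abs_add_le _ _).trans (add_le_add h1 ?_)
  rw [abs_mul, abs_of_pos (by positivity : 0 < 1 / Real.pi)]
  exact mul_le_mul_of_nonneg_left (hC' f hf κ ⟨hκ.1.le, hκ.2.le⟩) (by positivity)

/-- Second order expansion of the energy. -/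
lemma energy_add (hδ : 0 < δ) (x t : ℝ) {f g : ℝ → ℝ} (hf : IsWeylDominated δ u₀ xm f)
    (hg : IsWeylDominated δ u₀ xm g) :
    energy δ u₀ xm x t (f + g) = energy δ u₀ xm x t f +
      ∫ κ, energyDerivative δ u₀ xm x t f (quadZeta δ κ) * g κ ∂(kappaMeasure δ u₀ xm) +
      1 / (2 * Real.pi) *
        ∫ κ, kernelPotential δ u₀ xm g κ * g κ ∂(kappaMeasure δ u₀ xm) := by
  have hfi := hu.integrable_of_dominated hδ hf
  have hgi := hu.integrable_of_dominated hδ hg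
  have h1 := hu.integrable_energyDensity hδ x t hf
  have h2 := hu.integrable_energyDerivative_mul hδ x t hf hgi
  have h3 := (hu.integrable_kernelPotential_mul hδ hg hgi).const_mul (1 / (2 * Real.pi))
  have h4 := hu.integrable_kernelPotential_mul hδ hg hfi
  have h5 := hu.integrable_kernelPotential_mul hδ hf hgi
  -- Pointwise expansion yields half of each cross term, whereas the derivative contains `L[f] g` in
  -- full; this correction has integral zero by symmetry of the kernel.
  have h6 := (h4.sub h5).const_mul (1 / (2 * Real.pi))
  have h0 : ∫ κ, 1 / (2 * Real.pi) * (kernelPotential δ u₀ xm g κ * f κ -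
      kernelPotential δ u₀ xm f κ * g κ) ∂(kappaMeasure δ u₀ xm) = 0 := by
    rw [integral_const_mul, integral_sub h4 h5,
      hu.integral_kernelPotential_mul_symm hδ hf hg, sub_self, mul_zero]
  have e := integral_add' ((h1.add h2).add h3) h6
  rw [integral_add' (h1.add h2) h3, integral_add' h1 h2] at e
  have h7 := integral_const_mul (μ := kappaMeasure δ u₀ xm) (1 / (2 * Real.pi))
    (fun κ => kernelPotential δ u₀ xm g κ * g κ)
  simp only [Pi.sub_apply] at e
  rw [h0, h7, add_zero] at e
  refine Eq.trans (integral_congr_ae ?_) e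
  filter_upwards [ae_kappaMeasure_mem] with κ hκ
  simp only [energyDensity_eq, energyDerivative_eq, Pi.add_apply,
    hu.kernelPotential_add hδ hf hg ⟨hκ.1.le, hκ.2.le⟩]
  field_simp
  ring

lemma energy_eq_add (hδ : 0 < δ) (x t : ℝ) {ρ σ : ℝ → ℝ} (hρ : ρ ∈ admissibleDensities δ u₀ xm)
    (hσ : σ ∈ admissibleDensities δ u₀ xm) :
    energy δ u₀ xm x t σ = energy δ u₀ xm x t ρ +
      ∫ κ, energyDerivative δ u₀ xm x t ρ (quadZeta δ κ) * (σ - ρ) κ ∂(kappaMeasure δ u₀ xm) +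
      1 / (2 * Real.pi) *
        ∫ κ, kernelPotential δ u₀ xm (σ - ρ) κ * (σ - ρ) κ ∂(kappaMeasure δ u₀ xm) := by
  rw [← hu.energy_add hδ x t (isWeylDominated_of_mem hρ) (isWeylDominated_sub hσ hρ),
    add_sub_cancel]

lemma energy_ge (hδ : 0 < δ) (x t : ℝ) {ρ σ : ℝ → ℝ} (hρ : ρ ∈ admissibleDensities δ u₀ xm)
    (hσ : σ ∈ admissibleDensities δ u₀ xm) :
    energy δ u₀ xm x t ρ + ∫ κ, energyDerivative δ u₀ xm x t ρ (quadZeta δ κ) * (σ - ρ) κ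
      ∂(kappaMeasure δ u₀ xm) ≤ energy δ u₀ xm x t σ := by
  rw [hu.energy_eq_add hδ x t hρ hσ]
  have := hu.integral_kernelPotential_mul_self_nonneg hδ (isWeylDominated_sub hσ hρ)
  have : 0 ≤ 1 / (2 * Real.pi) *
      ∫ κ, kernelPotential δ u₀ xm (σ - ρ) κ * (σ - ρ) κ ∂(kappaMeasure δ u₀ xm) :=
    mul_nonneg (by positivity) this
  linarith

lemma abs_interaction_le (hδ : 0 < δ) {g : ℝ → ℝ} (hg : IsWeylDominated δ u₀ xm g) {C : ℝ}
    (hC : ∀ κ ∈ Icc 0 (kappaMax δ u₀ xm), |kernelPotential δ u₀ xm g κ| ≤ C) :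
    |∫ κ, kernelPotential δ u₀ xm g κ * g κ ∂(kappaMeasure δ u₀ xm)| ≤
      C * ∫ κ, |g κ| ∂(kappaMeasure δ u₀ xm) := by
  rw [← integral_const_mul, ← Real.norm_eq_abs]
  refine norm_integral_le_of_norm_le ((hu.integrable_of_dominated hδ hg).abs.const_mul C) ?_
  filter_upwards [ae_kappaMeasure_mem] with κ hκ
  rw [norm_mul]
  exact mul_le_mul_of_nonneg_right (hC κ ⟨hκ.1.le, hκ.2.le⟩) (abs_nonneg _)

/-- The energy is Lipschitz continuous on admissible densities for the `L¹` norm. -/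
lemma exists_energy_lipschitz (hδ : 0 < δ) (x t : ℝ) : ∃ C, ∀ ρ ∈ admissibleDensities δ u₀ xm,
    ∀ σ ∈ admissibleDensities δ u₀ xm, |energy δ u₀ xm x t σ - energy δ u₀ xm x t ρ| ≤
      C * ∫ κ, |(σ - ρ) κ| ∂(kappaMeasure δ u₀ xm) := by
  obtain ⟨C, hC⟩ := hu.exists_energyDerivative_bound hδ x t
  obtain ⟨C', -, hC'⟩ := hu.exists_kernelPotential_le hδ
  refine ⟨C + 1 / (2 * Real.pi) * C', fun ρ hρ σ hσ => ?_⟩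
  have hg := isWeylDominated_sub hσ hρ
  have hgi := hu.integrable_of_dominated hδ hg
  rw [hu.energy_eq_add hδ x t hρ hσ, add_assoc, add_sub_cancel_left, add_mul, mul_assoc]
  refine (abs_add_le _ _).trans (add_le_add ?_ ?_)
  · rw [← integral_const_mul, ← Real.norm_eq_abs]
    refine norm_integral_le_of_norm_le (hgi.abs.const_mul C) ?_
    filter_upwards [hC ρ (isWeylDominated_of_mem hρ)] with κ hκ
    rw [norm_mul]
    exact mul_le_mul_of_nonneg_right hκ (abs_nonneg _)
  · rw [abs_mul, abs_of_pos (by positivity : 0 < 1 / (2 * Real.pi))]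
    exact mul_le_mul_of_nonneg_left (hu.abs_interaction_le hδ hg (hC' _ hg)) (by positivity)

/-- The supporting inequality `energy_ge` is applied at the intermediate density, in the directions
of both endpoints; the weighted linear terms cancel. -/
lemma convexOn_energy (hδ : 0 < δ) (x t : ℝ) :
    ConvexOn ℝ (admissibleDensities δ u₀ xm) (energy δ u₀ xm x t) := by
  refine ⟨convex_admissibleDensities, fun ρ hρ σ hσ a b ha hb hab => ?_⟩
  have hτ := convex_admissibleDensities hρ hσ ha hb hab
  set τ := a • ρ + b • σ with hτdef
  have h1 := hu.energy_ge hδ x t hτ hρ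
  have h2 := hu.energy_ge hδ x t hτ hσ
  have hτd := isWeylDominated_of_mem hτ
  have i1 := hu.integrable_energyDerivative_mul hδ x t hτd
    (hu.integrable_of_dominated hδ (isWeylDominated_sub hρ hτ))
  have i2 := hu.integrable_energyDerivative_mul hδ x t hτd
    (hu.integrable_of_dominated hδ (isWeylDominated_sub hσ hτ))
  have h0 : a * (∫ κ, energyDerivative δ u₀ xm x t τ (quadZeta δ κ) * (ρ - τ) κ
      ∂(kappaMeasure δ u₀ xm)) + b * (∫ κ, energyDerivative δ u₀ xm x t τ (quadZeta δ κ) *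
      (σ - τ) κ ∂(kappaMeasure δ u₀ xm)) = 0 := by
    rw [← integral_const_mul, ← integral_const_mul,
      ← integral_add (i1.const_mul a) (i2.const_mul b)]
    refine integral_eq_zero_of_ae (Eventually.of_forall fun κ => ?_)
    have hb' : b = 1 - a := by linarith
    simp only [hτdef, Pi.sub_apply, Pi.add_apply, Pi.smul_apply, smul_eq_mul, hb', Pi.zero_apply]
    ring
  have h3 := mul_le_mul_of_nonneg_left h1 ha
  have h4 := mul_le_mul_of_nonneg_left h2 hb
  have h5 : a * energy δ u₀ xm x t τ + b * energy δ u₀ xm x t τ = energy δ u₀ xm x t τ := by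
    rw [← add_mul, hab, one_mul]
  simp only [smul_eq_mul]
  linarith

/-! ### Characterization and uniqueness of minimizers -/

/-- Along the segment to `σ` the energy changes by `s (a + s q)`, and `s → 0` gives `a ≥ 0`. The
converse is the supporting inequality `energy_ge`. -/
lemma isMinimizingDensity_iff (hδ : 0 < δ) (x t : ℝ) {ρ : ℝ → ℝ}
    (hρ : ρ ∈ admissibleDensities δ u₀ xm) : IsMinimizingDensity δ u₀ xm x t ρ ↔
      ∀ σ ∈ admissibleDensities δ u₀ xm, 0 ≤ ∫ κ,
        energyDerivative δ u₀ xm x t ρ (quadZeta δ κ) * (σ - ρ) κ ∂(kappaMeasure δ u₀ xm) := by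
  constructor
  · rintro ⟨-, hmin⟩ σ hσ
    set a := ∫ κ, energyDerivative δ u₀ xm x t ρ (quadZeta δ κ) * (σ - ρ) κ
      ∂(kappaMeasure δ u₀ xm) with ha
    set q := 1 / (2 * Real.pi) *
      ∫ κ, kernelPotential δ u₀ xm (σ - ρ) κ * (σ - ρ) κ ∂(kappaMeasure δ u₀ xm) with hq
    have key : ∀ s ∈ Ioo (0 : ℝ) 1, 0 ≤ a + s * q := by
      intro s hs
      have hmem := convex_admissibleDensities hρ hσ (sub_nonneg.2 hs.2.le) hs.1.le
        (sub_add_cancel 1 s)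
      have h1 : energy δ u₀ xm x t ρ ≤ energy δ u₀ xm x t _ := hmin hmem
      rw [hu.energy_eq_add hδ x t hρ hmem] at h1
      have hsub : (1 - s) • ρ + s • σ - ρ = s • (σ - ρ) := by
        rw [sub_smul, one_smul, smul_sub]
        abel
      rw [hsub] at h1
      simp only [kernelPotential_smul, Pi.smul_apply, smul_eq_mul] at h1
      have e1 : ∫ κ, energyDerivative δ u₀ xm x t ρ (quadZeta δ κ) * (s * (σ - ρ) κ)
          ∂(kappaMeasure δ u₀ xm) = s * a := by
        rw [ha, ← integral_const_mul]
        refine integral_congr_ae (Eventually.of_forall fun κ => ?_)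
        ring
      have e2 : ∫ κ, s * kernelPotential δ u₀ xm (σ - ρ) κ * (s * (σ - ρ) κ)
          ∂(kappaMeasure δ u₀ xm) = s ^ 2 *
            ∫ κ, kernelPotential δ u₀ xm (σ - ρ) κ * (σ - ρ) κ ∂(kappaMeasure δ u₀ xm) := by
        rw [← integral_const_mul]
        refine integral_congr_ae (Eventually.of_forall fun κ => ?_)
        ring
      rw [e1, e2] at h1
      have h2 : 0 ≤ s * (a + s * q) := by
        rw [hq]
        linarith
      exact nonneg_of_mul_nonneg_right h2 hs.1
    have hlim : Tendsto (fun s : ℝ => a + s * q) (𝓝[>] 0) (𝓝 (a + 0 * q)) :=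
      ((continuous_const.add (continuous_id.mul continuous_const)).tendsto 0).mono_left
        nhdsWithin_le_nhds
    have := ge_of_tendsto hlim (by
      filter_upwards [Ioo_mem_nhdsGT (zero_lt_one (α := ℝ))] with s hs
      exact key s hs)
    simpa using this
  · intro h
    refine ⟨hρ, fun σ hσ => ?_⟩
    have h1 := hu.energy_ge hδ x t hρ hσ
    have h2 := h σ hσ
    change energy δ u₀ xm x t ρ ≤ energy δ u₀ xm x t σ
    linarith

/-- Between two minimizers the linear term is nonnegative and the total change is at most zero, so
the interaction energy of the difference vanishes. -/
lemma isMinimizingDensity_unique (hδ : 0 < δ) (x t : ℝ) {ρ σ : ℝ → ℝ}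
    (hρ : IsMinimizingDensity δ u₀ xm x t ρ) (hσ : IsMinimizingDensity δ u₀ xm x t σ) :
    ρ =ᵐ[kappaMeasure δ u₀ xm] σ := by
  have hg := isWeylDominated_sub hσ.1 hρ.1
  have h1 := (hu.isMinimizingDensity_iff hδ x t hρ.1).1 hρ σ hσ.1
  have h2 := hu.energy_eq_add hδ x t hρ.1 hσ.1
  have h3 : energy δ u₀ xm x t σ ≤ energy δ u₀ xm x t ρ := hσ.2 hρ.1
  have h4 := hu.integral_kernelPotential_mul_self_nonneg hδ hg
  have h5 : 1 / (2 * Real.pi) * (∫ κ, kernelPotential δ u₀ xm (σ - ρ) κ * (σ - ρ) κ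
      ∂(kappaMeasure δ u₀ xm)) ≤ 0 := by linarith
  have h6 := le_antisymm (nonpos_of_mul_nonpos_right h5 (by positivity)) h4
  filter_upwards [hu.ae_eq_zero_of_interaction_eq_zero hδ hg h6] with κ hκ
  rw [Pi.sub_apply, Pi.zero_apply] at hκ
  linarith

lemma variationalConditions_iff (hδ : 0 < δ) (x t : ℝ) {ρ : ℝ → ℝ}
    (hρ : ρ ∈ admissibleDensities δ u₀ xm) : VariationalConditions δ u₀ xm x t ρ ↔
      ∀ σ ∈ admissibleDensities δ u₀ xm, 0 ≤ ∫ κ,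
        energyDerivative δ u₀ xm x t ρ (quadZeta δ κ) * (σ - ρ) κ ∂(kappaMeasure δ u₀ xm) := by
  constructor
  · intro h σ hσ
    refine integral_nonneg_of_ae ?_
    filter_upwards [h, hσ.2, ae_kappaMeasure_mem] with κ ⟨h1, _, h3⟩ hσκ hκ
    have hκ' : κ ∈ Icc 0 (kappaMax δ u₀ xm) := ⟨hκ.1.le, hκ.2.le⟩
    rw [Pi.zero_apply, Pi.sub_apply]
    rcases lt_trichotomy (energyDerivative δ u₀ xm x t ρ (quadZeta δ κ)) 0 with hD | hD | hD
    · rw [h3 ⟨hκ', hD⟩]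
      exact mul_nonneg_of_nonpos_of_nonpos hD.le (sub_nonpos.2 hσκ.2)
    · rw [hD, zero_mul]
    · rw [h1 ⟨hκ', hD⟩, sub_zero]
      exact mul_nonneg hD.le hσκ.1
  · intro h
    have hDm := hu.aestronglyMeasurable_energyDerivative hδ x t (isWeylDominated_of_mem hρ)
    -- A measurable version of the derivative makes the sign sets measurable.
    set D := hDm.mk _ with hD
    have hDmeas : Measurable D := hDm.stronglyMeasurable_mk.measurable
    -- This competitor makes `D (σ - ρ)` nonpositive almost everywhere; as its integral is
    -- nonnegative, the product vanishes almost everywhere.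
    set σ : ℝ → ℝ := {κ | D κ < 0}.indicator (rhoWeyl δ u₀ xm) + {κ | D κ = 0}.indicator ρ with hσ
    have hσ1 : ∀ κ, D κ < 0 → σ κ = rhoWeyl δ u₀ xm κ := fun κ hκ => by
      simp [hσ, indicator, hκ, hκ.ne]
    have hσ2 : ∀ κ, D κ = 0 → σ κ = ρ κ := fun κ hκ => by
      simp [hσ, indicator, hκ]
    have hσ3 : ∀ κ, 0 < D κ → σ κ = 0 := fun κ hκ => by
      simp [hσ, indicator, hκ.le, hκ.ne']
    have hσA : σ ∈ admissibleDensities δ u₀ xm := by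
      refine ⟨((measurable_rhoWeyl δ u₀ xm).aemeasurable.indicator
        (measurableSet_lt hDmeas measurable_const)).add
        (hρ.1.indicator (measurableSet_eq_fun hDmeas measurable_const)), ?_⟩
      filter_upwards [hρ.2, hu.rhoWeyl_nonneg hδ] with κ h1 h2
      rcases lt_trichotomy (D κ) 0 with hκ | hκ | hκ
      · rw [hσ1 κ hκ]
        exact ⟨h2, le_rfl⟩
      · rw [hσ2 κ hκ]
        exact h1
      · rw [hσ3 κ hκ]
        exact ⟨le_rfl, h2⟩
    have hint := hu.integrable_energyDerivative_mul hδ x t (isWeylDominated_of_mem hρ)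
      (hu.integrable_of_dominated hδ (isWeylDominated_sub hσA hρ))
    have hnp : ∀ᵐ κ ∂(kappaMeasure δ u₀ xm),
        0 ≤ -(energyDerivative δ u₀ xm x t ρ (quadZeta δ κ) * (σ - ρ) κ) := by
      filter_upwards [hDm.ae_eq_mk, hρ.2] with κ h1 h2
      rw [h1, Pi.sub_apply, neg_nonneg]
      rcases lt_trichotomy (D κ) 0 with hκ | hκ | hκ
      · rw [hσ1 κ hκ]
        exact mul_nonpos_of_nonpos_of_nonneg hκ.le (sub_nonneg.2 h2.2)
      · rw [← hD, hκ, zero_mul]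
      · rw [hσ3 κ hκ, zero_sub]
        exact mul_nonpos_of_nonneg_of_nonpos hκ.le (neg_nonpos.2 h2.1)
    have h0 : ∫ κ, -(energyDerivative δ u₀ xm x t ρ (quadZeta δ κ) * (σ - ρ) κ)
        ∂(kappaMeasure δ u₀ xm) = 0 := by
      refine le_antisymm ?_ (integral_nonneg_of_ae hnp)
      rw [integral_neg, neg_nonpos]
      exact h σ hσA
    rw [integral_eq_zero_iff_of_nonneg_ae hnp hint.neg] at h0
    filter_upwards [h0, hDm.ae_eq_mk, hρ.2] with κ h1 h2 h3
    rw [Pi.zero_apply, neg_eq_zero, Pi.sub_apply, mul_eq_zero, h2, ← hD] at h1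
    refine ⟨fun hκ => ?_, fun _ => h3, fun hκ => ?_⟩
    · have hp : 0 < D κ := by
        rw [hD, ← h2]
        exact hκ.2
      have := h1.resolve_left hp.ne'
      rw [hσ3 κ hp] at this
      linarith
    · have hp : D κ < 0 := by
        rw [hD, ← h2]
        exact hκ.2
      have := h1.resolve_left hp.ne
      rw [hσ1 κ hp] at this
      linarith

end IsAdmissibleInitialCondition

end ILW

namespace ILW

/-! ### Minimization of convex functions on bounded sets of a Hilbert space -/

/-- A continuous convex function attains its minimum on a nonempty closed bounded convex subset of
a Hilbert space, if it is bounded below there. -/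
lemma exists_isMinOn_of_convexOn {H : Type*} [NormedAddCommGroup H] [InnerProductSpace ℝ H]
    [CompleteSpace H] {C : Set H} {J : H → ℝ} (hne : C.Nonempty) (hcl : IsClosed C)
    (hbd : ∃ R, ∀ x ∈ C, ‖x‖ ≤ R) (hJ : ConvexOn ℝ C J) (hJc : ContinuousOn J C)
    (hJb : BddBelow (J '' C)) : ∃ x ∈ C, IsMinOn J C x := by
  set m := sInf (J '' C) with hm
  set K : ℕ → Set H := fun n => {x | x ∈ C ∧ J x ≤ m + 1 / (n + 1)} with hK
  have hKne : ∀ n, (K n).Nonempty := by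
    intro n
    obtain ⟨_, ⟨x, hx, rfl⟩, hlt⟩ := exists_lt_of_csInf_lt (hne.image J)
      (show sInf (J '' C) < m + 1 / ((n : ℝ) + 1) by
        have : (0 : ℝ) < 1 / ((n : ℝ) + 1) := Nat.one_div_pos_of_nat
        linarith)
    exact ⟨x, hx, hlt.le⟩
  have hKcl : ∀ n, IsClosed (K n) := fun n => hJc.preimage_isClosed_of_isClosed hcl isClosed_Iic
  have hKcv : ∀ n, Convex ℝ (K n) := fun n => hJ.convex_le _
  have hKanti : ∀ n k, n ≤ k → K k ⊆ K n := by
    intro n k hnk x hx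
    refine ⟨hx.1, hx.2.trans ?_⟩
    gcongr
  -- The elements of least norm in the nested sublevel sets have increasing bounded norms, and `‖v k
  -- - v n‖² ≤ ‖v k‖² - ‖v n‖²` makes them Cauchy. This takes the place of weak compactness.
  have hmin : ∀ n, ∃ v ∈ K n, ∀ z ∈ K n, ‖v‖ ^ 2 ≤ inner ℝ v z := by
    intro n
    obtain ⟨v, hv, hv'⟩ := exists_norm_eq_iInf_of_complete_convex (hKne n) (hKcl n).isComplete
      (hKcv n) 0
    refine ⟨v, hv, fun z hz => ?_⟩
    have := (norm_eq_iInf_iff_real_inner_le_zero (hKcv n) hv).1 hv' z hz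
    rw [zero_sub, inner_neg_left, inner_sub_right, real_inner_self_eq_norm_sq] at this
    linarith
  choose v hv hvmin using hmin
  have hdist : ∀ n k, n ≤ k → ‖v k - v n‖ ^ 2 ≤ ‖v k‖ ^ 2 - ‖v n‖ ^ 2 := by
    intro n k hnk
    have := hvmin n (v k) (hKanti n k hnk (hv k))
    rw [norm_sub_sq_real, real_inner_comm]
    linarith
  have hmono : Monotone fun n => ‖v n‖ ^ 2 := by
    intro n k hnk
    have := hdist n k hnk
    have := sq_nonneg ‖v k - v n‖
    simp only
    linarith
  obtain ⟨R, hR⟩ := hbd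
  have hbdd : BddAbove (range fun n => ‖v n‖ ^ 2) := by
    refine ⟨R ^ 2, ?_⟩
    rintro _ ⟨n, rfl⟩
    exact pow_le_pow_left₀ (norm_nonneg _) (hR _ (hv n).1) 2
  have hlim := tendsto_atTop_ciSup hmono hbdd
  set s := ⨆ n, ‖v n‖ ^ 2 with hs
  have hcauchy : CauchySeq v := by
    refine cauchySeq_of_le_tendsto_0' (fun n => Real.sqrt (s - ‖v n‖ ^ 2)) ?_ ?_
    · intro n k hnk
      rw [dist_comm, dist_eq_norm]
      refine Real.le_sqrt_of_sq_le ((hdist n k hnk).trans ?_)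
      have : ‖v k‖ ^ 2 ≤ s := le_ciSup hbdd k
      linarith
    · have := ((tendsto_const_nhds (x := s)).sub hlim).sqrt
      simpa using this
  obtain ⟨x, hx⟩ := cauchySeq_tendsto_of_complete hcauchy
  have hxK : ∀ n, x ∈ K n := fun n => (hKcl n).mem_of_tendsto hx
    (by filter_upwards [eventually_ge_atTop n] with k hk using hKanti n k hk (hv k))
  refine ⟨x, (hxK 0).1, fun y hy => ?_⟩
  have h1 : J x ≤ m := by
    have := ge_of_tendsto' ((tendsto_const_nhds (x := m)).add
      (tendsto_one_div_add_atTop_nhds_zero_nat (𝕜 := ℝ))) (fun n => (hxK n).2)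
    simpa using this
  exact h1.trans (csInf_le hJb (mem_image_of_mem J hy))

variable {δ : ℝ} {u₀ : ℝ → ℝ} {xm : ℝ}

/-! ### Existence of a minimizer -/

/-- The measure with density `ρ^Wyl` on the spectral interval. -/
noncomputable def weylMeasure (δ : ℝ) (u₀ : ℝ → ℝ) (xm : ℝ) : Measure ℝ :=
  (kappaMeasure δ u₀ xm).withDensity fun κ => ENNReal.ofReal (rhoWeyl δ u₀ xm κ)

namespace IsAdmissibleInitialCondition

variable (hu : IsAdmissibleInitialCondition u₀ xm)
include hu

lemma isFiniteMeasure_weylMeasure (hδ : 0 < δ) : IsFiniteMeasure (weylMeasure δ u₀ xm) :=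
  isFiniteMeasure_withDensity_ofReal (hu.integrable_rhoWeyl hδ).2

lemma ae_of_ae_weylMeasure (hδ : 0 < δ) {p : ℝ → Prop} (h : ∀ᵐ κ ∂(weylMeasure δ u₀ xm), p κ) :
    ∀ᵐ κ ∂(kappaMeasure δ u₀ xm), rhoWeyl δ u₀ xm κ = 0 ∨ p κ := by
  rw [weylMeasure, ae_withDensity_iff (measurable_rhoWeyl δ u₀ xm).ennreal_ofReal] at h
  filter_upwards [h, hu.rhoWeyl_nonneg hδ] with κ h1 h2
  rcases h2.eq_or_lt with h3 | h3
  · exact Or.inl h3.symm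
  · exact Or.inr (h1 (ENNReal.ofReal_pos.2 h3).ne')

lemma rhoWeyl_mul_congr_ae (hδ : 0 < δ) {f g : ℝ → ℝ} (h : f =ᵐ[weylMeasure δ u₀ xm] g) :
    rhoWeyl δ u₀ xm * f =ᵐ[kappaMeasure δ u₀ xm] rhoWeyl δ u₀ xm * g := by
  filter_upwards [hu.ae_of_ae_weylMeasure hδ h] with κ hκ
  rcases hκ with hκ | hκ
  · simp [hκ]
  · simp [hκ]

lemma integral_weylMeasure (hδ : 0 < δ) (g : ℝ → ℝ) : ∫ κ, g κ ∂(weylMeasure δ u₀ xm) =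
    ∫ κ, rhoWeyl δ u₀ xm κ * g κ ∂(kappaMeasure δ u₀ xm) := by
  rw [weylMeasure, integral_withDensity_eq_integral_toReal_smul
    (measurable_rhoWeyl δ u₀ xm).ennreal_ofReal (Eventually.of_forall fun _ =>
      ENNReal.ofReal_lt_top)]
  refine integral_congr_ae ?_
  filter_upwards [hu.rhoWeyl_nonneg hδ] with κ hκ
  rw [ENNReal.toReal_ofReal hκ, smul_eq_mul]

lemma zero_mem_admissibleDensities (hδ : 0 < δ) : (0 : ℝ → ℝ) ∈ admissibleDensities δ u₀ xm :=
  ⟨measurable_zero.aemeasurable, (hu.rhoWeyl_nonneg hδ).mono fun _ h => ⟨le_rfl, h⟩⟩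

lemma exists_energy_ge (hδ : 0 < δ) (x t : ℝ) : ∃ c, ∀ σ ∈ admissibleDensities δ u₀ xm,
    c ≤ energy δ u₀ xm x t σ := by
  obtain ⟨C, hC⟩ := hu.exists_energy_lipschitz hδ x t
  refine ⟨energy δ u₀ xm x t 0 - |C| * ∫ κ, rhoWeyl δ u₀ xm κ ∂(kappaMeasure δ u₀ xm),
    fun σ hσ => ?_⟩
  have h0 := hu.zero_mem_admissibleDensities hδ
  have h1 := (abs_le.1 (hC 0 h0 σ hσ)).1
  have hd := isWeylDominated_sub hσ h0
  have h2 : ∫ κ, |(σ - 0) κ| ∂(kappaMeasure δ u₀ xm) ≤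
      ∫ κ, rhoWeyl δ u₀ xm κ ∂(kappaMeasure δ u₀ xm) :=
    integral_mono_ae (hu.integrable_of_dominated hδ hd).abs (hu.integrable_rhoWeyl hδ) hd.2
  have h3 : C * (∫ κ, |(σ - 0) κ| ∂(kappaMeasure δ u₀ xm)) ≤
      |C| * ∫ κ, rhoWeyl δ u₀ xm κ ∂(kappaMeasure δ u₀ xm) :=
    mul_le_mul (le_abs_self C) h2 (integral_nonneg fun _ => abs_nonneg _) (abs_nonneg C)
  linarith

/-- Only integrability of `ρ^Wyl` is known, so the Hilbert space is `L²` of the finite measure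
`ρ^Wyl dκ`. There the admissible set is the order interval from `0` to `1`, and the `L¹` distance of
densities is bounded by the `L²` distance of the quotients `φ`, so the energy is continuous. -/
lemma exists_isMinimizingDensity (hδ : 0 < δ) (x t : ℝ) :
    ∃ ρ, IsMinimizingDensity δ u₀ xm x t ρ := by
  have hfin := hu.isFiniteMeasure_weylMeasure hδ
  set m := weylMeasure δ u₀ xm with hm
  set w := rhoWeyl δ u₀ xm with hw
  set C : Set (Lp ℝ 2 m) := {φ | ∀ᵐ κ ∂m, 0 ≤ φ κ ∧ φ κ ≤ 1} with hC
  set J : Lp ℝ 2 m → ℝ := fun φ => energy δ u₀ xm x t (w * φ) with hJ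
  have hone : MemLp (fun _ : ℝ => (1 : ℝ)) 2 m := memLp_const 1
  have hC_eq : C = Icc 0 (hone.toLp _) := by
    ext φ
    rw [mem_Icc, ← Lp.coeFn_nonneg, ← Lp.coeFn_le]
    constructor
    · intro (h : ∀ᵐ κ ∂m, 0 ≤ φ κ ∧ φ κ ≤ 1)
      refine ⟨h.mono fun κ hκ => hκ.1, ?_⟩
      filter_upwards [h, hone.coeFn_toLp] with κ h1 h2
      rw [h2]
      exact h1.2
    · rintro ⟨h1, h2⟩
      change ∀ᵐ κ ∂m, 0 ≤ φ κ ∧ φ κ ≤ 1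
      filter_upwards [h1, h2, hone.coeFn_toLp] with κ h3 h4 h5
      rw [h5] at h4
      exact ⟨h3, h4⟩
  have hmem : ∀ φ ∈ C, w * φ ∈ admissibleDensities δ u₀ xm := by
    intro φ hφ
    refine ⟨((measurable_rhoWeyl δ u₀ xm).mul (Lp.stronglyMeasurable φ).measurable).aemeasurable,
      ?_⟩
    filter_upwards [hu.ae_of_ae_weylMeasure hδ hφ, hu.rhoWeyl_nonneg hδ] with κ h1 h2
    rw [Pi.mul_apply]
    rcases h1 with h1 | h1
    · rw [hw, h1]
      simp
    · exact ⟨mul_nonneg h2 h1.1, mul_le_of_le_one_right h2 h1.2⟩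
  have hlin : ∀ (φ ψ : Lp ℝ 2 m) (a b : ℝ), w * ⇑(a • φ + b • ψ) =ᵐ[kappaMeasure δ u₀ xm]
      a • (w * ⇑φ) + b • (w * ⇑ψ) := by
    intro φ ψ a b
    have : ⇑(a • φ + b • ψ) =ᵐ[m] a • ⇑φ + b • ⇑ψ := by
      filter_upwards [Lp.coeFn_add (a • φ) (b • ψ), Lp.coeFn_smul a φ, Lp.coeFn_smul b ψ]
        with κ h1 h2 h3
      rw [h1, Pi.add_apply, Pi.add_apply, h2, h3]
    refine (hu.rhoWeyl_mul_congr_ae hδ this).trans (Eventually.of_forall fun κ => ?_)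
    simp only [Pi.mul_apply, Pi.add_apply, Pi.smul_apply, smul_eq_mul]
    ring
  have hCconv : Convex ℝ C := by
    intro φ hφ ψ hψ a b ha hb hab
    change ∀ᵐ κ ∂m, 0 ≤ (a • φ + b • ψ : Lp ℝ 2 m) κ ∧ (a • φ + b • ψ : Lp ℝ 2 m) κ ≤ 1
    filter_upwards [hφ, hψ, Lp.coeFn_add (a • φ) (b • ψ), Lp.coeFn_smul a φ, Lp.coeFn_smul b ψ]
      with κ h1 h2 h3 h4 h5
    rw [h3, Pi.add_apply, h4, h5, Pi.smul_apply, Pi.smul_apply, smul_eq_mul, smul_eq_mul]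
    constructor
    · exact add_nonneg (mul_nonneg ha h1.1) (mul_nonneg hb h2.1)
    · nlinarith [mul_le_mul_of_nonneg_left h1.2 ha, mul_le_mul_of_nonneg_left h2.2 hb]
  have hJconv : ConvexOn ℝ C J := by
    refine ⟨hCconv, fun φ hφ ψ hψ a b ha hb hab => ?_⟩
    simp only [hJ]
    rw [energy_congr_ae (hlin φ ψ a b)]
    exact (hu.convexOn_energy hδ x t).2 (hmem φ hφ) (hmem ψ hψ) ha hb hab
  have hJcont : ContinuousOn J C := by
    obtain ⟨c, hc⟩ := hu.exists_energy_lipschitz hδ x t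
    set M := ((m univ) ^ ((1 : ENNReal).toReal⁻¹ - (2 : ENNReal).toReal⁻¹)).toReal with hM
    have hnorm : ∀ φ ∈ C, ∀ ψ ∈ C, ∫ κ, |(w * ⇑φ - w * ⇑ψ) κ| ∂(kappaMeasure δ u₀ xm) ≤
        M * ‖φ - ψ‖ := by
      intro φ hφ ψ hψ
      have h1 : ∫ κ, |(w * ⇑φ - w * ⇑ψ) κ| ∂(kappaMeasure δ u₀ xm) =
          ∫ κ, ‖(φ - ψ : Lp ℝ 2 m) κ‖ ∂m := by
        have h2 : (fun κ => ‖(φ - ψ : Lp ℝ 2 m) κ‖) =ᵐ[m] fun κ => ‖φ κ - ψ κ‖ := by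
          filter_upwards [Lp.coeFn_sub φ ψ] with κ hκ
          rw [hκ, Pi.sub_apply]
        rw [integral_congr_ae h2, hu.integral_weylMeasure hδ]
        refine integral_congr_ae ?_
        filter_upwards [hu.rhoWeyl_nonneg hδ] with κ hκ
        simp only [Pi.sub_apply, Pi.mul_apply]
        rw [← mul_sub, abs_mul, abs_of_nonneg hκ, Real.norm_eq_abs]
      have hae := Lp.aestronglyMeasurable (φ - ψ)
      rw [h1, integral_norm_eq_lintegral_enorm hae, ← eLpNorm_one_eq_lintegral_enorm, Lp.norm_def,
        mul_comm, hM, ← ENNReal.toReal_mul]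
      have h3 := eLpNorm_le_eLpNorm_mul_rpow_measure_univ (p := 1) (q := 2) one_le_two hae
      rw [one_div, one_div] at h3
      refine ENNReal.toReal_mono (ENNReal.mul_ne_top (Lp.eLpNorm_ne_top _)
        (ENNReal.rpow_ne_top_of_nonneg ?_ (measure_ne_top m univ))) h3
      norm_num
    refine LipschitzOnWith.continuousOn (K := Real.toNNReal (|c| * M))
      (LipschitzOnWith.of_dist_le_mul fun φ hφ ψ hψ => ?_)
    rw [Real.dist_eq, dist_eq_norm, Real.coe_toNNReal _ (by positivity), mul_assoc]
    refine (hc _ (hmem ψ hψ) _ (hmem φ hφ)).trans ?_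
    exact mul_le_mul (le_abs_self c) (hnorm φ hφ ψ hψ)
      (integral_nonneg fun _ => abs_nonneg _) (abs_nonneg c)
  have hJbdd : BddBelow (J '' C) := by
    obtain ⟨c, hc⟩ := hu.exists_energy_ge hδ x t
    refine ⟨c, ?_⟩
    rintro _ ⟨φ, hφ, rfl⟩
    exact hc _ (hmem φ hφ)
  have hCne : C.Nonempty := by
    refine ⟨0, ?_⟩
    change ∀ᵐ κ ∂m, 0 ≤ (0 : Lp ℝ 2 m) κ ∧ (0 : Lp ℝ 2 m) κ ≤ 1
    filter_upwards [Lp.coeFn_zero ℝ 2 m] with κ hκ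
    rw [hκ]
    simp
  have hCbd : ∃ R, ∀ φ ∈ C, ‖φ‖ ≤ R := by
    refine ⟨‖hone.toLp _‖, fun φ hφ => ?_⟩
    rw [hC_eq] at hφ
    refine norm_le_norm_of_abs_le_abs ?_
    rw [abs_of_nonneg hφ.1]
    exact hφ.2.trans (le_abs_self _)
  obtain ⟨φ, hφ, hmin⟩ := exists_isMinOn_of_convexOn hCne (hC_eq ▸ isClosed_Icc) hCbd hJconv
    hJcont hJbdd
  refine ⟨w * φ, hmem φ hφ, fun σ hσ => ?_⟩
  have hac : m ≪ kappaMeasure δ u₀ xm := withDensity_absolutelyContinuous _ _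
  have hbound : ∀ᵐ κ ∂m, 0 ≤ σ κ / w κ ∧ σ κ / w κ ≤ 1 := by
    filter_upwards [hac.ae_le hσ.2, hac.ae_le (hu.rhoWeyl_nonneg hδ)] with κ h1 h2
    exact ⟨div_nonneg h1.1 h2, div_le_one_of_le₀ h1.2 h2⟩
  have hψ : MemLp (fun κ => σ κ / w κ) 2 m := by
    refine MemLp.of_bound ((hσ.1.div
      (measurable_rhoWeyl δ u₀ xm).aemeasurable).mono_ac hac).aestronglyMeasurable 1 ?_
    filter_upwards [hbound] with κ hκ
    rw [Real.norm_of_nonneg hκ.1]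
    exact hκ.2
  have hψC : hψ.toLp _ ∈ C := by
    change ∀ᵐ κ ∂m, 0 ≤ hψ.toLp _ κ ∧ hψ.toLp _ κ ≤ 1
    filter_upwards [hbound, hψ.coeFn_toLp] with κ h1 h2
    rw [h2]
    exact h1
  have hσeq : w * ⇑(hψ.toLp _) =ᵐ[kappaMeasure δ u₀ xm] σ := by
    refine (hu.rhoWeyl_mul_congr_ae hδ hψ.coeFn_toLp).trans ?_
    filter_upwards [hσ.2] with κ hκ
    rw [Pi.mul_apply]
    -- Where `ρ^Wyl` vanishes, admissibility forces `σ = 0`, so nothing is lost in the quotient `σ /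
    -- w`.
    rcases eq_or_ne (w κ) 0 with h0 | h0
    · rw [← hw, h0] at hκ
      rw [← hw, h0, zero_mul]
      exact le_antisymm hκ.1 hκ.2
    · exact mul_div_cancel₀ _ h0
  have := hmin hψC
  change energy δ u₀ xm x t _ ≤ energy δ u₀ xm x t _ at this
  rwa [energy_congr_ae hσeq] at this

end IsAdmissibleInitialCondition

end ILW

namespace ILW

variable {δ : ℝ} {u₀ : ℝ → ℝ} {xm : ℝ}

namespace IsAdmissibleInitialCondition

variable (hu : IsAdmissibleInitialCondition u₀ xm)
include hu

/-! ### The Fréchet derivative of the energy -/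

/-- The interaction energy is `o(‖g‖₁)` on densities dominated by the Weyl density. -/
lemma exists_interaction_le (hδ : 0 < δ) {ε : ℝ} (hε : 0 < ε) : ∃ r > 0, ∀ g,
    IsWeylDominated δ u₀ xm g → ∫ κ, |g κ| ∂(kappaMeasure δ u₀ xm) < r →
      |∫ κ, kernelPotential δ u₀ xm g κ * g κ ∂(kappaMeasure δ u₀ xm)| ≤
        ε * ∫ κ, |g κ| ∂(kappaMeasure δ u₀ xm) := by
  obtain ⟨C, hC, h⟩ := hu.exists_kernelPotential_bound hδ
  have hlim : Tendsto (fun T : ℝ => C * Real.exp (-(1 / 8) * T)) atTop (𝓝 0) := by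
    have h1 : Tendsto (fun T : ℝ => -(1 / 8) * T) atTop atBot :=
      tendsto_id.const_mul_atTop_of_neg (by norm_num)
    simpa using (Real.tendsto_exp_atBot.comp h1).const_mul C
  -- First `T` makes the exponential tail smaller than `ε / 2`; then `r = ε / (2T)` makes `T ‖g‖₁`
  -- smaller than `ε / 2`.
  obtain ⟨T, hT, hT0⟩ := ((hlim.eventually (gt_mem_nhds (half_pos hε))).and
    (eventually_gt_atTop 0)).exists
  refine ⟨ε / 2 / T, by positivity, fun g hg hr => ?_⟩
  refine hu.abs_interaction_le hδ hg fun κ hκ => (h g hg T hT0.le κ hκ).trans ?_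
  rw [lt_div_iff₀ hT0] at hr
  linarith

lemma isFrechetDerivativeOfEnergy (hδ : 0 < δ) (x t : ℝ) (ρ : Lp ℝ 1 (kappaMeasure δ u₀ xm))
    (hρ : (ρ : ℝ → ℝ) ∈ admissibleDensities δ u₀ xm) :
    IsFrechetDerivativeOfEnergy δ u₀ xm x t ρ := by
  have hρd := isWeylDominated_of_mem hρ
  obtain ⟨C, hC⟩ := hu.exists_energyDerivative_bound hδ x t
  have hint : ∀ h : Lp ℝ 1 (kappaMeasure δ u₀ xm),
      Integrable (fun κ => energyDerivative δ u₀ xm x t ρ (quadZeta δ κ) * h κ)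
        (kappaMeasure δ u₀ xm) := fun h =>
    hu.integrable_energyDerivative_mul hδ x t hρd (L1.integrable_coeFn h)
  let D₀ : Lp ℝ 1 (kappaMeasure δ u₀ xm) →ₗ[ℝ] ℝ :=
    { toFun := fun h => ∫ κ, energyDerivative δ u₀ xm x t ρ (quadZeta δ κ) * h κ
        ∂(kappaMeasure δ u₀ xm)
      map_add' := fun g h => by
        rw [← integral_add (hint g) (hint h)]
        refine integral_congr_ae ?_
        filter_upwards [Lp.coeFn_add g h] with κ hκ
        rw [hκ, Pi.add_apply, mul_add]
      map_smul' := fun c h => by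
        rw [RingHom.id_apply, smul_eq_mul, ← integral_const_mul]
        refine integral_congr_ae ?_
        filter_upwards [Lp.coeFn_smul c h] with κ hκ
        rw [hκ, Pi.smul_apply, smul_eq_mul]
        ring }
  let D : Lp ℝ 1 (kappaMeasure δ u₀ xm) →L[ℝ] ℝ := D₀.mkContinuous C fun h => by
    rw [L1.norm_eq_integral_norm, ← integral_const_mul]
    refine norm_integral_le_of_norm_le ((L1.integrable_coeFn h).norm.const_mul C) ?_
    filter_upwards [hC ρ hρd] with κ hκ
    rw [norm_mul]
    exact mul_le_mul_of_nonneg_right hκ (norm_nonneg _)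
  have hD : ∀ h, D h = ∫ κ, energyDerivative δ u₀ xm x t ρ (quadZeta δ κ) * h κ
      ∂(kappaMeasure δ u₀ xm) := fun h => rfl
  refine ⟨D, fun h => ⟨hint h, hD h⟩, HasFDerivWithinAt.of_isLittleO ?_⟩
  rw [Asymptotics.isLittleO_iff]
  intro c hc
  -- The remainder is exactly `1 / (2π)` times the interaction energy of `σ - ρ`, hence the
  -- tolerance `2πc`.
  obtain ⟨r, hr, hsmall⟩ := hu.exists_interaction_le hδ (by positivity : 0 < 2 * Real.pi * c)
  filter_upwards [self_mem_nhdsWithin, mem_nhdsWithin_of_mem_nhds (Metric.ball_mem_nhds ρ hr)]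
    with σ hσ hball
  have hsub := Lp.coeFn_sub σ ρ
  have hnorm : ∫ κ, |((σ : ℝ → ℝ) - ρ) κ| ∂(kappaMeasure δ u₀ xm) = ‖σ - ρ‖ := by
    rw [L1.norm_eq_integral_norm]
    refine integral_congr_ae ?_
    filter_upwards [hsub] with κ hκ
    rw [hκ, Real.norm_eq_abs]
  have hDeq : D (σ - ρ) = ∫ κ, energyDerivative δ u₀ xm x t ρ (quadZeta δ κ) *
      ((σ : ℝ → ℝ) - ρ) κ ∂(kappaMeasure δ u₀ xm) := by
    rw [hD]
    refine integral_congr_ae ?_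
    filter_upwards [hsub] with κ hκ
    rw [hκ]
  have hlt : ∫ κ, |((σ : ℝ → ℝ) - ρ) κ| ∂(kappaMeasure δ u₀ xm) < r := by
    rw [hnorm, ← dist_eq_norm]
    exact hball
  have h1 := hsmall _ (isWeylDominated_sub hσ hρ) hlt
  rw [hDeq, hu.energy_eq_add hδ x t hρ hσ, add_assoc, add_sub_cancel_left, add_sub_cancel_left,
    Real.norm_eq_abs, abs_mul, abs_of_pos (by positivity : 0 < 1 / (2 * Real.pi)), ← hnorm,
    one_div, inv_mul_le_iff₀ (by positivity), ← mul_assoc]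
  exact h1

end IsAdmissibleInitialCondition

end ILW

theorem mainTheorem4 (δ : ℝ) (hδ : 0 < δ) (u₀ : ℝ → ℝ) (xm : ℝ)
    (hu₀ : ILW.IsAdmissibleInitialCondition u₀ xm) (x t : ℝ) :
    -- the potential and the energy of every admissible density are finite
    (∀ ρ ∈ ILW.admissibleDensities δ u₀ xm,
      (∀ κ ∈ Set.Icc 0 (ILW.kappaMax δ u₀ xm),
        MeasureTheory.Integrable
          (fun η => ILW.logKernel δ (ILW.quadZeta δ κ) η * ρ η) (ILW.kappaMeasure δ u₀ xm)) ∧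
      MeasureTheory.Integrable (ILW.energyDensity δ u₀ xm x t ρ) (ILW.kappaMeasure δ u₀ xm)) ∧
    -- there is a minimizing density
    (∃ ρmin : ℝ → ℝ, ILW.IsMinimizingDensity δ u₀ xm x t ρmin) ∧
    -- it is unique
    (∀ ρ₁ ρ₂ : ℝ → ℝ, ILW.IsMinimizingDensity δ u₀ xm x t ρ₁ →
      ILW.IsMinimizingDensity δ u₀ xm x t ρ₂ → ρ₁ =ᵐ[ILW.kappaMeasure δ u₀ xm] ρ₂) ∧
    -- it is characterized by the variational conditions
    (∀ ρ ∈ ILW.admissibleDensities δ u₀ xm,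
      ILW.IsMinimizingDensity δ u₀ xm x t ρ ↔ ILW.VariationalConditions δ u₀ xm x t ρ) ∧
    -- the function in these conditions is the Fréchet derivative of the energy
    (∀ ρ : MeasureTheory.Lp ℝ 1 (ILW.kappaMeasure δ u₀ xm),
      (ρ : ℝ → ℝ) ∈ ILW.admissibleDensities δ u₀ xm →
        ILW.IsFrechetDerivativeOfEnergy δ u₀ xm x t ρ) := by
  have hdom : ∀ ρ ∈ ILW.admissibleDensities δ u₀ xm, ILW.IsWeylDominated δ u₀ xm ρ :=
    fun ρ hρ => ILW.isWeylDominated_of_mem hρ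
  refine ⟨fun ρ hρ => ⟨fun κ hκ => hu₀.integrable_kernel_mul hδ (hdom ρ hρ) hκ,
    hu₀.integrable_energyDensity hδ x t (hdom ρ hρ)⟩, hu₀.exists_isMinimizingDensity hδ x t,
    fun ρ₁ ρ₂ h₁ h₂ => hu₀.isMinimizingDensity_unique hδ x t h₁ h₂, fun ρ hρ => ?_,
    fun ρ hρ => hu₀.isFrechetDerivativeOfEnergy hδ x t ρ hρ⟩
  rw [hu₀.isMinimizingDensity_iff hδ x t hρ, hu₀.variationalConditions_iff hδ x t hρ]
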